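/- Let $d\ge 1$, let $\mathbb T^d=\mathbb R^d/2\pi\mathbb Z^d$, let $\nu>0$, and let $f=P+g$, where $P:\mathbb R\to\mathbb R$ is a polynomial of degree $p\ge 2$ and $g:\mathbb R\to\mathbb R$ is a bounded $C^\infty$ function all of whose derivatives are bounded. Let $s>d/2$ be an integer. Write $H^\sigma=H^\sigma(\mathbb T^d)$ for the Sobolev space of real-valued functions of order $\sigma$, with norm $\|\cdot\|_\sigma$, put $J_T=[0,T]$, and let $\mathcal X_{T,s}=C(J_T,H^s)\cap L^2(J_T,H^{s+1})$ with norm $\|u\|_{\mathcal X_{T,s}}=\|u\|_{C(J_T,H^s)}+\|u\|_{L^2(J_T,H^{s+1})}$. Consider the problem $$\partial_t u-\nu\Delta(u+\zeta)+f(u+\zeta)=\varphi\ \text{ on } \mathbb T^d,\qquad u(0)=u_0. \tag{1}$$ **Proposition 1.1.** Let $\hat u_0\in H^s$, $\hat\zeta\in C(\mathbb R_+,H^{s+1})$ and $\hat\varphi\in L^2_{loc}(\mathbb R_+,H^{s-1})$. There are a maximal time $T_*=T_*(\hat u_0,\hat\zeta,\hat\varphi)\in(0,+\infty]$ and a unique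 solution $\hat u$ of (1) with $(u_0,\zeta,\varphi)=(\hat u_0,\hat\zeta,\hat\varphi)$, defined on $[0,T_*)$, whose restriction to $J_T$ belongs to $\mathcal X_{T,s}$ for every $0<T<T_*$. Moreover, every solution of this problem in $\mathcal X_{T,s}$, for any $T>0$, satisfies $T<T_*$ and coincides with $\hat u$ on $J_T$. If $T_*<\infty$, then $\|\hat u(t)\|_s\to+\infty$ as $t\to T_*^-$. Furthermore, for every $0<T<T_*$ there are positive constants $\delta=\delta(T,\Lambda)$ and $C=C(T,\Lambda)$, which (for fixed $d,s,\nu,f$) depend only on $T$ and on $$\Lambda=\|\hat\zeta\|_{C(J_T,H^{s+1})}+\|\hat\varphi\|_{L^2(J_T,H^{s-1})}+\|\hat u\|_{\mathcal X_{T,s}}<\infty,$$ such that the following holds for all $u_0\in H^s$, $\zeta\in C(J_T,H^{s+1})$ and $\varphi\in L^2(J_T,H^{s-1})$ with $$D:=\|u_0-\hat u_0\|_s+\|\zeta-\hat\zeta\|_{C(J_T,H^{s+1})}+\|\varphi-\hat\varphi\|_{L^2(J_T,H^{s-1})}<\delta:$$ (i) problem (1) has a unique solution $u\in\mathcal X_{T,s}$;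 (ii) this solution satisfies $\|u-\hat u\|_{\mathcal X_{T,s}}\le C\,D$. -/

import Mathlib

open MeasureTheory Set Filter Topology
open scoped ENNReal NNReal ContDiff

noncomputable section

namespace ParabolicTorus

/-- The torus `𝕋^d = ℝ^d / 2πℤ^d`, with its Lebesgue measure `volume` (total mass `(2π)^d`). -/
abbrev Torus (d : ℕ) : Type := Fin d → AddCircle (2 * Real.pi)

instance factTwoPiPos : Fact (0 < 2 * Real.pi) := ⟨Real.two_pi_pos⟩

/-- Real-valued square integrable functions on the torus (modulo equality a.e.). All Sobolev spaces
below have a nonnegative order and are subspaces of this space. -/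
abbrev L2 (d : ℕ) : Type := Lp ℝ 2 (volume : Measure (Torus d))

/-- The squared Euclidean length `|k|²` of a frequency. -/
def freqSq {d : ℕ} (k : Fin d → ℤ) : ℝ := ∑ i, (k i : ℝ) ^ 2

/-- The Fourier coefficient `(2π)^{-d} ∫_{𝕋^d} h(x) e^{-i⟨k,x⟩} dx`. Here `fourier n y = e^{i n y}`
on the circle of length `2π`. -/
def coeff {d : ℕ} (h : Torus d → ℝ) (k : Fin d → ℤ) : ℂ :=
  (((2 * Real.pi) ^ d : ℝ) : ℂ)⁻¹ * ∫ x : Torus d, (∏ i, fourier (-(k i)) (x i)) * (h x : ℂ)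

/-- The Sobolev norm `‖v‖_σ = (∑_k (1 + |k|²)^σ |v̂(k)|²)^{1/2}`, infinite when `v ∉ H^σ`. -/
def sobNorm {d : ℕ} (σ : ℕ) (v : L2 d) : ℝ≥0∞ :=
  (∑' k : Fin d → ℤ, ENNReal.ofReal ((1 + freqSq k) ^ σ * ‖coeff v k‖ ^ 2)) ^ (1 / 2 : ℝ)

/-- Membership in the Sobolev space `H^σ(𝕋^d)`. -/
def MemH {d : ℕ} (σ : ℕ) (v : L2 d) : Prop := sobNorm σ v < ⊤

/-- `u ∈ C(I, H^σ)`, for a set `I` of times; the values of `u` outside `I` are irrelevant. -/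
def MemC {d : ℕ} (σ : ℕ) (I : Set ℝ) (u : ℝ → L2 d) : Prop :=
  (∀ t ∈ I, MemH σ (u t)) ∧
    ∀ t₀ ∈ I, Tendsto (fun t => sobNorm σ (u t - u t₀)) (𝓝[I] t₀) (𝓝 0)

/-- The norm of `C([0,T], H^σ)`. -/
def normC {d : ℕ} (σ : ℕ) (T : ℝ) (u : ℝ → L2 d) : ℝ≥0∞ :=
  ⨆ t ∈ Icc (0 : ℝ) T, sobNorm σ (u t)

/-- The norm of `L²([0,T], H^σ)`. -/
def normL2 {d : ℕ} (σ : ℕ) (T : ℝ) (u : ℝ → L2 d) : ℝ≥0∞ :=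
  (∫⁻ t in Icc (0 : ℝ) T, sobNorm σ (u t) ^ 2) ^ (1 / 2 : ℝ)

/-- `u ∈ L²([0,T], H^σ)`: measurable in time, with finite norm (so `u t ∈ H^σ` for a.e. `t`). -/
def MemL2 {d : ℕ} (σ : ℕ) (T : ℝ) (u : ℝ → L2 d) : Prop :=
  AEStronglyMeasurable u (volume.restrict (Icc (0 : ℝ) T)) ∧ normL2 σ T u < ⊤

/-- `u ∈ L²_loc(ℝ₊, H^σ)`. -/
def MemL2loc {d : ℕ} (σ : ℕ) (u : ℝ → L2 d) : Prop := ∀ T : ℝ, 0 < T → MemL2 σ T u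

/-- `u ∈ 𝒳_{T,s} = C([0,T], H^s) ∩ L²([0,T], H^{s+1})`. -/
def MemX {d : ℕ} (s : ℕ) (T : ℝ) (u : ℝ → L2 d) : Prop :=
  MemC s (Icc 0 T) u ∧ MemL2 (s + 1) T u

/-- The norm of `𝒳_{T,s}`. -/
def normX {d : ℕ} (s : ℕ) (T : ℝ) (u : ℝ → L2 d) : ℝ≥0∞ :=
  normC s T u + normL2 (s + 1) T u

/-- `u` is a solution in `𝒳_{T,s}`, on the time interval `[0,T]`, of
`∂ₜu - νΔ(u + ζ) + f(u + ζ) = φ`, `u(0) = u₀`. The equation is understood in the sense of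
distributions on the torus, integrated in time: it is tested against every character
`x ↦ e^{-i⟨k,x⟩}`, `k ∈ ℤ^d`, on which `Δ` acts as multiplication by `-|k|²`. For `u` and data in the
spaces considered here (with `s > d/2`) all the integrals converge. -/
structure IsSolution {d : ℕ} (s : ℕ) (ν : ℝ) (f : ℝ → ℝ) (T : ℝ) (u₀ : L2 d) (ζ φ : ℝ → L2 d)
    (u : ℝ → L2 d) : Prop where
  memX : MemX s T u
  initial : u 0 = u₀
  equation : ∀ t ∈ Icc (0 : ℝ) T, ∀ k : Fin d → ℤ,
    coeff (u t) k = coeff u₀ k +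
      ∫ τ in (0 : ℝ)..t,
        (-((ν * freqSq k : ℝ) : ℂ) * coeff (u τ + ζ τ : L2 d) k
          - coeff (fun x => f ((u τ + ζ τ : L2 d) x)) k
          + coeff (φ τ) k)

/-- The distance between two triples of data, in `H^s × C([0,T], H^{s+1}) × L²([0,T], H^{s-1})`
(used only for `s ≥ 1`). -/
def dataDist {d : ℕ} (s : ℕ) (T : ℝ) (u₀ : L2 d) (ζ φ : ℝ → L2 d) (u₀' : L2 d)
    (ζ' φ' : ℝ → L2 d) : ℝ≥0∞ :=
  sobNorm s (u₀ - u₀') + normC (s + 1) T (ζ - ζ') + normL2 (s - 1) T (φ - φ')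

/-- The quantity `Λ = ‖ζ‖_{C([0,T],H^{s+1})} + ‖φ‖_{L²([0,T],H^{s-1})} + ‖u‖_{𝒳_{T,s}}`. -/
def size {d : ℕ} (s : ℕ) (T : ℝ) (ζ φ u : ℝ → L2 d) : ℝ≥0∞ :=
  normC (s + 1) T ζ + normL2 (s - 1) T φ + normX s T u

end ParabolicTorus

end

open ParabolicTorus

/-! The problem is solved by truncating the nonlinearity, and everything is done on Fourier
coefficients, where `H^σ` is a weighted `ℓ²` space (`wsq`).

*Nonlinearity.* For an integer `s > d/2`, the map `v ↦ f(v)` is Lipschitz on bounded sets of `H^s`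
(`exists_wsq_comp_sub_le`), whatever the smooth function `f`. This follows from the embedding
`H^s ⊆ L^∞` (`ae_enorm_sq_le`), the product law (`wsq_coeff_mul_le`), and the chain rule for weak
derivatives (`IsWeakDeriv.coeff_comp`, by polynomial approximation), in finitely many steps each of
which gains a quarter of a derivative.

*Linear part.* Each Fourier coefficient of a solution is given by Duhamel's formula. Summing the
bounds for the single modes, the heat equation gains one derivative from the forcing term in
`C(H^σ)` and two in `L²(H^{σ+1})` (`IsLinSol.wsq_le`, `IsLinSol.lintegral_wsq_le`), and its
solutions are continuous in time (`IsLinSol.tendsto_wsq`).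

*Truncation.* Replacing `u` by its radial retraction to a ball of `H^s` inside the nonlinearity
makes the latter globally Lipschitz. The truncated problem has a solution on every time interval,
the fixed point of a Volterra map (`exists_solves_trunc`), and by Gronwall's inequality its solutions
depend Lipschitz continuously on the data in the norm of `𝒳_{T,s}` (`exists_normX_sub_le`). As long
as a solution stays in the ball, the truncated and the original problem agree.

*Conclusion.* A large ball gives uniqueness (`IsSolution.eqOn`), continuation of a solution beyond
its final time (`IsSolution.exists_extension`) and stability (`exists_stability`); the maximal time
is the supremum of the times up to which there is a solution. If `‖u(t)‖_s` does not tend to infinity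
at a finite maximal time, the linear estimate started at a time close to the maximal one, where
`‖u(t)‖_s` is below a fixed bound, shows that `u` is bounded in `H^s` (`exists_bound_of_frequently`);
the truncated solution then continues `u` up to the maximal time (`exists_isSolution_of_bound`), and
hence beyond it, a contradiction. -/

noncomputable section

namespace ParabolicTorus

open scoped ComplexConjugate

variable {d : ℕ}

/-! ### Fourier analysis on the torus -/

/-- The Haar probability measure on `(ℝ / ℤ)^d`. -/
abbrev unitVol (d : ℕ) : Measure (UnitAddTorus (Fin d)) :=
  Measure.pi fun _ => AddCircle.haarAddCircle

/-- The dilation `(ℝ / ℤ)^d → (ℝ / 2πℤ)^d`. -/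
def dilate (d : ℕ) : UnitAddTorus (Fin d) ≃ₜ Torus d :=
  Homeomorph.piCongrRight fun _ =>
    AddCircle.homeomorphAddCircle 1 (2 * Real.pi) one_ne_zero Real.two_pi_pos.ne'

lemma map_haarAddCircle_dilate :
    Measure.map (AddCircle.homeomorphAddCircle 1 (2 * Real.pi) one_ne_zero Real.two_pi_pos.ne')
      (AddCircle.haarAddCircle : Measure (AddCircle (1 : ℝ))) = AddCircle.haarAddCircle := by
  set e := AddCircle.equivAddCircle 1 (2 * Real.pi) one_ne_zero Real.two_pi_pos.ne'
  set h := AddCircle.homeomorphAddCircle 1 (2 * Real.pi) one_ne_zero Real.two_pi_pos.ne'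
  have h1 : (Measure.map e (AddCircle.haarAddCircle : Measure (AddCircle (1 : ℝ)))).IsAddHaarMeasure :=
    AddEquiv.isAddHaarMeasure_map _ e h.continuous h.symm.continuous
  have h2 : IsProbabilityMeasure
      (Measure.map e (AddCircle.haarAddCircle : Measure (AddCircle (1 : ℝ)))) :=
    Measure.isProbabilityMeasure_map (f := e) (h.continuous.measurable.aemeasurable)
  change Measure.map e _ = _
  exact Measure.isAddHaarMeasure_eq_of_isProbabilityMeasure _ _

lemma volume_torus_eq :
    (volume : Measure (Torus d)) =
      ENNReal.ofReal ((2 * Real.pi) ^ d) • Measure.pi fun _ => AddCircle.haarAddCircle := by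
  symm
  rw [volume_pi]
  refine (Measure.pi_eq fun s hs => ?_).symm
  simp only [Measure.smul_apply, Measure.pi_pi, AddCircle.volume_eq_smul_haarAddCircle, smul_eq_mul,
    Finset.prod_mul_distrib, Finset.prod_const, Finset.card_univ, Fintype.card_fin]
  rw [ENNReal.ofReal_pow Real.two_pi_pos.le]

lemma measurePreserving_dilate :
    MeasurePreserving (dilate d) (unitVol d) (Measure.pi fun _ => AddCircle.haarAddCircle) :=
  measurePreserving_pi _ _ fun _ =>
    ⟨(AddCircle.homeomorphAddCircle 1 (2 * Real.pi) one_ne_zero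
      Real.two_pi_pos.ne').continuous.measurable, map_haarAddCircle_dilate⟩

/-- The complex Fourier coefficient, for complex-valued functions. -/
def ccoeff (F : Torus d → ℂ) (k : Fin d → ℤ) : ℂ :=
  (((2 * Real.pi) ^ d : ℝ) : ℂ)⁻¹ * ∫ x : Torus d, (∏ i, fourier (-(k i)) (x i)) * F x

lemma coeff_eq_ccoeff (h : Torus d → ℝ) (k : Fin d → ℤ) :
    coeff h k = ccoeff (fun x => (h x : ℂ)) k := rfl

lemma two_pi_pow_pos (d : ℕ) : (0 : ℝ) < (2 * Real.pi) ^ d := pow_pos Real.two_pi_pos d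

lemma integral_torus_eq (F : Torus d → ℂ) :
    (((2 * Real.pi) ^ d : ℝ) : ℂ)⁻¹ * ∫ x : Torus d, F x
      = ∫ y, F (dilate d y) ∂(unitVol d) := by
  rw [measurePreserving_dilate.integral_comp (dilate d).measurableEmbedding,
    volume_torus_eq, integral_smul_measure, ENNReal.toReal_ofReal (two_pi_pow_pos d).le,
    Complex.real_smul, inv_mul_cancel_left₀]
  exact_mod_cast (two_pi_pow_pos d).ne'

lemma fourier_dilate (n : ℤ) (x : AddCircle (1 : ℝ)) :
    fourier n (AddCircle.equivAddCircle 1 (2 * Real.pi) one_ne_zero Real.two_pi_pos.ne' x)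
      = fourier n x := by
  induction x using QuotientAddGroup.induction_on with
  | H y =>
    rw [AddCircle.equivAddCircle_apply_mk]
    rw [fourier_coe_apply, fourier_coe_apply]
    congr 1
    have := Real.pi_ne_zero
    push_cast
    field_simp

lemma ccoeff_eq (F : Torus d → ℂ) (k : Fin d → ℤ) :
    ccoeff F k = UnitAddTorus.mFourierCoeff (fun y => F (dilate d y)) k := by
  rw [ccoeff, integral_torus_eq]
  refine integral_congr_ae (Eventually.of_forall fun y => ?_)
  simp only [UnitAddTorus.mFourier, ContinuousMap.coe_mk, smul_eq_mul, Pi.neg_apply]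
  congr 1
  exact Finset.prod_congr rfl fun i _ => fourier_dilate _ _

lemma memLp_dilate_iff (F : Torus d → ℂ) :
    MemLp (fun y => F (dilate d y)) 2 (unitVol d) ↔ MemLp F 2 (volume : Measure (Torus d)) := by
  have h0 := two_pi_pow_pos d
  have h1 : MemLp (fun y => F (dilate d y)) 2 (unitVol d) ↔
      MemLp F 2 (Measure.pi fun _ => AddCircle.haarAddCircle) := by
    rw [← measurePreserving_dilate.map_eq]
    exact ((dilate d).measurableEmbedding.memLp_map_measure_iff).symm
  rw [h1, volume_torus_eq]
  refine ⟨fun h ↦ h.smul_measure (by finiteness), fun h ↦ ?_⟩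
  have := h.smul_measure (c := (ENNReal.ofReal ((2 * Real.pi) ^ d))⁻¹) (by finiteness)
  rwa [smul_smul, ENNReal.inv_mul_cancel (by positivity) (by finiteness), one_smul] at this

lemma mFourierCoeff_toLp' {G : UnitAddTorus (Fin d) → ℂ} (hG : MemLp G 2 (unitVol d))
    (k : Fin d → ℤ) :
    UnitAddTorus.mFourierCoeff (hG.toLp G) k = UnitAddTorus.mFourierCoeff G k :=
  integral_congr_ae (by filter_upwards [hG.coeFn_toLp] with x hx; rw [hx])

/-- Parseval's identity on the torus. -/
lemma hasSum_conj_ccoeff_mul {F G : Torus d → ℂ} (hF : MemLp F 2 (volume : Measure (Torus d)))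
    (hG : MemLp G 2 (volume : Measure (Torus d))) :
    HasSum (fun k => conj (ccoeff F k) * ccoeff G k)
      ((((2 * Real.pi) ^ d : ℝ) : ℂ)⁻¹ * ∫ x, conj (F x) * G x) := by
  have hF' := (memLp_dilate_iff F).2 hF
  have hG' := (memLp_dilate_iff G).2 hG
  have := UnitAddTorus.hasSum_prod_mFourierCoeff (hF'.toLp _) (hG'.toLp _)
  rw [integral_torus_eq]
  convert this using 1
  · ext k
    rw [mFourierCoeff_toLp', mFourierCoeff_toLp', ccoeff_eq, ccoeff_eq]
  · refine integral_congr_ae ?_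
    filter_upwards [hF'.coeFn_toLp, hG'.coeFn_toLp] with x h1 h2
    rw [h1, h2]

/-- Riesz–Fischer: every square summable family is the family of Fourier coefficients of a square
integrable function. -/
lemma exists_ccoeff_eq {a : (Fin d → ℤ) → ℂ} (ha : Summable fun k => ‖a k‖ ^ 2) :
    ∃ F : Torus d → ℂ, MemLp F 2 (volume : Measure (Torus d)) ∧ ∀ k, ccoeff F k = a k := by
  have ha' : Memℓp a 2 := by
    rw [memℓp_gen_iff (by norm_num)]
    simpa using ha
  set V := (UnitAddTorus.mFourierBasis (d := Fin d)).repr.symm ⟨a, ha'⟩ with hV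
  have hVk : ∀ k, UnitAddTorus.mFourierCoeff V k = a k := fun k => by
    rw [← UnitAddTorus.mFourierBasis_repr, hV, LinearIsometryEquiv.apply_symm_apply]
  refine ⟨fun x => V ((dilate d).symm x), (memLp_dilate_iff _).1 ?_, fun k => ?_⟩
  · simp only [Homeomorph.symm_apply_apply]
    exact Lp.memLp V
  · rw [ccoeff_eq]
    simp only [Homeomorph.symm_apply_apply]
    exact hVk k

/-- A square integrable function with summable Fourier coefficients is bounded by their sum. -/
lemma ae_norm_le_tsum_ccoeff {F : Torus d → ℂ} (hF : MemLp F 2 (volume : Measure (Torus d)))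
    (hs : Summable fun k => ‖ccoeff F k‖) :
    ∀ᵐ x : Torus d, ‖F x‖ ≤ ∑' k, ‖ccoeff F k‖ := by
  have hF' := (memLp_dilate_iff F).2 hF
  set a : (Fin d → ℤ) → ℂ := ccoeff F
  have hsum : Summable fun k => a k • UnitAddTorus.mFourier k := by
    refine Summable.of_norm ?_
    simpa only [norm_smul, UnitAddTorus.mFourier_norm, mul_one] using hs
  set G : C(UnitAddTorus (Fin d), ℂ) := ∑' k, a k • UnitAddTorus.mFourier k with hG
  have h1 := UnitAddTorus.hasSum_mFourier_series_L2 (hF'.toLp _)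
  have h2 := hsum.hasSum.mapL (ContinuousMap.toLp (E := ℂ) 2 (unitVol d) ℂ)
  have h3 : hF'.toLp _ = ContinuousMap.toLp (E := ℂ) 2 (unitVol d) ℂ G := by
    refine h1.unique ?_
    refine h2.congr_fun fun k => ?_
    rw [mFourierCoeff_toLp', ← ccoeff_eq, map_smul]
    rfl
  have h4 : ∀ᵐ y ∂(unitVol d), ‖F (dilate d y)‖ ≤ ∑' k, ‖a k‖ := by
    filter_upwards [hF'.coeFn_toLp, ContinuousMap.coeFn_toLp (𝕜 := ℂ) (p := 2) (unitVol d) G]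
      with y hy1 hy2
    rw [← hy1, h3, hy2]
    refine (G.norm_coe_le_norm y).trans (tsum_of_norm_bounded hs.hasSum fun k => ?_)
    rw [norm_smul, UnitAddTorus.mFourier_norm, mul_one]
  rw [volume_torus_eq, ← measurePreserving_dilate.map_eq]
  refine Measure.ae_smul_measure ?_ _
  exact ((dilate d).measurableEmbedding.ae_map_iff).2 h4

/-! ### Real-valued functions -/

lemma memLp_ofReal {u : Torus d → ℝ} (hu : MemLp u 2 (volume : Measure (Torus d))) :
    MemLp (fun x => (u x : ℂ)) 2 (volume : Measure (Torus d)) := hu.ofReal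

lemma coeff_congr_ae {u v : Torus d → ℝ} (h : u =ᵐ[volume] v) : coeff u = coeff v := by
  ext k
  unfold coeff
  congr 1
  refine integral_congr_ae ?_
  filter_upwards [h] with x hx
  rw [hx]

lemma continuous_char (k : Fin d → ℤ) :
    Continuous fun x : Torus d => ∏ i, (fourier (k i) (x i) : ℂ) := by fun_prop

lemma norm_char (k : Fin d → ℤ) (x : Torus d) : ‖∏ i, (fourier (k i) (x i) : ℂ)‖ = 1 := by
  simp only [norm_prod, fourier_apply, Circle.norm_coe, Finset.prod_const_one]

lemma integrable_char_mul {F : Torus d → ℂ} (hF : Integrable F) (k : Fin d → ℤ) :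
    Integrable fun x => (∏ i, (fourier (k i) (x i) : ℂ)) * F x :=
  hF.bdd_mul (continuous_char k).aestronglyMeasurable
    (Eventually.of_forall fun x => (norm_char k x).le)

lemma ccoeff_add {F G : Torus d → ℂ} (hF : Integrable F) (hG : Integrable G) (k : Fin d → ℤ) :
    ccoeff (fun x => F x + G x) k = ccoeff F k + ccoeff G k := by
  unfold ccoeff
  rw [← mul_add, ← integral_add (integrable_char_mul hF fun i => -(k i))
    (integrable_char_mul hG fun i => -(k i))]
  simp only [mul_add]

lemma coeff_add {u v : Torus d → ℝ} (hu : Integrable u) (hv : Integrable v) (k : Fin d → ℤ) :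
    coeff (fun x => u x + v x) k = coeff u k + coeff v k := by
  have := ccoeff_add (F := fun x => (u x : ℂ)) (G := fun x => (v x : ℂ)) hu.ofReal hv.ofReal k
  simp only [coeff_eq_ccoeff, Complex.ofReal_add]
  exact this

lemma coeff_smul (c : ℝ) (u : Torus d → ℝ) (k : Fin d → ℤ) :
    coeff (fun x => c * u x) k = c * coeff u k := by
  unfold coeff
  rw [mul_left_comm (c : ℂ), ← integral_const_mul (c : ℂ)]
  congr 1
  refine integral_congr_ae (Eventually.of_forall fun x => ?_)
  push_cast
  ring

lemma coeff_sub {u v : Torus d → ℝ} (hu : Integrable u) (hv : Integrable v) (k : Fin d → ℤ) :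
    coeff (fun x => u x - v x) k = coeff u k - coeff v k := by
  have := coeff_add hu (hv.const_mul (-1)) k
  rw [coeff_smul] at this
  convert this using 1
  · simp [sub_eq_add_neg]
  · push_cast; ring

lemma norm_coeff_le (u : Torus d → ℝ) (k : Fin d → ℤ) :
    ‖coeff u k‖ ≤ ((2 * Real.pi) ^ d)⁻¹ * ∫ x, |u x| := by
  have h0 := two_pi_pow_pos d
  unfold coeff
  rw [norm_mul, norm_inv, Complex.norm_real, Real.norm_of_nonneg h0.le]
  gcongr
  refine (norm_integral_le_integral_norm _).trans (le_of_eq ?_)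
  refine integral_congr_ae (Eventually.of_forall fun x => ?_)
  dsimp only
  rw [norm_mul, norm_char (fun i => -(k i)) x, one_mul, Complex.norm_real, Real.norm_eq_abs]

lemma conj_char (k : Fin d → ℤ) (x : Torus d) :
    conj (∏ i, (fourier (k i) (x i) : ℂ)) = ∏ i, (fourier (-(k i)) (x i) : ℂ) := by
  rw [map_prod]
  exact Finset.prod_congr rfl fun i _ => fourier_neg.symm

lemma coeff_neg_eq_conj (u : Torus d → ℝ) (k : Fin d → ℤ) : coeff u (-k) = conj (coeff u k) := by
  unfold coeff
  rw [map_mul, ← integral_conj, ← Complex.ofReal_inv, Complex.conj_ofReal]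
  congr 1
  refine integral_congr_ae (Eventually.of_forall fun x => ?_)
  dsimp only
  rw [map_mul, Complex.conj_ofReal, conj_char (fun i => -(k i))]
  rfl

/-- Parseval's identity for the norms. -/
lemma hasSum_norm_coeff_sq {u : Torus d → ℝ} (hu : MemLp u 2 (volume : Measure (Torus d))) :
    HasSum (fun k => ‖coeff u k‖ ^ 2) (((2 * Real.pi) ^ d)⁻¹ * ∫ x, u x ^ 2) := by
  have h := hasSum_conj_ccoeff_mul (memLp_ofReal hu) (memLp_ofReal hu)
  have h2 : (((2 * Real.pi) ^ d : ℝ) : ℂ)⁻¹ * ∫ x : Torus d, conj ((u x : ℂ)) * (u x : ℂ)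
      = (((((2 * Real.pi) ^ d)⁻¹ * ∫ x, u x ^ 2 : ℝ)) : ℂ) := by
    push_cast
    congr 1
    rw [← integral_complex_ofReal]
    refine integral_congr_ae (Eventually.of_forall fun x => ?_)
    simp [sq]
  rw [h2] at h
  have h3 : (fun k => conj (ccoeff (fun x => (u x : ℂ)) k) * ccoeff (fun x => (u x : ℂ)) k)
      = fun k => ((‖coeff u k‖ ^ 2 : ℝ) : ℂ) := by
    ext k
    rw [Complex.conj_mul', coeff_eq_ccoeff]
    push_cast; rfl
  rw [h3] at h
  exact_mod_cast h

lemma coeff_injective {u v : Torus d → ℝ} (hu : MemLp u 2 (volume : Measure (Torus d)))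
    (hv : MemLp v 2 (volume : Measure (Torus d))) (h : coeff u = coeff v) : u =ᵐ[volume] v := by
  have hi : ∀ {w : Torus d → ℝ}, MemLp w 2 (volume : Measure (Torus d)) → Integrable w :=
    fun hw => hw.integrable (by norm_num)
  have hs := hasSum_norm_coeff_sq (hu.sub hv)
  have h0 : ∀ k, coeff (u - v) k = 0 := fun k => by
    have := coeff_sub (hi hu) (hi hv) k
    rw [h, sub_self] at this
    exact this
  simp only [h0, norm_zero, ne_eq, OfNat.ofNat_ne_zero, not_false_eq_true, zero_pow] at hs
  have h1 := hs.unique hasSum_zero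
  have h2 : ∫ x, (u - v) x ^ 2 = 0 := by
    have := two_pi_pow_pos d
    rcases mul_eq_zero.1 h1 with h | h
    · exact absurd h (by positivity)
    · exact h
  rw [integral_eq_zero_iff_of_nonneg (fun x => sq_nonneg _) (hu.sub hv).integrable_sq] at h2
  filter_upwards [h2] with x hx
  simpa [sub_eq_zero] using hx

/-- Riesz–Fischer for real-valued functions. -/
lemma exists_L2_coeff_eq {a : (Fin d → ℤ) → ℂ} (ha : Summable fun k => ‖a k‖ ^ 2)
    (hconj : ∀ k, a (-k) = conj (a k)) : ∃ v : L2 d, ∀ k, coeff v k = a k := by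
  obtain ⟨F, hF, hFa⟩ := exists_ccoeff_eq ha
  -- the real part of `F` has the same coefficients, by the symmetry of `a`
  have hre : MemLp (fun x => (F x).re) 2 (volume : Measure (Torus d)) := hF.re
  refine ⟨hre.toLp _, fun k => ?_⟩
  rw [coeff_congr_ae hre.coeFn_toLp]
  have hFi : Integrable F := hF.integrable (by norm_num)
  have hconjF : ccoeff (fun x => conj (F x)) k = a k := by
    rw [← Complex.conj_conj (a k), ← hconj, ← hFa (-k)]
    unfold ccoeff
    rw [map_mul, ← integral_conj, ← Complex.ofReal_inv, Complex.conj_ofReal]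
    congr 1
    refine integral_congr_ae (Eventually.of_forall fun x => ?_)
    dsimp only
    rw [map_mul, conj_char (fun i => -((-k) i))]
    simp
  have hsum : coeff (fun x => (F x).re) k
      = (2 : ℂ)⁻¹ * (ccoeff F k + ccoeff (fun x => conj (F x)) k) := by
    have hFc : Integrable fun x => conj (F x) :=
      (RCLike.conjCLE (K := ℂ)).toContinuousLinearMap.integrable_comp hFi
    rw [← ccoeff_add hFi hFc]
    unfold coeff ccoeff
    rw [mul_left_comm (2 : ℂ)⁻¹, ← integral_const_mul (2 : ℂ)⁻¹]
    congr 1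
    refine integral_congr_ae (Eventually.of_forall fun x => ?_)
    simp only [Complex.add_conj]
    push_cast
    ring
  rw [hsum, hconjF, hFa]
  ring

/-- The coefficients of a product are the convolution of the coefficients. -/
lemma hasSum_coeff_mul {u v : Torus d → ℝ} (hu : MemLp u 2 (volume : Measure (Torus d)))
    (hv : MemLp v 2 (volume : Measure (Torus d))) (k : Fin d → ℤ) :
    HasSum (fun l => coeff u l * coeff v (k - l)) (coeff (fun x => u x * v x) k) := by
  have hvk : MemLp (fun x => (∏ i, (fourier (-(k i)) (x i) : ℂ)) * (v x : ℂ)) 2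
      (volume : Measure (Torus d)) := by
    refine (memLp_ofReal hv).of_le
      ((continuous_char fun i => -(k i)).aestronglyMeasurable.mul (memLp_ofReal hv).1)
      (Eventually.of_forall fun x => ?_)
    rw [norm_mul, norm_char (fun i => -(k i)) x, one_mul]
  have h := hasSum_conj_ccoeff_mul (memLp_ofReal hu) hvk
  have h2 : ∀ l, conj (ccoeff (fun x => (u x : ℂ)) l)
      * ccoeff (fun x => (∏ i, (fourier (-(k i)) (x i) : ℂ)) * (v x : ℂ)) l
      = coeff u (-l) * coeff v (k + l) := fun l => by
    rw [coeff_neg_eq_conj, coeff_eq_ccoeff u]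
    congr 1
    unfold coeff ccoeff
    congr 1
    refine integral_congr_ae (Eventually.of_forall fun x => ?_)
    dsimp only
    rw [← mul_assoc, ← Finset.prod_mul_distrib]
    congr 1
    refine Finset.prod_congr rfl fun i _ => ?_
    rw [← fourier_add]
    congr 1
    simp only [Pi.add_apply]
    ring_nf
  simp only [h2] at h
  have h3 := (Equiv.neg (Fin d → ℤ)).hasSum_iff.2 h
  convert h3 using 1
  · ext l
    simp [Function.comp, sub_eq_add_neg]
  · unfold coeff
    congr 1
    refine integral_congr_ae (Eventually.of_forall fun x => ?_)
    simp only [Complex.conj_ofReal]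
    push_cast
    ring

/-! ### Inequalities in `ℝ≥0∞` -/

lemma ennreal_add_sq_le (a b : ℝ≥0∞) : (a + b) ^ 2 ≤ 2 * (a ^ 2 + b ^ 2) := by
  rcases eq_or_ne a ⊤ with rfl | ha
  · simp
  rcases eq_or_ne b ⊤ with rfl | hb
  · simp
  lift a to ℝ≥0 using ha
  lift b to ℝ≥0 using hb
  have h : (a + b) ^ 2 ≤ 2 * (a ^ 2 + b ^ 2) := by
    rw [← NNReal.coe_le_coe]
    push_cast
    exact add_sq_le
  exact_mod_cast h

lemma lintegral_mul_sq_le {α : Type*} [MeasurableSpace α] (μ : Measure α) {f g : α → ℝ≥0∞}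
    (hf : AEMeasurable f μ) (hg : AEMeasurable g μ) :
    (∫⁻ x, f x * g x ∂μ) ^ 2 ≤ (∫⁻ x, f x ^ 2 ∂μ) * ∫⁻ x, g x ^ 2 ∂μ := by
  have h := ENNReal.lintegral_mul_le_Lp_mul_Lq μ (p := 2) (q := 2)
    (Real.holderConjugate_iff.2 ⟨by norm_num, by norm_num⟩) hf hg
  have h2 := pow_le_pow_left' h 2
  simp only [Pi.mul_apply, ENNReal.rpow_two] at h2
  refine h2.trans (le_of_eq ?_)
  rw [mul_pow, ← ENNReal.rpow_two, ← ENNReal.rpow_two, ← ENNReal.rpow_mul, ← ENNReal.rpow_mul]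
  norm_num

lemma tsum_mul_sq_le {ι : Type*} (f g : ι → ℝ≥0∞) :
    (∑' i, f i * g i) ^ 2 ≤ (∑' i, f i ^ 2) * ∑' i, g i ^ 2 := by
  let _ : MeasurableSpace ι := ⊤
  have := lintegral_mul_sq_le (Measure.count : Measure ι) (f := f) (g := g)
    measurable_from_top.aemeasurable measurable_from_top.aemeasurable
  simpa only [lintegral_count] using this

/-- Young's inequality `ℓ¹ * ℓ² ⊆ ℓ²`. -/
lemma tsum_conv_sq_le {G : Type*} [AddCommGroup G] (A B : G → ℝ≥0∞) :
    ∑' k, (∑' l, A l * B (k - l)) ^ 2 ≤ (∑' l, A l) ^ 2 * ∑' l, B l ^ 2 := by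
  have h1 : ∀ k, (∑' l, A l * B (k - l)) ^ 2 ≤ (∑' l, A l) * ∑' l, A l * B (k - l) ^ 2 := fun k => by
    have h := tsum_mul_sq_le (fun l => A l ^ (1 / 2 : ℝ)) (fun l => A l ^ (1 / 2 : ℝ) * B (k - l))
    have h3 : ∀ l, (A l ^ (1 / 2 : ℝ)) ^ 2 = A l := fun l => by
      rw [← ENNReal.rpow_two, ← ENNReal.rpow_mul]; norm_num
    simpa only [← mul_assoc, ← sq, mul_pow, h3] using h
  calc _ ≤ ∑' k, (∑' l, A l) * ∑' l, A l * B (k - l) ^ 2 := ENNReal.tsum_le_tsum h1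
    _ = (∑' l, A l) * ∑' l, ∑' k, A l * B (k - l) ^ 2 := by
      rw [ENNReal.tsum_mul_left, ENNReal.tsum_comm]
    _ = (∑' l, A l) * ∑' l, A l * ∑' k, B k ^ 2 := by
      congr 1
      refine tsum_congr fun l => ?_
      rw [ENNReal.tsum_mul_left]
      congr 1
      exact (Equiv.subRight l).tsum_eq (fun k => B k ^ 2)
    _ = _ := by rw [ENNReal.tsum_mul_right]; ring

/-! ### Weights -/

/-- The weight `1 + |k|²`. -/
def wt (k : Fin d → ℤ) : ℝ := 1 + freqSq k

lemma freqSq_nonneg (k : Fin d → ℤ) : 0 ≤ freqSq k := Finset.sum_nonneg fun _ _ => sq_nonneg _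

lemma one_le_wt (k : Fin d → ℤ) : 1 ≤ wt k := by
  unfold wt; linarith [freqSq_nonneg k]

lemma wt_pos (k : Fin d → ℤ) : 0 < wt k := one_pos.trans_le (one_le_wt k)

/-- The power `(1 + |k|²)^σ` of the weight, as an extended nonnegative number. -/
def pw (σ : ℝ) (k : Fin d → ℤ) : ℝ≥0∞ := ENNReal.ofReal (wt k ^ σ)

lemma pw_ne_top (σ : ℝ) (k : Fin d → ℤ) : pw σ k ≠ ⊤ := ENNReal.ofReal_ne_top

lemma pw_add (σ τ : ℝ) (k : Fin d → ℤ) : pw (σ + τ) k = pw σ k * pw τ k := by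
  unfold pw
  rw [Real.rpow_add (wt_pos k), ENNReal.ofReal_mul (Real.rpow_nonneg (wt_pos k).le _)]

lemma pw_zero (k : Fin d → ℤ) : pw 0 k = 1 := by simp [pw]

lemma pw_one (k : Fin d → ℤ) : pw 1 k = ENNReal.ofReal (wt k) := by simp [pw]

lemma pw_mono {σ τ : ℝ} (h : σ ≤ τ) (k : Fin d → ℤ) : pw σ k ≤ pw τ k :=
  ENNReal.ofReal_le_ofReal (Real.rpow_le_rpow_of_exponent_le (one_le_wt k) h)

lemma pw_half_sq (σ : ℝ) (k : Fin d → ℤ) : pw (σ / 2) k ^ 2 = pw σ k := by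
  rw [sq, ← pw_add]; congr 1; ring

lemma pw_anti_wt {α : ℝ} (hα : 0 ≤ α) {k l : Fin d → ℤ} (h : wt k ≤ wt l) :
    pw (-α) l ≤ pw (-α) k :=
  ENNReal.ofReal_le_ofReal (Real.rpow_le_rpow_of_nonpos (wt_pos k) h (by linarith))

/-- The whole decay can be placed on the smaller one of the two frequencies. -/
lemma pw_neg_mul_le {α β : ℝ} (hα : 0 ≤ α) (hβ : 0 ≤ β) (k l : Fin d → ℤ) :
    pw (-α) k * pw (-β) l ≤ pw (-(α + β)) k + pw (-(α + β)) l := by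
  rw [neg_add, pw_add, pw_add]
  rcases le_total (wt k) (wt l) with h | h
  · refine le_add_right ?_
    gcongr
    exact pw_anti_wt hβ h
  · refine le_add_left ?_
    gcongr
    exact pw_anti_wt hα h

lemma wt_add_le (k l : Fin d → ℤ) : wt (k + l) ≤ 2 * (wt k + wt l) := by
  unfold wt freqSq
  have : ∑ i, ((k + l) i : ℝ) ^ 2 ≤ ∑ i, 2 * ((k i : ℝ) ^ 2 + (l i : ℝ) ^ 2) :=
    Finset.sum_le_sum fun i _ => by
      simp only [Pi.add_apply]; push_cast; exact add_sq_le
  rw [← Finset.mul_sum, Finset.sum_add_distrib] at this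
  linarith

lemma pw_le_of_add {α : ℝ} (hα : 0 ≤ α) (k l : Fin d → ℤ) :
    pw α (k + l) ≤ ENNReal.ofReal (4 ^ α) * (pw α k + pw α l) := by
  have key : ∀ m : Fin d → ℤ, wt (k + l) ≤ 4 * wt m → pw α (k + l) ≤ ENNReal.ofReal (4 ^ α) * pw α m :=
    fun m hm => by
      unfold pw
      rw [← ENNReal.ofReal_mul (by positivity), ← Real.mul_rpow (by norm_num) (wt_pos m).le]
      exact ENNReal.ofReal_le_ofReal (Real.rpow_le_rpow (wt_pos _).le hm hα)
  have h := wt_add_le k l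
  rcases le_total (wt k) (wt l) with h' | h'
  · exact (key l (by linarith)).trans (by gcongr; exact le_add_self)
  · exact (key k (by linarith)).trans (by gcongr; exact le_self_add)

lemma tsum_pw_neg_lt_top {q : ℝ} (hq : (d : ℝ) / 2 < q) :
    ∑' k : Fin d → ℤ, pw (-q) k < ⊤ := by
  set b := Pi.basisFun ℝ (Fin d)
  set L := Submodule.span ℤ (Set.range b)
  have hrank : Module.finrank ℤ L = d := by
    rw [ZLattice.rank ℝ L]; simp
  have hs := ZLattice.summable_norm_rpow L (-(2 * q)) (by rw [hrank]; linarith)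
  let e : (Fin d → ℤ) → L := fun k => ⟨fun i => (k i : ℝ), by
    have : (fun i => (k i : ℝ)) = ∑ i, k i • b i := by
      ext j
      simp [b, Finset.sum_apply, Pi.single_apply]
    rw [this]
    exact Submodule.sum_mem _ fun i _ => Submodule.smul_mem _ _ (Submodule.subset_span ⟨i, rfl⟩)⟩
  have he : Function.Injective e := fun k l h => by
    ext i
    have : (k i : ℝ) = l i := congrFun (congrArg Subtype.val h) i
    exact_mod_cast this
  have hs' := hs.comp_injective he
  have h0 : Summable fun k : Fin d → ℤ => if k = 0 then (1 : ℝ) else 0 :=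
    summable_of_hasFiniteSupport ((Set.finite_singleton 0).subset fun k hk => by
      by_contra h; simp at h; simp [h] at hk)
  have hle : ∀ k : Fin d → ℤ, wt k ^ (-q) ≤ ‖e k‖ ^ (-(2 * q)) + if k = 0 then (1 : ℝ) else 0 := by
    intro k
    have hd : (0 : ℝ) ≤ d := by positivity
    split_ifs with hk
    · have : wt k ^ (-q) ≤ 1 := Real.rpow_le_one_of_one_le_of_nonpos (one_le_wt k) (by linarith)
      have := Real.rpow_nonneg (norm_nonneg (e k)) (-(2 * q))
      linarith
    · have hpos : 0 < ‖e k‖ := by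
        rw [norm_pos_iff]
        intro h
        apply hk
        apply he
        rw [h]
        ext i
        simp [e]
      rw [add_zero, show -(2 * q) = 2 * -q by ring, Real.rpow_mul hpos.le]
      refine Real.rpow_le_rpow_of_nonpos (by positivity) ?_ (by linarith)
      have h1 : ‖e k‖ ≤ Real.sqrt (wt k) := by
        change ‖fun i => (k i : ℝ)‖ ≤ _
        rw [pi_norm_le_iff_of_nonneg (Real.sqrt_nonneg _)]
        intro i
        rw [Real.norm_eq_abs]
        refine Real.abs_le_sqrt ?_
        have : (k i : ℝ) ^ 2 ≤ freqSq k :=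
          Finset.single_le_sum (f := fun i => (k i : ℝ) ^ 2) (fun _ _ => sq_nonneg _) (Finset.mem_univ i)
        unfold wt; linarith
      rw [Real.rpow_two]
      calc ‖e k‖ ^ 2 ≤ Real.sqrt (wt k) ^ 2 := by gcongr
        _ = wt k := Real.sq_sqrt (wt_pos k).le
  have hsum : Summable fun k : Fin d → ℤ => wt k ^ (-q) :=
    Summable.of_nonneg_of_le (fun k => Real.rpow_nonneg (wt_pos k).le _) hle (hs'.add h0)
  exact hsum.tsum_ofReal_lt_top

/-! ### Weighted square sums -/

/-- The squared Sobolev norm `∑_k (1 + |k|²)^σ |a_k|²` of a family of Fourier coefficients, for any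
real order `σ`. -/
def wsq (σ : ℝ) (a : (Fin d → ℤ) → ℂ) : ℝ≥0∞ := ∑' k, pw σ k * ‖a k‖ₑ ^ 2

lemma sobNorm_sq (σ : ℕ) (v : L2 d) : sobNorm σ v ^ 2 = wsq σ (coeff v) := by
  unfold sobNorm wsq
  rw [← ENNReal.rpow_two, ← ENNReal.rpow_mul]
  norm_num
  refine tsum_congr fun k => ?_
  unfold pw
  rw [ENNReal.ofReal_mul (by have := wt_pos k; unfold wt at this; positivity),
    ENNReal.ofReal_pow (norm_nonneg _), ofReal_norm, Real.rpow_natCast]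
  rfl

lemma wsq_mono {σ τ : ℝ} (h : σ ≤ τ) (a : (Fin d → ℤ) → ℂ) : wsq σ a ≤ wsq τ a :=
  ENNReal.tsum_le_tsum fun k => by gcongr; exact pw_mono h k

lemma wsq_le_wsq {σ : ℝ} {a b : (Fin d → ℤ) → ℂ} (h : ∀ k, ‖a k‖ₑ ≤ ‖b k‖ₑ) : wsq σ a ≤ wsq σ b :=
  ENNReal.tsum_le_tsum fun k => by gcongr; exact h k

lemma wsq_add_le (σ : ℝ) (a b : (Fin d → ℤ) → ℂ) :
    wsq σ (fun k => a k + b k) ≤ 2 * (wsq σ a + wsq σ b) := by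
  unfold wsq
  rw [← ENNReal.tsum_add, ← ENNReal.tsum_mul_left]
  refine ENNReal.tsum_le_tsum fun k => ?_
  calc pw σ k * ‖a k + b k‖ₑ ^ 2 ≤ pw σ k * (‖a k‖ₑ + ‖b k‖ₑ) ^ 2 := by
        gcongr; exact enorm_add_le _ _
    _ ≤ pw σ k * (2 * (‖a k‖ₑ ^ 2 + ‖b k‖ₑ ^ 2)) := by gcongr; exact ennreal_add_sq_le _ _
    _ = _ := by ring

lemma wsq_neg (σ : ℝ) (a : (Fin d → ℤ) → ℂ) : wsq σ (fun k => -a k) = wsq σ a := by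
  simp [wsq]

lemma wsq_sub_le (σ : ℝ) (a b : (Fin d → ℤ) → ℂ) :
    wsq σ (fun k => a k - b k) ≤ 2 * (wsq σ a + wsq σ b) := by
  have := wsq_add_le σ a (fun k => -b k)
  rw [wsq_neg] at this
  simpa only [sub_eq_add_neg] using this

lemma wsq_smul (σ : ℝ) (c : ℂ) (a : (Fin d → ℤ) → ℂ) :
    wsq σ (fun k => c * a k) = ‖c‖ₑ ^ 2 * wsq σ a := by
  unfold wsq
  rw [← ENNReal.tsum_mul_left]
  exact tsum_congr fun k => by rw [enorm_mul]; ring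

lemma wsq_zero_eq {u : Torus d → ℝ} (hu : MemLp u 2 (volume : Measure (Torus d))) :
    wsq 0 (coeff u) = (ENNReal.ofReal ((2 * Real.pi) ^ d))⁻¹ * ∫⁻ x, ‖u x‖ₑ ^ 2 := by
  have h := hasSum_norm_coeff_sq hu
  have h0 := two_pi_pow_pos d
  unfold wsq
  simp only [pw_zero, one_mul]
  have h1 : ∀ k, ‖coeff u k‖ₑ ^ 2 = ENNReal.ofReal (‖coeff u k‖ ^ 2) := fun k => by
    rw [ENNReal.ofReal_pow (norm_nonneg _), ofReal_norm]
  simp only [h1]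
  rw [← ENNReal.ofReal_tsum_of_nonneg (fun k => by positivity) h.summable, h.tsum_eq,
    ENNReal.ofReal_mul (by positivity), ENNReal.ofReal_inv_of_pos h0,
    ofReal_integral_eq_lintegral_ofReal hu.integrable_sq (Eventually.of_forall fun x => sq_nonneg _)]
  congr 1
  refine lintegral_congr fun x => ?_
  rw [← ofReal_norm, ← ENNReal.ofReal_pow (norm_nonneg _), Real.norm_eq_abs, sq_abs]

lemma wsq_zero_lt_top {u : Torus d → ℝ} (hu : MemLp u 2 (volume : Measure (Torus d))) :
    wsq 0 (coeff u) < ⊤ := by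
  have h := hasSum_norm_coeff_sq hu
  have h1 : ∀ k, ‖coeff u k‖ₑ ^ 2 = ENNReal.ofReal (‖coeff u k‖ ^ 2) := fun k => by
    rw [ENNReal.ofReal_pow (norm_nonneg _), ofReal_norm]
  unfold wsq
  simp only [pw_zero, one_mul, h1]
  exact h.summable.tsum_ofReal_lt_top

lemma wsq_succ (ρ : ℝ) (a : (Fin d → ℤ) → ℂ) :
    wsq (ρ + 1) a = wsq ρ a + ∑ j, wsq ρ (fun k => Complex.I * (k j : ℂ) * a k) := by
  unfold wsq
  rw [← Summable.tsum_finsetSum fun _ _ => ENNReal.summable, ← ENNReal.tsum_add]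
  refine tsum_congr fun k => ?_
  rw [pw_add, pw_one, wt, ENNReal.ofReal_add zero_le_one (freqSq_nonneg k), ENNReal.ofReal_one,
    freqSq, ENNReal.ofReal_sum_of_nonneg fun _ _ => sq_nonneg _, mul_add, mul_one, add_mul,
    Finset.mul_sum, Finset.sum_mul]
  congr 1
  refine Finset.sum_congr rfl fun j _ => ?_
  rw [enorm_mul, enorm_mul, mul_pow, mul_pow, mul_assoc]
  congr 2
  rw [← ofReal_norm, ← ofReal_norm, Complex.norm_I, ENNReal.ofReal_one, one_pow, one_mul,
    ← ENNReal.ofReal_pow (norm_nonneg _)]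
  congr 1
  rw [Complex.norm_intCast, sq_abs]

lemma pw_mul_enorm_sq_le (σ : ℝ) (a : (Fin d → ℤ) → ℂ) (k : Fin d → ℤ) :
    pw σ k * ‖a k‖ₑ ^ 2 ≤ wsq σ a := ENNReal.le_tsum k

lemma enorm_sq_le_wsq {σ : ℝ} (hσ : 0 ≤ σ) (a : (Fin d → ℤ) → ℂ) (k : Fin d → ℤ) :
    ‖a k‖ₑ ^ 2 ≤ wsq σ a := by
  refine le_trans ?_ (pw_mul_enorm_sq_le σ a k)
  calc ‖a k‖ₑ ^ 2 = 1 * ‖a k‖ₑ ^ 2 := (one_mul _).symm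
    _ ≤ _ := by
      gcongr
      rw [← pw_zero k]
      exact pw_mono hσ k

lemma wsq_eq_zero {σ : ℝ} (hσ : 0 ≤ σ) {a : (Fin d → ℤ) → ℂ} (h : wsq σ a = 0) (k : Fin d → ℤ) :
    a k = 0 := by
  have := enorm_sq_le_wsq hσ a k
  rw [h] at this
  simpa using this

/-- The Sobolev embedding `H^s ⊆ L^∞`, `s > d/2`. -/
lemma ae_enorm_sq_le {u : Torus d → ℝ} (hu : MemLp u 2 (volume : Measure (Torus d))) {s : ℝ}
    (hs : (d : ℝ) / 2 < s) :
    ∀ᵐ x : Torus d, ‖u x‖ₑ ^ 2 ≤ (∑' k : Fin d → ℤ, pw (-s) k) * wsq s (coeff u) := by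
  rcases eq_or_ne (wsq s (coeff u)) ⊤ with htop | htop
  · rw [htop, ENNReal.mul_top]
    · exact Eventually.of_forall fun _ => le_top
    · refine fun h => ?_
      have := ENNReal.le_tsum (f := fun k : Fin d → ℤ => pw (-s) k) 0
      rw [h] at this
      simp [pw, wt, freqSq] at this
  have hcs : (∑' k, ‖coeff u k‖ₑ) ^ 2 ≤ (∑' k : Fin d → ℤ, pw (-s) k) * wsq s (coeff u) := by
    have := tsum_mul_sq_le (fun k : Fin d → ℤ => pw (-s / 2) k) (fun k => pw (s / 2) k * ‖coeff u k‖ₑ)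
    simp only [← mul_assoc, ← pw_add, mul_pow, pw_half_sq] at this
    have h0 : -s / 2 + s / 2 = 0 := by ring
    simp only [h0, pw_zero, one_mul] at this
    exact this
  have hfin : ∑' k, ‖coeff u k‖ₑ ≠ ⊤ := by
    intro h
    rw [h] at hcs
    exact (ENNReal.mul_lt_top (tsum_pw_neg_lt_top hs) htop.lt_top).not_ge (by simpa using hcs)
  have hsum : Summable fun k => ‖coeff u k‖ := by
    have := ENNReal.summable_toReal hfin
    simpa using this
  filter_upwards [ae_norm_le_tsum_ccoeff (memLp_ofReal hu) hsum] with x hx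
  refine le_trans ?_ hcs
  gcongr
  have h1 : ‖u x‖ ≤ ∑' k, ‖coeff u k‖ := by
    simpa [coeff_eq_ccoeff] using hx
  calc ‖u x‖ₑ = ENNReal.ofReal ‖u x‖ := (ofReal_norm _).symm
    _ ≤ ENNReal.ofReal (∑' k, ‖coeff u k‖) := ENNReal.ofReal_le_ofReal h1
    _ = ∑' k, ‖coeff u k‖ₑ := by
      rw [ENNReal.ofReal_tsum_of_nonneg (fun _ => norm_nonneg _) hsum]
      simp only [ofReal_norm]

/-- The product law: `H^σ · H^τ ⊆ H^ρ` for `0 ≤ ρ ≤ σ, τ` and `σ + τ - ρ > d/2`. The weight of the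
product is placed on either factor; the decay `σ + τ - ρ` which remains makes one of the two sequences
in the convolution summable. -/
lemma wsq_coeff_mul_le {ρ σ τ : ℝ} (hρ : 0 ≤ ρ) (hρσ : ρ ≤ σ) (hρτ : ρ ≤ τ)
    (h : (d : ℝ) / 2 < σ + τ - ρ) :
    ∃ C : ℝ≥0, ∀ u v : Torus d → ℝ, MemLp u 2 (volume : Measure (Torus d)) →
      MemLp v 2 (volume : Measure (Torus d)) →
      wsq ρ (coeff fun x => u x * v x) ≤ C * (wsq σ (coeff u) * wsq τ (coeff v)) := by
  set S := ∑' k : Fin d → ℤ, pw (-(σ + τ - ρ)) k with hS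
  have hStop : S < ⊤ := tsum_pw_neg_lt_top h
  set c := ENNReal.ofReal (4 ^ (ρ / 2)) with hc
  have hC : (2 * c) ^ 2 * (2 * (S + S)) ≠ ⊤ := by
    have : c ≠ ⊤ := ENNReal.ofReal_ne_top
    finiteness
  refine ⟨((2 * c) ^ 2 * (2 * (S + S))).toNNReal, fun u v hu hv => ?_⟩
  rw [ENNReal.coe_toNNReal hC]
  set A : (Fin d → ℤ) → ℝ≥0∞ := fun k => pw (σ / 2) k * ‖coeff u k‖ₑ with hA
  set B : (Fin d → ℤ) → ℝ≥0∞ := fun k => pw (τ / 2) k * ‖coeff v k‖ₑ with hB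
  have hAs : ∑' k, A k ^ 2 = wsq σ (coeff u) := by
    simp only [hA, mul_pow, pw_half_sq]; rfl
  have hBs : ∑' k, B k ^ 2 = wsq τ (coeff v) := by
    simp only [hB, mul_pow, pw_half_sq]; rfl
  set q := (σ + τ - ρ) / 2 with hq
  -- the two convolutions to which Young's inequality applies
  set X : (Fin d → ℤ) → ℝ≥0∞ := fun k => ∑' l, (pw (-q) l * A l) * B (k - l) with hX
  set Y : (Fin d → ℤ) → ℝ≥0∞ := fun k => ∑' l, (pw (-q) l * B l) * A (k - l) with hY
  have hl1 : ∀ Z : (Fin d → ℤ) → ℝ≥0∞, (∑' l, pw (-q) l * Z l) ^ 2 ≤ S * ∑' l, Z l ^ 2 := fun Z => by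
    refine (tsum_mul_sq_le _ _).trans (le_of_eq ?_)
    congr 1
    refine tsum_congr fun k => ?_
    rw [← pw_half_sq (-(σ + τ - ρ)) k, hq]
    congr 2
    ring
  have hXs : ∑' k, X k ^ 2 ≤ S * (wsq σ (coeff u) * wsq τ (coeff v)) := by
    refine (tsum_conv_sq_le _ _).trans ?_
    rw [← hAs, ← hBs, ← mul_assoc]
    gcongr
    exact hl1 A
  have hYs : ∑' k, Y k ^ 2 ≤ S * (wsq σ (coeff u) * wsq τ (coeff v)) := by
    refine (tsum_conv_sq_le _ _).trans ?_
    rw [← hAs, ← hBs, mul_comm (∑' k, A k ^ 2), ← mul_assoc]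
    gcongr
    exact hl1 B
  have hYeq : ∀ k, Y k = ∑' l, A l * (pw (-q) (k - l) * B (k - l)) := fun k => by
    rw [hY]
    dsimp only
    rw [← (Equiv.subLeft k).tsum_eq]
    refine tsum_congr fun l => ?_
    simp only [Equiv.subLeft_apply, sub_sub_cancel]
    ring
  -- a weight placed on either factor leaves the total decay `q`
  have key : ∀ α β : ℝ, 0 ≤ α → 0 ≤ β → α + β = q → ∀ k,
      ∑' l, pw (-α) l * A l * (pw (-β) (k - l) * B (k - l)) ≤ X k + Y k := by
    intro α β hα hβ hαβ k
    rw [hYeq, hX, ← ENNReal.tsum_add]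
    refine ENNReal.tsum_le_tsum fun l => ?_
    calc pw (-α) l * A l * (pw (-β) (k - l) * B (k - l))
        = (pw (-α) l * pw (-β) (k - l)) * (A l * B (k - l)) := by ring
      _ ≤ (pw (-(α + β)) l + pw (-(α + β)) (k - l)) * (A l * B (k - l)) := by
          gcongr; exact pw_neg_mul_le hα hβ _ _
      _ = _ := by rw [hαβ]; ring
  have hpt : ∀ k, pw (ρ / 2) k * ‖coeff (fun x => u x * v x) k‖ₑ ≤ 2 * c * (X k + Y k) := by
    intro k
    have h1 : ‖coeff (fun x => u x * v x) k‖ₑ ≤ ∑' l, ‖coeff u l‖ₑ * ‖coeff v (k - l)‖ₑ := by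
      rw [← (hasSum_coeff_mul hu hv k).tsum_eq]
      refine enorm_tsum_le_tsum_enorm.trans (le_of_eq ?_)
      simp only [enorm_mul]
    have hcancel : ∀ (x y : ℝ) (m : Fin d → ℤ), pw (x - y) m = pw (-y) m * pw x m := fun x y m => by
      rw [← pw_add]; congr 1; ring
    calc pw (ρ / 2) k * ‖coeff (fun x => u x * v x) k‖ₑ
        ≤ pw (ρ / 2) k * ∑' l, ‖coeff u l‖ₑ * ‖coeff v (k - l)‖ₑ := by gcongr
      _ = ∑' l, pw (ρ / 2) k * (‖coeff u l‖ₑ * ‖coeff v (k - l)‖ₑ) := by rw [ENNReal.tsum_mul_left]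
      _ ≤ ∑' l, (c * (pw (-((σ - ρ) / 2)) l * A l * (pw (-(τ / 2)) (k - l) * B (k - l)))
            + c * (pw (-(σ / 2)) l * A l * (pw (-((τ - ρ) / 2)) (k - l) * B (k - l)))) := by
          refine ENNReal.tsum_le_tsum fun l => ?_
          have h2 : pw (ρ / 2) k ≤ c * (pw (ρ / 2) l + pw (ρ / 2) (k - l)) := by
            have := pw_le_of_add (α := ρ / 2) (by positivity) l (k - l)
            rwa [add_sub_cancel] at this
          have e1 : pw (-((σ - ρ) / 2)) l * pw (σ / 2) l = pw (ρ / 2) l := by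
            rw [← pw_add]; congr 1; ring
          have e2 : pw (-((τ - ρ) / 2)) (k - l) * pw (τ / 2) (k - l) = pw (ρ / 2) (k - l) := by
            rw [← pw_add]; congr 1; ring
          have e3 : pw (-(τ / 2)) (k - l) * pw (τ / 2) (k - l) = 1 := by
            rw [← pw_add, neg_add_cancel, pw_zero]
          have e4 : pw (-(σ / 2)) l * pw (σ / 2) l = 1 := by
            rw [← pw_add, neg_add_cancel, pw_zero]
          calc _ ≤ c * (pw (ρ / 2) l + pw (ρ / 2) (k - l)) * (‖coeff u l‖ₑ * ‖coeff v (k - l)‖ₑ) := by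
                gcongr
            _ = c * (pw (ρ / 2) l * 1 + 1 * pw (ρ / 2) (k - l))
                * (‖coeff u l‖ₑ * ‖coeff v (k - l)‖ₑ) := by rw [mul_one, one_mul]
            _ = _ := by
                nth_rewrite 1 [← e1, ← e3, ← e4, ← e2]
                simp only [hA, hB]
                ring
      _ = c * ∑' l, (pw (-((σ - ρ) / 2)) l * A l * (pw (-(τ / 2)) (k - l) * B (k - l)))
            + c * ∑' l, (pw (-(σ / 2)) l * A l * (pw (-((τ - ρ) / 2)) (k - l) * B (k - l))) := by
          rw [ENNReal.tsum_add, ENNReal.tsum_mul_left, ENNReal.tsum_mul_left]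
      _ ≤ c * (X k + Y k) + c * (X k + Y k) := by
          gcongr
          · exact key _ _ (by linarith) (by linarith) (by rw [hq]; ring) k
          · exact key _ _ (by linarith) (by linarith) (by rw [hq]; ring) k
      _ = _ := by ring
  calc wsq ρ (coeff fun x => u x * v x)
      = ∑' k, (pw (ρ / 2) k * ‖coeff (fun x => u x * v x) k‖ₑ) ^ 2 := by
        simp only [mul_pow, pw_half_sq]; rfl
    _ ≤ ∑' k, (2 * c) ^ 2 * (2 * (X k ^ 2 + Y k ^ 2)) := by
        refine ENNReal.tsum_le_tsum fun k => ?_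
        refine (pow_le_pow_left' (hpt k) 2).trans ?_
        rw [mul_pow]
        gcongr
        exact ennreal_add_sq_le _ _
    _ = (2 * c) ^ 2 * (2 * (∑' k, X k ^ 2 + ∑' k, Y k ^ 2)) := by
        rw [ENNReal.tsum_mul_left, ENNReal.tsum_mul_left, ENNReal.tsum_add]
    _ ≤ (2 * c) ^ 2 * (2 * (S * (wsq σ (coeff u) * wsq τ (coeff v))
          + S * (wsq σ (coeff u) * wsq τ (coeff v)))) := by gcongr
    _ = _ := by ring

/-! ### Weak derivatives and the chain rule -/

lemma memLp_comp_of_bounded {h : ℝ → ℝ} (hh : Continuous h) {w : Torus d → ℝ}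
    (hw : MemLp w 2 (volume : Measure (Torus d))) {M : ℝ} (hM : ∀ᵐ x, |w x| ≤ M) :
    MemLp (fun x => h (w x)) 2 (volume : Measure (Torus d)) := by
  obtain ⟨B, hB⟩ := (isCompact_Icc (a := -M) (b := M)).exists_bound_of_continuousOn hh.continuousOn
  refine MemLp.of_bound (hh.comp_aestronglyMeasurable hw.1) B ?_
  filter_upwards [hM] with x hx
  exact hB _ (abs_le.1 hx)

lemma memLp_comp_mul {h : ℝ → ℝ} (hh : Continuous h) {w u : Torus d → ℝ}
    (hw : MemLp w 2 (volume : Measure (Torus d))) {M : ℝ} (hM : ∀ᵐ x, |w x| ≤ M)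
    (hu : MemLp u 2 (volume : Measure (Torus d))) :
    MemLp (fun x => h (w x) * u x) 2 (volume : Measure (Torus d)) := by
  obtain ⟨B, hB⟩ := (isCompact_Icc (a := -M) (b := M)).exists_bound_of_continuousOn hh.continuousOn
  refine MemLp.of_le_mul hu (c := B) ((hh.comp_aestronglyMeasurable hw.1).mul hu.1) ?_
  filter_upwards [hM] with x hx
  rw [norm_mul]
  gcongr
  exact hB _ (abs_le.1 hx)

lemma _root_.MeasureTheory.MemLp.integrable_torus {u : Torus d → ℝ} (hu : MemLp u 2 (volume : Measure (Torus d))) :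
    Integrable u := hu.integrable (by norm_num)

/-- `u'` is the weak derivative of `u` in the `j`-th variable, both being square integrable; the
definition is in terms of Fourier coefficients. -/
structure IsWeakDeriv (j : Fin d) (u u' : Torus d → ℝ) : Prop where
  memLp : MemLp u 2 (volume : Measure (Torus d))
  memLp' : MemLp u' 2 (volume : Measure (Torus d))
  coeff_eq : ∀ k, coeff u' k = Complex.I * (k j : ℂ) * coeff u k

lemma IsWeakDeriv.coeff_mul {j : Fin d} {u u' v v' : Torus d → ℝ} (hu : IsWeakDeriv j u u')
    (hv : IsWeakDeriv j v v') (k : Fin d → ℤ) :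
    coeff (fun x => u' x * v x + u x * v' x) k
      = Complex.I * (k j : ℂ) * coeff (fun x => u x * v x) k := by
  rw [coeff_add (u := fun x => u' x * v x) (v := fun x => u x * v' x)
    (hu.memLp'.integrable_mul hv.memLp) (hu.memLp.integrable_mul hv.memLp')]
  refine ((hasSum_coeff_mul hu.memLp' hv.memLp k).add
    (hasSum_coeff_mul hu.memLp hv.memLp' k)).unique ?_
  refine ((hasSum_coeff_mul hu.memLp hv.memLp k).mul_left (Complex.I * (k j : ℂ))).congr_fun
    fun l => ?_
  rw [hu.coeff_eq, hv.coeff_eq]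
  simp only [Pi.sub_apply]
  push_cast
  ring

lemma coeff_const_of_ne {k : Fin d → ℤ} (hk : k ≠ 0) (c : ℝ) :
    coeff (fun _ : Torus d => c) k = 0 := by
  -- the coefficient of order `0` exhausts Parseval's identity
  have h1 : MemLp (fun _ : Torus d => (1 : ℝ)) 2 (volume : Measure (Torus d)) := memLp_const 1
  have h := hasSum_norm_coeff_sq h1
  have hvol : (volume : Measure (Torus d)).real univ = (2 * Real.pi) ^ d := by
    rw [measureReal_def, volume_torus_eq, Measure.smul_apply, measure_univ, smul_eq_mul, mul_one,
      ENNReal.toReal_ofReal (two_pi_pow_pos d).le]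
  have hd := (two_pi_pow_pos d).ne'
  simp only [one_pow, integral_const, hvol, smul_eq_mul, mul_one, inv_mul_cancel₀ hd] at h
  have h0 : coeff (fun _ : Torus d => (1 : ℝ)) 0 = 1 := by
    unfold coeff
    simp only [Pi.zero_apply, neg_zero, fourier_zero, Finset.prod_const_one, Complex.ofReal_one,
      mul_one, integral_const, hvol]
    rw [Complex.real_smul, mul_one, inv_mul_cancel₀]
    exact_mod_cast hd
  have h2 := h.summable.sum_le_tsum {0, k} fun _ _ => sq_nonneg _
  rw [Finset.sum_pair hk.symm, h.tsum_eq, h0, norm_one, one_pow] at h2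
  have h3 : ‖coeff (fun _ : Torus d => (1 : ℝ)) k‖ ^ 2 ≤ 0 := by linarith
  have h4 : coeff (fun _ : Torus d => (1 : ℝ)) k = 0 := by
    simpa using le_antisymm h3 (sq_nonneg _)
  have := coeff_smul c (fun _ : Torus d => (1 : ℝ)) k
  rwa [h4, mul_zero, mul_one] at this

lemma mul_coeff_const (j : Fin d) (k : Fin d → ℤ) (c : ℝ) :
    Complex.I * (k j : ℂ) * coeff (fun _ : Torus d => c) k = 0 := by
  by_cases hk : k = 0
  · simp [hk]
  · rw [coeff_const_of_ne hk, mul_zero]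

lemma coeff_zero_fun (k : Fin d → ℤ) : coeff (fun _ : Torus d => (0 : ℝ)) k = 0 := by
  simp [coeff]

lemma coeff_L2_zero : coeff ((0 : L2 d) : Torus d → ℝ) = fun _ => 0 := by
  rw [coeff_congr_ae (Lp.coeFn_zero ℝ 2 (volume : Measure (Torus d)))]
  ext k
  exact coeff_zero_fun k

lemma IsWeakDeriv.coeff_pow {j : Fin d} {w w' : Torus d → ℝ} (hw : IsWeakDeriv j w w') {M : ℝ}
    (hM : ∀ᵐ x, |w x| ≤ M) (n : ℕ) (k : Fin d → ℤ) :
    coeff (fun x => (n * w x ^ (n - 1)) * w' x) k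
      = Complex.I * (k j : ℂ) * coeff (fun x => w x ^ n) k := by
  induction n generalizing k with
  | zero =>
    simp only [Nat.cast_zero, zero_mul, pow_zero]
    rw [mul_coeff_const, coeff_zero_fun]
  | succ n ih =>
    have hn : IsWeakDeriv j (fun x => w x ^ n) (fun x => (n * w x ^ (n - 1)) * w' x) :=
      ⟨memLp_comp_of_bounded (h := fun y => y ^ n) (by fun_prop) hw.memLp hM,
        memLp_comp_mul (h := fun y => n * y ^ (n - 1)) (by fun_prop) hw.memLp hM hw.memLp', ih⟩
    have := hn.coeff_mul hw k
    simp only [← pow_succ] at this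
    rw [← this]
    congr 1
    ext x
    rcases n with _ | n
    · simp
    · simp only [Nat.add_sub_cancel]
      push_cast
      ring

/-- The chain rule for polynomials. -/
lemma IsWeakDeriv.coeff_polynomial {j : Fin d} {w w' : Torus d → ℝ} (hw : IsWeakDeriv j w w')
    {M : ℝ} (hM : ∀ᵐ x, |w x| ≤ M) (p : Polynomial ℝ) (k : Fin d → ℤ) :
    coeff (fun x => p.derivative.eval (w x) * w' x) k
      = Complex.I * (k j : ℂ) * coeff (fun x => p.eval (w x)) k := by
  induction p using Polynomial.induction_on' with
  | add p q hp hq =>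
    simp only [Polynomial.derivative_add, Polynomial.eval_add, add_mul]
    rw [coeff_add, coeff_add, hp, hq, mul_add]
    · exact (memLp_comp_of_bounded p.continuous hw.memLp hM).integrable_torus
    · exact (memLp_comp_of_bounded q.continuous hw.memLp hM).integrable_torus
    · exact (memLp_comp_mul p.derivative.continuous hw.memLp hM hw.memLp').integrable_torus
    · exact (memLp_comp_mul q.derivative.continuous hw.memLp hM hw.memLp').integrable_torus
  | monomial n a =>
    have := hw.coeff_pow hM n k
    simp only [Polynomial.derivative_monomial, Polynomial.eval_monomial]
    rw [coeff_smul, mul_left_comm, ← this, ← coeff_smul]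
    congr 1
    ext x
    ring

lemma exists_polynomial_derivative_eq (p : Polynomial ℝ) : ∃ q : Polynomial ℝ, q.derivative = p := by
  induction p using Polynomial.induction_on' with
  | add p q hp hq =>
    obtain ⟨a, rfl⟩ := hp
    obtain ⟨b, rfl⟩ := hq
    exact ⟨a + b, Polynomial.derivative_add⟩
  | monomial n a =>
    refine ⟨Polynomial.monomial (n + 1) (a / (n + 1)), ?_⟩
    rw [Polynomial.derivative_monomial]
    simp only [Nat.add_sub_cancel]
    congr 1
    have : (n : ℝ) + 1 ≠ 0 := by positivity
    push_cast
    field_simp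

/-- A `C¹` function is approximated on a bounded interval, together with its derivative, by
polynomials. -/
lemma exists_polynomial_near_C1 {h : ℝ → ℝ} (hh : ContDiff ℝ 1 h) {M ε : ℝ} (hM : 0 ≤ M)
    (hε : 0 < ε) :
    ∃ q : Polynomial ℝ, ∀ y ∈ Icc (-M) M,
      |deriv h y - q.derivative.eval y| ≤ ε ∧ |h y - q.eval y| ≤ ε * M := by
  obtain ⟨p, hp⟩ := exists_polynomial_near_of_continuousOn (-M) M (deriv h)
    (hh.continuous_deriv le_rfl).continuousOn ε hε
  obtain ⟨q₀, rfl⟩ := exists_polynomial_derivative_eq p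
  have h1 : ∀ y ∈ Icc (-M) M, |deriv h y - q₀.derivative.eval y| ≤ ε := fun y hy => by
    rw [abs_sub_comm]; exact (hp y hy).le
  refine ⟨q₀ + Polynomial.C (h 0 - q₀.eval 0), fun y hy => ⟨by simpa using h1 y hy, ?_⟩⟩
  have hd : Differentiable ℝ h := hh.differentiable one_ne_zero
  have hder : ∀ x, HasDerivAt (fun y => h y - q₀.eval y) (deriv h x - q₀.derivative.eval x) x :=
    fun x => (hd x).hasDerivAt.sub (q₀.hasDerivAt x)
  have := (convex_Icc (-M) M).norm_image_sub_le_of_norm_hasDerivWithin_le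
    (fun x _ => (hder x).hasDerivWithinAt) (fun x hx => h1 x hx) (x := 0) (y := y)
    ⟨by linarith, hM⟩ hy
  simp only [Polynomial.eval_add, Polynomial.eval_C]
  rw [Real.norm_eq_abs, Real.norm_eq_abs, sub_zero] at this
  calc |h y - (q₀.eval y + (h 0 - q₀.eval 0))| = |h y - q₀.eval y - (h 0 - q₀.eval 0)| := by
        congr 1; ring
    _ ≤ ε * |y| := this
    _ ≤ ε * M := by gcongr; exact abs_le.2 hy

/-- The chain rule for bounded functions with a square integrable weak derivative. -/
lemma IsWeakDeriv.coeff_comp {j : Fin d} {w w' : Torus d → ℝ} (hw : IsWeakDeriv j w w') {M : ℝ}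
    (hM : ∀ᵐ x, |w x| ≤ M) {h : ℝ → ℝ} (hh : ContDiff ℝ 1 h) (k : Fin d → ℤ) :
    coeff (fun x => deriv h (w x) * w' x) k
      = Complex.I * (k j : ℂ) * coeff (fun x => h (w x)) k := by
  wlog hM0 : 0 ≤ M generalizing M
  · exact this (M := |M|) (by filter_upwards [hM] with x hx using hx.trans (le_abs_self M))
      (abs_nonneg M)
  set c := ((2 * Real.pi) ^ d : ℝ)⁻¹ with hc
  have hc0 : 0 ≤ c := (inv_pos.2 (two_pi_pow_pos d)).le
  set V := (volume : Measure (Torus d)).real univ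
  set K := c * (∫ x, |w' x|) + ‖Complex.I * (k j : ℂ)‖ * (c * (M * V)) with hK
  have hdc : Continuous (deriv h) := hh.continuous_deriv le_rfl
  have key : ∀ ε > 0, ‖coeff (fun x => deriv h (w x) * w' x) k
      - Complex.I * (k j : ℂ) * coeff (fun x => h (w x)) k‖ ≤ ε * K := by
    intro ε hε
    obtain ⟨q, hq⟩ := exists_polynomial_near_C1 hh hM0 hε
    have e1 : coeff (fun x => deriv h (w x) * w' x - q.derivative.eval (w x) * w' x) k
        = coeff (fun x => deriv h (w x) * w' x) k
          - coeff (fun x => q.derivative.eval (w x) * w' x) k :=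
      coeff_sub (memLp_comp_mul hdc hw.memLp hM hw.memLp').integrable_torus
        (memLp_comp_mul q.derivative.continuous hw.memLp hM hw.memLp').integrable_torus k
    have e2 : coeff (fun x => h (w x) - q.eval (w x)) k
        = coeff (fun x => h (w x)) k - coeff (fun x => q.eval (w x)) k :=
      coeff_sub (memLp_comp_of_bounded hh.continuous hw.memLp hM).integrable_torus
        (memLp_comp_of_bounded q.continuous hw.memLp hM).integrable_torus k
    have e3 : coeff (fun x => deriv h (w x) * w' x) k
        - Complex.I * (k j : ℂ) * coeff (fun x => h (w x)) k
        = coeff (fun x => deriv h (w x) * w' x - q.derivative.eval (w x) * w' x) k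
          - Complex.I * (k j : ℂ) * coeff (fun x => h (w x) - q.eval (w x)) k := by
      rw [e1, e2, hw.coeff_polynomial hM q]
      ring
    have b1 : ‖coeff (fun x => deriv h (w x) * w' x - q.derivative.eval (w x) * w' x) k‖
        ≤ ε * (c * ∫ x, |w' x|) := by
      refine (norm_coeff_le _ k).trans ?_
      rw [mul_left_comm ε, ← integral_const_mul ε]
      refine mul_le_mul_of_nonneg_left ?_ hc0
      refine integral_mono_of_nonneg (Eventually.of_forall fun _ => abs_nonneg _)
        (hw.memLp'.integrable_torus.abs.const_mul ε) ?_
      filter_upwards [hM] with x hx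
      rw [← sub_mul, abs_mul]
      gcongr
      exact (hq _ (abs_le.1 hx)).1
    have b2 : ‖coeff (fun x => h (w x) - q.eval (w x)) k‖ ≤ ε * (c * (M * V)) := by
      refine (norm_coeff_le _ k).trans ?_
      rw [mul_left_comm]
      refine mul_le_mul_of_nonneg_left ?_ hc0
      calc ∫ x, |h (w x) - q.eval (w x)| ≤ ∫ _ : Torus d, ε * M := by
            refine integral_mono_of_nonneg (Eventually.of_forall fun _ => abs_nonneg _)
              (integrable_const _) ?_
            filter_upwards [hM] with x hx
            exact (hq _ (abs_le.1 hx)).2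
        _ = ε * (M * V) := by rw [integral_const, smul_eq_mul]; ring
    rw [e3]
    refine (norm_sub_le _ _).trans ?_
    rw [norm_mul _ (coeff _ k), hK, mul_add]
    refine add_le_add b1 ?_
    rw [mul_left_comm ε]
    gcongr
  have hK0 : 0 ≤ K := by
    have := key 1 one_pos
    rw [one_mul] at this
    exact (norm_nonneg _).trans this
  have : ‖coeff (fun x => deriv h (w x) * w' x) k
      - Complex.I * (k j : ℂ) * coeff (fun x => h (w x)) k‖ ≤ 0 := by
    refine le_of_forall_pos_le_add fun η hη => ?_
    have := key (η / (K + 1)) (by positivity)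
    refine this.trans ?_
    rw [zero_add, div_mul_eq_mul_div, div_le_iff₀ (by positivity)]
    nlinarith
  exact sub_eq_zero.1 (norm_le_zero_iff.1 this)

/-! ### Superposition operators on `H^s` -/

lemma exists_L2_of_wsq_lt_top {a : (Fin d → ℤ) → ℂ} (ha : wsq 0 a < ⊤)
    (hconj : ∀ k, a (-k) = conj (a k)) : ∃ v : L2 d, ∀ k, coeff v k = a k := by
  refine exists_L2_coeff_eq ?_ hconj
  have := ENNReal.summable_toReal ha.ne
  simpa [pw_zero] using this

lemma memLp_L2 (v : L2 d) : MemLp v 2 (volume : Measure (Torus d)) := Lp.memLp v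

lemma exists_isWeakDeriv {v : L2 d} (hv : wsq 1 (coeff v) < ⊤) (j : Fin d) :
    ∃ v' : L2 d, IsWeakDeriv j v v' := by
  obtain ⟨v', hv'⟩ := exists_L2_of_wsq_lt_top
    (a := fun k => Complex.I * (k j : ℂ) * coeff v k) (by
      refine lt_of_le_of_lt ?_ hv
      rw [← zero_add (1 : ℝ), wsq_succ]
      exact le_add_left (Finset.single_le_sum
        (f := fun j => wsq 0 (fun k => Complex.I * (k j : ℂ) * coeff v k)) (fun _ _ => zero_le)
        (Finset.mem_univ j))) (fun k => by
      rw [coeff_neg_eq_conj]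
      simp)
  exact ⟨v', memLp_L2 v, memLp_L2 v', hv'⟩

lemma IsWeakDeriv.wsq_le {j : Fin d} {v v' : Torus d → ℝ} (h : IsWeakDeriv j v v') (s : ℝ) :
    wsq (s - 1) (coeff v') ≤ wsq s (coeff v) := by
  have h1 : coeff v' = fun k => Complex.I * (k j : ℂ) * coeff v k := funext h.coeff_eq
  rw [h1]
  conv_rhs => rw [← sub_add_cancel s 1, wsq_succ]
  exact le_add_left (Finset.single_le_sum
    (f := fun j => wsq (s - 1) (fun k => Complex.I * (k j : ℂ) * coeff v k)) (fun _ _ => zero_le)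
    (Finset.mem_univ j))

lemma IsWeakDeriv.sub {j : Fin d} {u u' v v' : Torus d → ℝ} (hu : IsWeakDeriv j u u')
    (hv : IsWeakDeriv j v v') :
    IsWeakDeriv j (fun x => u x - v x) (fun x => u' x - v' x) :=
  ⟨hu.memLp.sub hv.memLp, hu.memLp'.sub hv.memLp', fun k => by
    rw [coeff_sub hu.memLp'.integrable_torus hv.memLp'.integrable_torus,
      coeff_sub hu.memLp.integrable_torus hv.memLp.integrable_torus, hu.coeff_eq, hv.coeff_eq]
    ring⟩

lemma IsWeakDeriv.comp {j : Fin d} {w w' : Torus d → ℝ} (hw : IsWeakDeriv j w w') {M : ℝ}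
    (hM : ∀ᵐ x, |w x| ≤ M) {h : ℝ → ℝ} (hh : ContDiff ℝ 1 h) :
    IsWeakDeriv j (fun x => h (w x)) (fun x => deriv h (w x) * w' x) :=
  ⟨memLp_comp_of_bounded hh.continuous hw.memLp hM,
    memLp_comp_mul (hh.continuous_deriv le_rfl) hw.memLp hM hw.memLp', hw.coeff_comp hM hh⟩

lemma wsq_zero_le_of_ae {F G : Torus d → ℝ} (hF : MemLp F 2 (volume : Measure (Torus d)))
    (hG : MemLp G 2 (volume : Measure (Torus d))) {c : ℝ≥0∞}
    (h : ∀ᵐ x, ‖F x‖ₑ ^ 2 ≤ c * ‖G x‖ₑ ^ 2) :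
    wsq 0 (coeff F) ≤ c * wsq 0 (coeff G) := by
  rw [wsq_zero_eq hF, wsq_zero_eq hG, mul_left_comm]
  gcongr
  rw [← lintegral_const_mul'' _ (hG.1.enorm.pow_const 2)]
  exact lintegral_mono_ae h

lemma exists_lipschitz_Icc {h : ℝ → ℝ} (hh : ContDiff ℝ 1 h) (M : ℝ) :
    ∃ L : ℝ≥0, ∀ a ∈ Icc (-M) M, ∀ b ∈ Icc (-M) M, ‖h a - h b‖ₑ ≤ L * ‖a - b‖ₑ := by
  obtain ⟨B, hB⟩ := (isCompact_Icc (a := -M) (b := M)).exists_bound_of_continuousOn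
    (hh.continuous_deriv le_rfl).continuousOn
  refine ⟨B.toNNReal, fun a ha b hb => ?_⟩
  have h1 := (convex_Icc (-M) M).norm_image_sub_le_of_norm_deriv_le (f := h)
    (fun x _ => hh.differentiable one_ne_zero x) hB hb ha
  have hB0 : 0 ≤ B := (norm_nonneg _).trans (hB a ha)
  rw [← ofReal_norm, ← ofReal_norm]
  refine (ENNReal.ofReal_le_ofReal h1).trans (le_of_eq ?_)
  rw [ENNReal.ofReal_mul hB0]
  rfl

lemma exists_ae_bound {s : ℝ} (hs : (d : ℝ) / 2 < s) (R : ℝ≥0) :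
    ∃ M : ℝ, ∀ v : L2 d, wsq s (coeff v) ≤ R → ∀ᵐ x, |v x| ≤ M := by
  set S := ∑' k : Fin d → ℤ, pw (-s) k
  have hS : S < ⊤ := tsum_pw_neg_lt_top hs
  have hSR : S * R ≠ ⊤ := by finiteness
  refine ⟨Real.sqrt (S * R).toReal, fun v hv => ?_⟩
  filter_upwards [ae_enorm_sq_le (memLp_L2 v) hs] with x hx
  refine Real.abs_le_sqrt ?_
  have h1 : ‖v x‖ₑ ^ 2 ≤ S * R := hx.trans (by gcongr)
  rw [← ofReal_norm, ← ENNReal.ofReal_pow (norm_nonneg _), Real.norm_eq_abs, sq_abs] at h1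
  exact (ENNReal.ofReal_le_iff_le_toReal hSR).1 h1

lemma wsq_const_lt_top (σ c : ℝ) : wsq σ (coeff fun _ : Torus d => c) < ⊤ := by
  unfold wsq
  rw [tsum_eq_single 0 fun k hk => by rw [coeff_const_of_ne hk]; simp]
  have := pw_ne_top σ (0 : Fin d → ℤ)
  finiteness

/-- A superposition operator with a smooth function is Lipschitz on bounded sets of `H^s`, as a map
into `H^σ` with `σ = min (1 + n / 4) s`. By the chain rule, a derivative of `h(v) - h(w)` is
`(h'(v) - h'(w)) ∂v + h'(w) ∂(v - w)`, and `s > d/2` being an integer gives `s ≥ d/2 + 1/2`, so that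
the product of `H^σ` and `H^{s-1}` lies in `H^{σ-3/4}`: each step gains a quarter of a derivative. -/
lemma exists_wsq_comp_sub_le_aux (s : ℕ) (hs1 : 1 ≤ s) (hs : (d : ℝ) / 2 < s) (R : ℝ≥0) (n : ℕ) :
    ∀ h : ℝ → ℝ, ContDiff ℝ ∞ h → ∃ C : ℝ≥0, ∀ v w : L2 d, wsq s (coeff v) ≤ R →
      wsq s (coeff w) ≤ R →
      wsq (min (1 + n / 4) s) (coeff fun x => h (v x) - h (w x))
        ≤ C * wsq s (coeff fun x => v x - w x) := by
  have hs1' : (1 : ℝ) ≤ s := by exact_mod_cast hs1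
  obtain ⟨M, hM⟩ := exists_ae_bound hs R
  set S := ∑' k : Fin d → ℤ, pw (-(s : ℝ)) k with hSdef
  have hS : S < ⊤ := tsum_pw_neg_lt_top hs
  have hdiff : ∀ (h : ℝ → ℝ), ContDiff ℝ ∞ h → ContDiff ℝ 1 h := fun h hh =>
    hh.of_le (by exact_mod_cast le_top)
  have hderiv : ∀ (h : ℝ → ℝ), ContDiff ℝ ∞ h → ContDiff ℝ ∞ (deriv h) := fun h hh =>
    (contDiff_infty_iff_deriv.1 hh).2
  have hlt : ∀ v : L2 d, wsq s (coeff v) ≤ R → wsq 1 (coeff v) < ⊤ := fun v hv =>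
    (wsq_mono hs1' _).trans_lt (hv.trans_lt ENNReal.coe_lt_top)
  -- the difference of the compositions has the expected derivative
  have hder : ∀ h : ℝ → ℝ, ContDiff ℝ ∞ h → ∀ v w : L2 d, wsq s (coeff v) ≤ R →
      wsq s (coeff w) ≤ R → ∀ (j : Fin d) (v' w' : L2 d), IsWeakDeriv j v v' → IsWeakDeriv j w w' →
      ∀ ρ, wsq ρ (fun k => Complex.I * (k j : ℂ) * coeff (fun x => h (v x) - h (w x)) k)
        ≤ 2 * (wsq ρ (coeff fun x => (deriv h (v x) - deriv h (w x)) * v' x)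
          + wsq ρ (coeff fun x => deriv h (w x) * (v' x - w' x))) := by
    intro h hh v w hv hw j v' w' hv' hw' ρ
    have h1 := (hv'.comp (hM v hv) (hdiff h hh)).sub (hw'.comp (hM w hw) (hdiff h hh))
    have hc := (hderiv h hh).continuous
    refine le_trans (le_of_eq ?_) (wsq_add_le ρ _ _)
    congr 1
    ext k
    rw [← h1.coeff_eq]
    have i1 : Integrable fun x => (deriv h (v x) - deriv h (w x)) * v' x := by
      have := ((memLp_comp_mul hc (memLp_L2 v) (hM v hv) (memLp_L2 v')).sub
        (memLp_comp_mul hc (memLp_L2 w) (hM w hw) (memLp_L2 v'))).integrable_torus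
      refine this.congr (Eventually.of_forall fun x => ?_)
      simp only [Pi.sub_apply]; ring
    have i2 : Integrable fun x => deriv h (w x) * (v' x - w' x) :=
      (memLp_comp_mul hc (memLp_L2 w) (hM w hw) ((memLp_L2 v').sub (memLp_L2 w'))).integrable_torus
    rw [← coeff_add i1 i2]
    congr 1
    ext x
    ring
  induction n with
  | zero =>
    intro h hh
    obtain ⟨L0, hL0⟩ := exists_lipschitz_Icc (hdiff h hh) M
    obtain ⟨L1, hL1⟩ := exists_lipschitz_Icc (hdiff _ (hderiv h hh)) M
    obtain ⟨B, hB⟩ := (isCompact_Icc (a := -M) (b := M)).exists_bound_of_continuousOn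
      (hderiv h hh).continuous.continuousOn
    have hCt : (L0 : ℝ≥0∞) ^ 2 + d * (2 * ((L1 : ℝ≥0∞) ^ 2 * S * R + ENNReal.ofReal B ^ 2)) ≠ ⊤ := by
      finiteness
    refine ⟨((L0 : ℝ≥0∞) ^ 2
      + d * (2 * ((L1 : ℝ≥0∞) ^ 2 * S * R + ENNReal.ofReal B ^ 2))).toNNReal, fun v w hv hw => ?_⟩
    rw [ENNReal.coe_toNNReal hCt]
    have hc := (hderiv h hh).continuous
    have hsub : MemLp (fun x => v x - w x) 2 (volume : Measure (Torus d)) :=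
      (memLp_L2 v).sub (memLp_L2 w)
    set D := wsq s (coeff fun x => v x - w x) with hD
    have h0D : wsq 0 (coeff fun x => v x - w x) ≤ D := wsq_mono (by positivity) _
    have e : min (1 + ((0 : ℕ) : ℝ) / 4) (s : ℝ) = 0 + 1 := by
      rw [min_eq_left] <;> simp [hs1]
    rw [e, wsq_succ, add_mul]
    refine add_le_add ?_ ?_
    · refine (wsq_zero_le_of_ae ?_ hsub (c := (L0 : ℝ≥0∞) ^ 2) ?_).trans (by gcongr)
      · exact (memLp_comp_of_bounded hh.continuous (memLp_L2 v) (hM v hv)).sub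
          (memLp_comp_of_bounded hh.continuous (memLp_L2 w) (hM w hw))
      · filter_upwards [hM v hv, hM w hw] with x hx hx'
        rw [← mul_pow]
        gcongr
        exact hL0 _ (abs_le.1 hx) _ (abs_le.1 hx')
    · have hj : ∀ j : Fin d, wsq 0 (fun k => Complex.I * (k j : ℂ)
          * coeff (fun x => h (v x) - h (w x)) k)
          ≤ 2 * ((L1 : ℝ≥0∞) ^ 2 * S * R + ENNReal.ofReal B ^ 2) * D := by
        intro j
        obtain ⟨v', hv'⟩ := exists_isWeakDeriv (hlt v hv) j
        obtain ⟨w', hw'⟩ := exists_isWeakDeriv (hlt w hw) j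
        refine (hder h hh v w hv hw j v' w' hv' hw' 0).trans ?_
        rw [mul_assoc, add_mul]
        gcongr
        · have : wsq 0 (coeff v') ≤ R :=
            ((wsq_mono (by linarith) _).trans (hv'.wsq_le s)).trans hv
          refine (wsq_zero_le_of_ae (G := v') ?_ (memLp_L2 v') (c := (L1 : ℝ≥0∞) ^ 2 * (S * D))
            ?_).trans ?_
          · have := (memLp_comp_mul hc (memLp_L2 v) (hM v hv) (memLp_L2 v')).sub
              (memLp_comp_mul hc (memLp_L2 w) (hM w hw) (memLp_L2 v'))
            convert this using 2 with x
            simp only [Pi.sub_apply]; ring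
          · filter_upwards [hM v hv, hM w hw, ae_enorm_sq_le hsub hs] with x hx hx' hx2
            rw [enorm_mul, mul_pow]
            gcongr
            calc ‖deriv h (v x) - deriv h (w x)‖ₑ ^ 2 ≤ (L1 * ‖v x - w x‖ₑ) ^ 2 := by
                  gcongr
                  exact hL1 _ (abs_le.1 hx) _ (abs_le.1 hx')
              _ = (L1 : ℝ≥0∞) ^ 2 * ‖v x - w x‖ₑ ^ 2 := mul_pow _ _ _
              _ ≤ _ := by gcongr
          · calc (L1 : ℝ≥0∞) ^ 2 * (S * D) * wsq 0 (coeff v') ≤ (L1 : ℝ≥0∞) ^ 2 * (S * D) * R := by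
                  gcongr
              _ = _ := by ring
        · have hsub' : MemLp (fun x => v' x - w' x) 2 (volume : Measure (Torus d)) :=
            (memLp_L2 v').sub (memLp_L2 w')
          refine (wsq_zero_le_of_ae (G := fun x => v' x - w' x) ?_ hsub'
            (c := ENNReal.ofReal B ^ 2) ?_).trans ?_
          · exact memLp_comp_mul hc (memLp_L2 w) (hM w hw) hsub'
          · filter_upwards [hM w hw] with x hx
            rw [enorm_mul, mul_pow]
            gcongr
            rw [← ofReal_norm]
            exact ENNReal.ofReal_le_ofReal (hB _ (abs_le.1 hx))
          · gcongr
            exact (wsq_mono (by linarith) _).trans ((hv'.sub hw').wsq_le s)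
      refine (Finset.sum_le_sum fun j _ => hj j).trans (le_of_eq ?_)
      rw [Finset.sum_const, Finset.card_univ, Fintype.card_fin, nsmul_eq_mul]
      ring
  | succ n ih =>
    intro h hh
    set σ : ℝ := min (1 + n / 4) s with hσ
    set ρ : ℝ := min (1 + ((n + 1 : ℕ) : ℝ) / 4) (s : ℝ) - 1 with hρ
    have hn0 : (0 : ℝ) ≤ n := by positivity
    have hρ0 : 0 ≤ ρ := by
      rw [hρ, sub_nonneg]
      exact le_min (by linarith [(by positivity : (0 : ℝ) ≤ ((n + 1 : ℕ) : ℝ) / 4)]) hs1'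
    have hρs : ρ ≤ (s : ℝ) - 1 := by
      rw [hρ]; linarith [min_le_right (1 + ((n + 1 : ℕ) : ℝ) / 4) (s : ℝ)]
    have hρσ' : ρ ≤ σ - 3 / 4 := by
      rw [hρ, hσ]
      push_cast
      rcases min_choice (1 + (n : ℝ) / 4) (s : ℝ) with h1 | h1 <;> rw [h1]
      · linarith [min_le_left (1 + ((n : ℝ) + 1) / 4) (s : ℝ)]
      · linarith [min_le_right (1 + ((n : ℝ) + 1) / 4) (s : ℝ)]
    have hρσ : ρ ≤ σ := by linarith
    have hsd : (d : ℝ) / 2 + 1 / 2 ≤ s := by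
      have h1 : (d : ℝ) < 2 * s := by linarith
      have h2 : d < 2 * s := by exact_mod_cast h1
      have h3 : d + 1 ≤ 2 * s := h2
      have h4 : (d : ℝ) + 1 ≤ 2 * s := by exact_mod_cast h3
      linarith
    obtain ⟨C0, hC0⟩ := ih h hh
    obtain ⟨C1, hC1⟩ := ih _ (hderiv h hh)
    obtain ⟨P, hP⟩ := wsq_coeff_mul_le (d := d) (τ := (s : ℝ) - 1) hρ0 hρσ hρs (by linarith)
    set A := wsq σ (coeff fun _ : Torus d => deriv h 0) with hA
    have hAt : A < ⊤ := wsq_const_lt_top _ _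
    have hCt : (C0 : ℝ≥0∞) + d * (2 * (P * C1 * R + P * (2 * (C1 * R + A)))) ≠ ⊤ := by finiteness
    refine ⟨((C0 : ℝ≥0∞) + d * (2 * (P * C1 * R + P * (2 * (C1 * R + A))))).toNNReal,
      fun v w hv hw => ?_⟩
    rw [ENNReal.coe_toNNReal hCt]
    have hc := (hderiv h hh).continuous
    set D := wsq s (coeff fun x => v x - w x) with hD
    rw [show min (1 + ((n + 1 : ℕ) : ℝ) / 4) (s : ℝ) = ρ + 1 by rw [hρ]; ring, wsq_succ, add_mul]
    refine add_le_add ((wsq_mono hρσ _).trans (hC0 v w hv hw)) ?_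
    have hmv := memLp_comp_of_bounded hc (memLp_L2 v) (hM v hv)
    have hmw := memLp_comp_of_bounded hc (memLp_L2 w) (hM w hw)
    -- the composition itself is bounded, by comparison with a constant
    have hbdd : wsq σ (coeff fun x => deriv h (w x)) ≤ 2 * (C1 * R + A) := by
      have hz := coeff_L2_zero (d := d)
      have h1 := hC1 w 0 hw (by rw [hz]; simp [wsq])
      have h2 : coeff (fun x => deriv h (w x) - deriv h ((0 : L2 d) x))
          = coeff (fun x => deriv h (w x) - deriv h 0) := coeff_congr_ae (by
        filter_upwards [Lp.coeFn_zero ℝ 2 (volume : Measure (Torus d))] with x hx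
        rw [hx]; rfl)
      have h3 : coeff (fun x => w x - (0 : L2 d) x) = coeff w := coeff_congr_ae (by
        filter_upwards [Lp.coeFn_zero ℝ 2 (volume : Measure (Torus d))] with x hx
        rw [hx]; simp)
      rw [h2, h3] at h1
      have h4 : coeff (fun x => deriv h (w x)) = fun k =>
          coeff (fun x => deriv h (w x) - deriv h 0) k + coeff (fun _ : Torus d => deriv h 0) k := by
        ext k
        rw [coeff_sub hmw.integrable_torus (integrable_const _), sub_add_cancel]
      rw [h4]
      refine (wsq_add_le _ _ _).trans ?_
      gcongr
      exact h1.trans (by gcongr)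
    have hj : ∀ j : Fin d, wsq ρ (fun k => Complex.I * (k j : ℂ)
        * coeff (fun x => h (v x) - h (w x)) k)
        ≤ 2 * (P * C1 * R + P * (2 * (C1 * R + A))) * D := by
      intro j
      obtain ⟨v', hv'⟩ := exists_isWeakDeriv (hlt v hv) j
      obtain ⟨w', hw'⟩ := exists_isWeakDeriv (hlt w hw) j
      refine (hder h hh v w hv hw j v' w' hv' hw' ρ).trans ?_
      rw [mul_assoc, add_mul]
      gcongr
      · refine (hP _ _ (hmv.sub hmw) (memLp_L2 v')).trans ?_
        calc (P : ℝ≥0∞) * (wsq σ (coeff fun x => deriv h (v x) - deriv h (w x))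
              * wsq (s - 1) (coeff v')) ≤ P * ((C1 * D) * R) := by
              gcongr
              · exact hC1 v w hv hw
              · exact (hv'.wsq_le s).trans hv
          _ = _ := by ring
      · refine (hP _ _ hmw ((memLp_L2 v').sub (memLp_L2 w'))).trans ?_
        rw [mul_assoc]
        gcongr
        exact (hv'.sub hw').wsq_le s
    refine (Finset.sum_le_sum fun j _ => hj j).trans (le_of_eq ?_)
    rw [Finset.sum_const, Finset.card_univ, Fintype.card_fin, nsmul_eq_mul]
    ring

lemma coeff_L2_sub (v w : L2 d) (k : Fin d → ℤ) : coeff (v - w : L2 d) k = coeff v k - coeff w k := by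
  rw [← coeff_sub (memLp_L2 v).integrable_torus (memLp_L2 w).integrable_torus]
  exact congrFun (coeff_congr_ae (Lp.coeFn_sub v w)) k

lemma coeff_L2_add (v w : L2 d) (k : Fin d → ℤ) : coeff (v + w : L2 d) k = coeff v k + coeff w k := by
  rw [← coeff_add (memLp_L2 v).integrable_torus (memLp_L2 w).integrable_torus]
  exact congrFun (coeff_congr_ae (Lp.coeFn_add v w)) k

lemma coeff_L2_smul (c : ℝ) (v : L2 d) (k : Fin d → ℤ) : coeff (c • v : L2 d) k = c * coeff v k := by
  rw [← coeff_smul]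
  exact congrFun (coeff_congr_ae (Lp.coeFn_smul c v)) k

/-- A superposition operator with a smooth function is Lipschitz on bounded sets of `H^s`. -/
lemma exists_wsq_comp_sub_le {s : ℕ} (hs1 : 1 ≤ s) (hs : (d : ℝ) / 2 < s) {h : ℝ → ℝ}
    (hh : ContDiff ℝ ∞ h) (R : ℝ≥0) :
    ∃ C : ℝ≥0, ∀ v w : L2 d, wsq s (coeff v) ≤ R → wsq s (coeff w) ≤ R →
      wsq s (fun k => coeff (fun x => h (v x)) k - coeff (fun x => h (w x)) k)
        ≤ C * wsq s (coeff (v - w : L2 d)) := by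
  obtain ⟨C, hC⟩ := exists_wsq_comp_sub_le_aux s hs1 hs R (4 * s) h hh
  obtain ⟨M, hM⟩ := exists_ae_bound hs R
  refine ⟨C, fun v w hv hw => ?_⟩
  have h1 := hC v w hv hw
  rw [min_eq_right (by push_cast; linarith)] at h1
  rw [coeff_congr_ae (Lp.coeFn_sub v w)]
  refine le_trans (le_of_eq ?_) h1
  congr 1
  ext k
  rw [coeff_sub (memLp_comp_of_bounded hh.continuous (memLp_L2 v) (hM v hv)).integrable_torus
    (memLp_comp_of_bounded hh.continuous (memLp_L2 w) (hM w hw)).integrable_torus]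

lemma wsq_comp_lt_top {s : ℕ} (hs1 : 1 ≤ s) (hs : (d : ℝ) / 2 < s) {h : ℝ → ℝ}
    (hh : ContDiff ℝ ∞ h) {v : L2 d} (hv : wsq s (coeff v) < ⊤) :
    wsq s (coeff fun x => h (v x)) < ⊤ := by
  obtain ⟨C, hC⟩ := exists_wsq_comp_sub_le hs1 hs hh (wsq s (coeff v)).toNNReal
  have hz := coeff_L2_zero (d := d)
  have h1 := hC v 0 (ENNReal.coe_toNNReal hv.ne).ge (by rw [hz]; simp [wsq])
  have h2 : coeff (fun x => h ((0 : L2 d) x)) = coeff (fun _ => h 0) := coeff_congr_ae (by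
    filter_upwards [Lp.coeFn_zero ℝ 2 (volume : Measure (Torus d))] with x hx
    rw [hx]; rfl)
  rw [h2, sub_zero] at h1
  have h3 := wsq_add_le s (fun k => coeff (fun x => h (v x)) k - coeff (fun _ : Torus d => h 0) k)
    (coeff fun _ : Torus d => h 0)
  simp only [sub_add_cancel] at h3
  refine h3.trans_lt ?_
  have := wsq_const_lt_top (d := d) s (h 0)
  have : (C : ℝ≥0∞) * wsq s (coeff v) < ⊤ := by finiteness
  have := h1.trans_lt this
  finiteness

/-! ### Gronwall's inequality -/

lemma lintegral_exp_le {c : ℝ} (hc : 0 < c) (t : ℝ) (S : Set ℝ) :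
    ∫⁻ r in S ∩ Iic t, ENNReal.ofReal (Real.exp (-(c * (t - r)))) ≤ ENNReal.ofReal c⁻¹ := by
  have e : ∀ r, Real.exp (-(c * (t - r))) = Real.exp (-(c * t)) * Real.exp (c * r) := fun r => by
    rw [← Real.exp_add]; congr 1; ring
  calc ∫⁻ r in S ∩ Iic t, ENNReal.ofReal (Real.exp (-(c * (t - r))))
      ≤ ∫⁻ r in Iic t, ENNReal.ofReal (Real.exp (-(c * (t - r)))) :=
        lintegral_mono_set inter_subset_right
    _ = ENNReal.ofReal (∫ r in Iic t, Real.exp (-(c * (t - r)))) := by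
        simp only [e]
        rw [ofReal_integral_eq_lintegral_ofReal ((integrableOn_exp_mul_Iic hc t).const_mul _)
          (Eventually.of_forall fun r => by positivity)]
    _ = ENNReal.ofReal c⁻¹ := by
        simp only [e]
        rw [integral_const_mul, integral_exp_mul_Iic hc]
        congr 1
        rw [← mul_div_assoc, ← Real.exp_add]
        simp

lemma lintegral_exp_le' {c : ℝ} (hc : 0 < c) (r : ℝ) (S : Set ℝ) :
    ∫⁻ t in S ∩ Ici r, ENNReal.ofReal (Real.exp (-(c * (t - r)))) ≤ ENNReal.ofReal c⁻¹ := by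
  have e : ∀ t, Real.exp (-(c * (t - r))) = Real.exp (c * r) * Real.exp (-c * t) := fun t => by
    rw [← Real.exp_add]; congr 1; ring
  calc ∫⁻ t in S ∩ Ici r, ENNReal.ofReal (Real.exp (-(c * (t - r))))
      ≤ ∫⁻ t in Ici r, ENNReal.ofReal (Real.exp (-(c * (t - r)))) :=
        lintegral_mono_set inter_subset_right
    _ = ∫⁻ t in Ioi r, ENNReal.ofReal (Real.exp (-(c * (t - r)))) :=
        setLIntegral_congr Ioi_ae_eq_Ici.symm
    _ = ENNReal.ofReal (∫ t in Ioi r, Real.exp (-(c * (t - r)))) := by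
        simp only [e]
        rw [ofReal_integral_eq_lintegral_ofReal
          ((integrableOn_exp_mul_Ioi (neg_neg_of_pos hc) r).const_mul _)
          (Eventually.of_forall fun r => by positivity)]
    _ = ENNReal.ofReal c⁻¹ := by
        simp only [e]
        rw [integral_const_mul, integral_exp_mul_Ioi (neg_neg_of_pos hc)]
        congr 1
        rw [neg_div_neg_eq, ← mul_div_assoc, ← Real.exp_add]
        simp

/-- Gronwall's inequality for bounded functions with values in `[0, ∞]`. The weighted supremum
`sup_t e^{-2K(t-a)} z(t)` is at most `A` plus one half of itself. -/
lemma exists_gronwall (K : ℝ≥0) (T : ℝ) : ∃ C : ℝ≥0, ∀ (a b : ℝ) (z : ℝ → ℝ≥0∞) (A B : ℝ≥0∞),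
    b ≤ a + T → B < ⊤ → (∀ t ∈ Icc a b, z t ≤ B) →
    (∀ t ∈ Icc a b, z t ≤ A + K * ∫⁻ τ in Icc a t, z τ) → ∀ t ∈ Icc a b, z t ≤ C * A := by
  set c : ℝ := 2 * (K + 1) with hc
  have hc0 : 0 < c := by positivity
  refine ⟨Real.toNNReal (2 * Real.exp (c * T)), fun a b z A B hT hB hzB hz t ht => ?_⟩
  set w : ℝ → ℝ≥0∞ := fun t => ENNReal.ofReal (Real.exp (-(c * (t - a)))) with hw
  set M := ⨆ t ∈ Icc a b, w t * z t with hM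
  have hwle : ∀ t ∈ Icc a b, w t ≤ 1 := fun t ht => by
    rw [← ENNReal.ofReal_one]
    refine ENNReal.ofReal_le_ofReal (Real.exp_le_one_iff.2 ?_)
    have := ht.1
    nlinarith
  have hMB : M ≤ B := iSup₂_le fun t ht => by
    calc w t * z t ≤ 1 * B := mul_le_mul' (hwle t ht) (hzB t ht)
      _ = B := one_mul _
  have hMtop : M ≠ ⊤ := (hMB.trans_lt hB).ne
  have hzM : ∀ t ∈ Icc a b, z t ≤ ENNReal.ofReal (Real.exp (c * (t - a))) * M := fun t ht => by
    calc z t = ENNReal.ofReal (Real.exp (c * (t - a))) * (w t * z t) := by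
          rw [hw, ← mul_assoc, ← ENNReal.ofReal_mul (by positivity), ← Real.exp_add]
          simp
      _ ≤ _ := by
          gcongr
          exact le_iSup₂ (f := fun t _ => w t * z t) t ht
  have hhalf : M ≤ A + 2⁻¹ * M := iSup₂_le fun t ht => by
    have h1 : w t * ∫⁻ τ in Icc a t, z τ ≤ ENNReal.ofReal c⁻¹ * M := by
      calc w t * ∫⁻ τ in Icc a t, z τ
          ≤ w t * ∫⁻ τ in Icc a t, ENNReal.ofReal (Real.exp (c * (τ - a))) * M := by
            exact mul_le_mul' le_rfl (setLIntegral_mono' measurableSet_Icc fun τ hτ =>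
              hzM τ ⟨hτ.1, hτ.2.trans ht.2⟩)
        _ = (∫⁻ τ in Icc a t, ENNReal.ofReal (Real.exp (-(c * (t - τ))))) * M := by
            rw [lintegral_mul_const _ (by fun_prop), ← mul_assoc,
              ← lintegral_const_mul _ (by fun_prop)]
            congr 1
            refine lintegral_congr fun τ => ?_
            rw [hw, ← ENNReal.ofReal_mul (by positivity), ← Real.exp_add]
            congr 2
            ring
        _ ≤ ENNReal.ofReal c⁻¹ * M := by
            gcongr
            rw [← Ici_inter_Iic]
            exact lintegral_exp_le hc0 t _
    have h2 : (K : ℝ≥0∞) * ENNReal.ofReal c⁻¹ ≤ 2⁻¹ := by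
      rw [← ENNReal.ofReal_coe_nnreal, ← ENNReal.ofReal_mul (by positivity),
        show (2⁻¹ : ℝ≥0∞) = ENNReal.ofReal 2⁻¹ by
          rw [ENNReal.ofReal_inv_of_pos (by norm_num)]; norm_num]
      refine ENNReal.ofReal_le_ofReal ?_
      rw [hc, ← div_eq_mul_inv, div_le_iff₀ (by positivity)]
      linarith
    calc w t * z t ≤ w t * (A + K * ∫⁻ τ in Icc a t, z τ) := by gcongr; exact hz t ht
      _ = w t * A + K * (w t * ∫⁻ τ in Icc a t, z τ) := by ring
      _ ≤ 1 * A + K * (ENNReal.ofReal c⁻¹ * M) := by gcongr; exact hwle t ht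
      _ = A + K * ENNReal.ofReal c⁻¹ * M := by ring
      _ ≤ _ := by gcongr
  have hM2 : M ≤ 2 * A := by
    rcases eq_or_ne A ⊤ with rfl | hA
    · simp
    lift M to ℝ≥0 using hMtop with m
    lift A to ℝ≥0 using hA
    rw [show (2⁻¹ : ℝ≥0∞) = ((2⁻¹ : ℝ≥0) : ℝ≥0∞) by simp] at hhalf
    have h3 : m ≤ A + 2⁻¹ * m := by exact_mod_cast hhalf
    have h4 : (m : ℝ) ≤ A + 2⁻¹ * m := by exact_mod_cast h3
    have h5 : m ≤ 2 * A := by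
      rw [← NNReal.coe_le_coe]; push_cast; linarith
    exact_mod_cast h5
  calc z t ≤ ENNReal.ofReal (Real.exp (c * (t - a))) * M := hzM t ht
    _ ≤ ENNReal.ofReal (Real.exp (c * T)) * (2 * A) := by
        gcongr
        linarith [ht.2]
    _ = _ := by
        change _ = ENNReal.ofReal _ * A
        rw [ENNReal.ofReal_mul (by norm_num)]
        norm_num
        ring

/-! ### The scalar linear equation `y' = -λ y + h` -/

/-- Fubini's theorem on the triangle `a ≤ r ≤ τ ≤ t`. -/
lemma integral_mul_primitive_eq {φ : ℝ → ℂ} (hφ : Continuous φ) {g : ℝ → ℂ} {a t : ℝ} (hat : a ≤ t)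
    (hg : IntegrableOn g (Icc a t)) :
    ∫ τ in a..t, φ τ * ∫ r in a..τ, g r = ∫ r in a..t, (∫ τ in r..t, φ τ) * g r := by
  have hg' : IntegrableOn g (Ioc a t) := hg.mono_set Ioc_subset_Icc_self
  set F : ℝ → ℝ → ℂ := fun τ r => (Iic τ).indicator (fun r => φ τ * g r) r with hF
  obtain ⟨B, hB⟩ := (isCompact_Icc (a := a) (b := t)).exists_bound_of_continuousOn hφ.continuousOn
  have hint : Integrable (Function.uncurry F)
      ((volume.restrict (Ioc a t)).prod (volume.restrict (Ioc a t))) := by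
    have h1 : Integrable (fun p : ℝ × ℝ => φ p.1 * g p.2)
        ((volume.restrict (Ioc a t)).prod (volume.restrict (Ioc a t))) :=
      ((hφ.integrableOn_Icc (a := a) (b := t)).mono_set Ioc_subset_Icc_self).mul_prod hg'
    have h2 : Function.uncurry F = {p : ℝ × ℝ | p.2 ≤ p.1}.indicator fun p => φ p.1 * g p.2 := by
      ext ⟨τ, r⟩
      simp [F, indicator]
    rw [h2]
    exact h1.indicator (measurableSet_le measurable_snd measurable_fst)
  have hswap := integral_integral_swap hint
  rw [intervalIntegral.integral_of_le hat, intervalIntegral.integral_of_le hat]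
  convert hswap using 1
  · refine setIntegral_congr_fun measurableSet_Ioc fun τ hτ => ?_
    simp only [hF]
    rw [integral_indicator measurableSet_Iic, Measure.restrict_restrict measurableSet_Iic,
      integral_const_mul, intervalIntegral.integral_of_le hτ.1.le]
    congr 3
    ext r
    simp only [mem_Ioc, mem_inter_iff, mem_Iic]
    constructor
    · rintro ⟨h1, h2⟩; exact ⟨h2, h1, h2.trans hτ.2⟩
    · rintro ⟨h1, h2, _⟩; exact ⟨h2, h1⟩
  · refine setIntegral_congr_fun measurableSet_Ioc fun r hr => ?_
    simp only [hF]
    have h3 : ∀ τ, (Iic τ).indicator (fun r => φ τ * g r) r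
        = (Ici r).indicator (fun τ => φ τ * g r) τ := fun τ => by
      simp [indicator]
    simp only [h3]
    rw [integral_indicator measurableSet_Ici, Measure.restrict_restrict measurableSet_Ici,
      integral_mul_const, intervalIntegral.integral_of_le hr.2]
    congr 1
    refine setIntegral_congr_set ?_
    have : Ici r ∩ Ioc a t = Icc r t := by
      ext τ
      simp only [mem_inter_iff, mem_Ici, mem_Ioc, mem_Icc]
      constructor
      · rintro ⟨h1, _, h2⟩; exact ⟨h1, h2⟩
      · rintro ⟨h1, h2⟩; exact ⟨h1, hr.1.trans_le h1, h2⟩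
    rw [this]
    exact Ioc_ae_eq_Icc

/-- Duhamel's formula for the solution of `y' = -λ y + h`, `y(a) = c`. -/
def duhamel (l a : ℝ) (c : ℂ) (h : ℝ → ℂ) (t : ℝ) : ℂ :=
  (Real.exp (-(l * (t - a))) : ℂ) * c + ∫ r in a..t, (Real.exp (-(l * (t - r))) : ℂ) * h r

lemma duhamel_self (l a : ℝ) (c : ℂ) (h : ℝ → ℂ) : duhamel l a c h a = c := by
  simp [duhamel]

lemma duhamel_conj (l a : ℝ) (c : ℂ) (h : ℝ → ℂ) (t : ℝ) :
    duhamel l a (conj c) (fun r => conj (h r)) t = conj (duhamel l a c h t) := by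
  unfold duhamel
  rw [map_add, map_mul, Complex.conj_ofReal, intervalIntegral.intervalIntegral_eq_integral_uIoc,
    intervalIntegral.intervalIntegral_eq_integral_uIoc, Complex.real_smul, Complex.real_smul,
    map_mul, Complex.conj_ofReal, ← integral_conj]
  simp only [map_mul, Complex.conj_ofReal]

lemma duhamel_eq_mul (l a : ℝ) (c : ℂ) (h : ℝ → ℂ) (t : ℝ) :
    duhamel l a c h t = (Real.exp (-(l * (t - a))) : ℂ)
      * (c + ∫ r in a..t, (Real.exp (l * (r - a)) : ℂ) * h r) := by
  unfold duhamel
  rw [mul_add, ← intervalIntegral.integral_const_mul]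
  congr 2
  ext r
  rw [← mul_assoc, ← Complex.ofReal_mul, ← Real.exp_add]
  congr 3
  ring_nf

lemma integrableOn_exp_mul {h : ℝ → ℂ} {S : Set ℝ} (hS : IsCompact S) (hh : IntegrableOn h S)
    {e : ℝ → ℝ} (he : Continuous e) : IntegrableOn (fun r => (Real.exp (e r) : ℂ) * h r) S :=
  hh.continuousOn_mul (by fun_prop) hS

lemma continuousOn_duhamel (l : ℝ) {a b : ℝ} (c : ℂ) {h : ℝ → ℂ}
    (hh : IntegrableOn h (Icc a b)) : ContinuousOn (duhamel l a c h) (Icc a b) := by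
  rcases lt_or_ge b a with hab | hab
  · simp [Icc_eq_empty_of_lt hab]
  have h1 : ContinuousOn (fun t => ∫ r in a..t, (Real.exp (l * (r - a)) : ℂ) * h r) (Icc a b) := by
    rw [← uIcc_of_le hab]
    refine intervalIntegral.continuousOn_primitive_interval ?_
    rw [uIcc_of_le hab]
    exact integrableOn_exp_mul isCompact_Icc hh (by fun_prop)
  have h2 : duhamel l a c h = fun t => (Real.exp (-(l * (t - a))) : ℂ)
      * (c + ∫ r in a..t, (Real.exp (l * (r - a)) : ℂ) * h r) := funext fun t => duhamel_eq_mul ..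
  rw [h2]
  exact ContinuousOn.mul (by fun_prop) (continuousOn_const.add h1)

lemma duhamel_solves (l : ℝ) {a b : ℝ} (c : ℂ) {h : ℝ → ℂ} (hh : IntegrableOn h (Icc a b)) {t : ℝ}
    (ht : t ∈ Icc a b) :
    duhamel l a c h t = c + ∫ τ in a..t, (-(l : ℂ) * duhamel l a c h τ + h τ) := by
  have hat : a ≤ t := ht.1
  have hht : IntegrableOn h (Icc a t) := hh.mono_set (Icc_subset_Icc_right ht.2)
  set g : ℝ → ℂ := fun r => (Real.exp (l * (r - a)) : ℂ) * h r with hg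
  have hgi : IntegrableOn g (Icc a t) := integrableOn_exp_mul isCompact_Icc hht (by fun_prop)
  set φ : ℝ → ℂ := fun τ => -(l : ℂ) * (Real.exp (-(l * (τ - a))) : ℂ) with hφ
  have hφc : Continuous φ := by fun_prop
  have hφint : ∀ r, ∫ τ in r..t, φ τ
      = (Real.exp (-(l * (t - a))) : ℂ) - (Real.exp (-(l * (r - a))) : ℂ) := fun r => by
    refine intervalIntegral.integral_eq_sub_of_hasDerivAt
      (f := fun τ => (Real.exp (-(l * (τ - a))) : ℂ)) (fun τ _ => ?_) (hφc.intervalIntegrable _ _)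
    have h1 : HasDerivAt (fun τ => Real.exp (-(l * (τ - a))))
        (Real.exp (-(l * (τ - a))) * (-(l * 1))) τ :=
      ((((hasDerivAt_id τ).sub_const a).const_mul l).neg).exp
    refine h1.ofReal_comp.congr_deriv ?_
    simp only [hφ]
    push_cast
    ring
  have ii : ∀ {f : ℝ → ℂ}, IntegrableOn f (Icc a t) → IntervalIntegrable f volume a t := fun hf =>
    (intervalIntegrable_iff_integrableOn_Icc_of_le hat).2 hf
  have hprim : ContinuousOn (fun τ => ∫ r in a..τ, g r) (Icc a t) := by
    rw [← uIcc_of_le hat]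
    refine intervalIntegral.continuousOn_primitive_interval ?_
    rwa [uIcc_of_le hat]
  have i1 : IntervalIntegrable (fun τ => φ τ * c) volume a t :=
    (hφc.mul continuous_const).intervalIntegrable _ _
  have i2 : IntervalIntegrable (fun τ => φ τ * ∫ r in a..τ, g r) volume a t :=
    ii ((hφc.continuousOn.mul hprim).integrableOn_Icc)
  have e1 : ∀ τ, -(l : ℂ) * duhamel l a c h τ + h τ
      = (φ τ * c + φ τ * ∫ r in a..τ, g r) + h τ := fun τ => by
    rw [duhamel_eq_mul]
    simp only [hφ, hg]
    ring
  simp only [e1]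
  rw [intervalIntegral.integral_add (i1.add i2) (ii hht), intervalIntegral.integral_add i1 i2,
    integral_mul_primitive_eq hφc hat hgi, intervalIntegral.integral_mul_const, hφint]
  simp only [hφint, sub_mul]
  have i3 : IntervalIntegrable (fun r => (Real.exp (-(l * (t - a))) : ℂ) * g r) volume a t :=
    (ii hgi).const_mul _
  have i4 : IntervalIntegrable (fun r => (Real.exp (-(l * (r - a))) : ℂ) * g r) volume a t :=
    ii (integrableOn_exp_mul isCompact_Icc hgi (by fun_prop))
  rw [intervalIntegral.integral_sub i3 i4, intervalIntegral.integral_const_mul, duhamel_eq_mul]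
  have e2 : ∀ r, (Real.exp (-(l * (r - a))) : ℂ) * g r = h r := fun r => by
    simp only [hg]
    rw [← mul_assoc, ← Complex.ofReal_mul, ← Real.exp_add, neg_add_cancel, Real.exp_zero]
    simp
  simp only [e2, sub_self, mul_zero, neg_zero, Real.exp_zero, Complex.ofReal_one, one_mul]
  ring

/-- The integrated equation has only one continuous solution. -/
lemma eq_duhamel {l a b : ℝ} {h y : ℝ → ℂ} (hh : IntegrableOn h (Icc a b))
    (hy : ContinuousOn y (Icc a b))
    (heq : ∀ t ∈ Icc a b, y t = y a + ∫ τ in a..t, (-(l : ℂ) * y τ + h τ)) :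
    ∀ t ∈ Icc a b, y t = duhamel l a (y a) h t := by
  set D := duhamel l a (y a) h with hD
  have hDc : ContinuousOn D (Icc a b) := continuousOn_duhamel l (y a) hh
  obtain ⟨B, hB⟩ := isCompact_Icc.exists_bound_of_continuousOn (hy.sub hDc)
  obtain ⟨C, hC⟩ := exists_gronwall ‖l‖₊ (b - a)
  have hdiff : ∀ t ∈ Icc a b, y t - D t = ∫ τ in a..t, -(l : ℂ) * (y τ - D τ) := fun t ht => by
    have hs : Icc a t ⊆ Icc a b := Icc_subset_Icc_right ht.2
    have ii : ∀ {f : ℝ → ℂ}, IntegrableOn f (Icc a t) → IntervalIntegrable f volume a t := fun hf =>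
      (intervalIntegrable_iff_integrableOn_Icc_of_le ht.1).2 hf
    rw [heq t ht, hD, duhamel_solves l (y a) hh ht, add_sub_add_left_eq_sub,
      ← intervalIntegral.integral_sub]
    · refine intervalIntegral.integral_congr fun τ _ => ?_
      ring
    · exact (ii ((hy.mono hs).integrableOn_Icc.const_mul _)).add (ii (hh.mono_set hs))
    · exact (ii ((hDc.mono hs).integrableOn_Icc.const_mul _)).add (ii (hh.mono_set hs))
  intro t ht
  have := hC a b (fun τ => ‖y τ - D τ‖ₑ) 0 (ENNReal.ofReal B) (by linarith) ENNReal.ofReal_lt_top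
    (fun τ hτ => by rw [← ofReal_norm]; exact ENNReal.ofReal_le_ofReal (hB τ hτ))
    (fun τ hτ => by
      rw [hdiff τ hτ, zero_add, intervalIntegral.integral_of_le hτ.1]
      refine (enorm_integral_le_lintegral_enorm _).trans ?_
      simp only [enorm_mul, enorm_neg]
      rw [lintegral_const_mul' _ _ (by simp)]
      refine mul_le_mul' (le_of_eq ?_) (lintegral_mono_set Ioc_subset_Icc_self)
      rw [← ofReal_norm, Complex.norm_real, ofReal_norm]
      rfl) t ht
  rw [mul_zero] at this
  simpa [sub_eq_zero] using this

/-- Pointwise bound of Duhamel's formula on intervals of length `T`. The decay rate `λ + ν` instead of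
`λ`, which may vanish, costs a factor `e^{νT}`. -/
lemma enorm_duhamel_sq_le {l ν T : ℝ} (hl : 0 ≤ l) (hν : 0 < ν) {a t : ℝ} (hat : a ≤ t)
    (htT : t ≤ a + T) (c : ℂ) {h : ℝ → ℂ} (hh : IntegrableOn h (Icc a t)) :
    ‖duhamel l a c h t‖ₑ ^ 2 ≤ ENNReal.ofReal (2 * Real.exp (ν * T) ^ 2) *
      (ENNReal.ofReal (Real.exp (-((l + ν) * (t - a)))) * ‖c‖ₑ ^ 2 + ENNReal.ofReal (l + ν)⁻¹ *
        ∫⁻ r in Icc a t, ENNReal.ofReal (Real.exp (-((l + ν) * (t - r)))) * ‖h r‖ₑ ^ 2) := by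
  set μ := l + ν with hμ
  have hμ0 : 0 < μ := by positivity
  set M := Real.exp (ν * T) with hM
  have hexp : ∀ r ∈ Icc a t, Real.exp (-(l * (t - r))) ≤ M * Real.exp (-(μ * (t - r))) := fun r hr => by
    rw [hM, ← Real.exp_add, Real.exp_le_exp, hμ]
    have : ν * (t - r) ≤ ν * T := by
      gcongr
      linarith [hr.1]
    linarith
  have henorm : ∀ r, ‖(Real.exp (-(l * (t - r))) : ℂ)‖ₑ = ENNReal.ofReal (Real.exp (-(l * (t - r)))) :=
    fun r => by
      rw [← ofReal_norm, Complex.norm_real, Real.norm_of_nonneg (Real.exp_pos _).le]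
  set E : ℝ → ℝ≥0∞ := fun r => ENNReal.ofReal (Real.exp (-(μ * (t - r)))) with hE
  have hEh : ∀ r, E r = ENNReal.ofReal (Real.exp (-(μ * (t - r)) / 2)) ^ 2 := fun r => by
    rw [← ENNReal.ofReal_pow (by positivity), sq, ← Real.exp_add, add_halves]
  set I := ∫⁻ r in Icc a t, E r * ‖h r‖ₑ with hI
  have hhm : AEMeasurable (fun r => ‖h r‖ₑ) (volume.restrict (Icc a t)) := hh.1.enorm
  have hI2 : I ^ 2 ≤ ENNReal.ofReal μ⁻¹ * ∫⁻ r in Icc a t, E r * ‖h r‖ₑ ^ 2 := by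
    have h1 := lintegral_mul_sq_le (volume.restrict (Icc a t))
      (f := fun r => ENNReal.ofReal (Real.exp (-(μ * (t - r)) / 2)))
      (g := fun r => ENNReal.ofReal (Real.exp (-(μ * (t - r)) / 2)) * ‖h r‖ₑ)
      (by fun_prop) ((by fun_prop : AEMeasurable _ _).mul hhm)
    simp only [← mul_assoc, ← sq, mul_pow, ← hEh] at h1
    refine h1.trans ?_
    gcongr
    rw [← Ici_inter_Iic]
    exact lintegral_exp_le hμ0 t _
  have h1 : ‖duhamel l a c h t‖ₑ ≤ ENNReal.ofReal M * (E a * ‖c‖ₑ + I) := by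
    unfold duhamel
    refine (enorm_add_le _ _).trans ?_
    rw [mul_add]
    refine add_le_add ?_ ?_
    · rw [enorm_mul, henorm, ← mul_assoc, ← ENNReal.ofReal_mul (by positivity)]
      gcongr
      exact hexp a ⟨le_rfl, hat⟩
    · rw [intervalIntegral.integral_of_le hat, hI, ← lintegral_const_mul' _ _ ENNReal.ofReal_ne_top]
      refine (enorm_integral_le_lintegral_enorm _).trans
        ((lintegral_mono_set Ioc_subset_Icc_self).trans ?_)
      refine setLIntegral_mono' measurableSet_Icc fun r hr => ?_
      rw [enorm_mul, henorm, ← mul_assoc, ← ENNReal.ofReal_mul (by positivity)]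
      gcongr
      exact hexp r hr
  have hE1 : E a ≤ 1 := by
    rw [hE, ← ENNReal.ofReal_one]
    refine ENNReal.ofReal_le_ofReal (Real.exp_le_one_iff.2 ?_)
    nlinarith
  calc ‖duhamel l a c h t‖ₑ ^ 2 ≤ (ENNReal.ofReal M * (E a * ‖c‖ₑ + I)) ^ 2 := by gcongr
    _ ≤ ENNReal.ofReal M ^ 2 * (2 * ((E a * ‖c‖ₑ) ^ 2 + I ^ 2)) := by
        rw [mul_pow]
        gcongr
        exact ennreal_add_sq_le _ _
    _ ≤ ENNReal.ofReal M ^ 2 * (2 * (E a * ‖c‖ₑ ^ 2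
          + ENNReal.ofReal μ⁻¹ * ∫⁻ r in Icc a t, E r * ‖h r‖ₑ ^ 2)) := by
        gcongr
        rw [mul_pow]
        gcongr
        calc E a ^ 2 = E a * E a := sq _
          _ ≤ E a * 1 := by gcongr
          _ = E a := mul_one _
    _ = _ := by
        rw [ENNReal.ofReal_mul (by norm_num), ENNReal.ofReal_pow (by positivity)]
        norm_num
        ring

lemma enorm_duhamel_sq_le_sup {l ν T : ℝ} (hl : 0 ≤ l) (hν : 0 < ν) {a t : ℝ} (hat : a ≤ t)
    (htT : t ≤ a + T) (c : ℂ) {h : ℝ → ℂ} (hh : IntegrableOn h (Icc a t)) :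
    ‖duhamel l a c h t‖ₑ ^ 2 ≤ ENNReal.ofReal (2 * Real.exp (ν * T) ^ 2) *
      (‖c‖ₑ ^ 2 + ENNReal.ofReal (l + ν)⁻¹ * ∫⁻ r in Icc a t, ‖h r‖ₑ ^ 2) := by
  have hone : ∀ r ≤ t, ENNReal.ofReal (Real.exp (-((l + ν) * (t - r)))) ≤ 1 := fun r hr => by
    rw [← ENNReal.ofReal_one]
    refine ENNReal.ofReal_le_ofReal (Real.exp_le_one_iff.2 ?_)
    have : 0 ≤ (l + ν) * (t - r) := mul_nonneg (by positivity) (by linarith)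
    linarith
  refine (enorm_duhamel_sq_le hl hν hat htT c hh).trans ?_
  refine mul_le_mul' le_rfl (add_le_add ?_ (mul_le_mul' le_rfl ?_))
  · exact (mul_le_mul' (hone a hat) le_rfl).trans (one_mul _).le
  · exact setLIntegral_mono' measurableSet_Icc fun r hr =>
      (mul_le_mul' (hone r hr.2) le_rfl).trans (one_mul _).le

/-- The `L²` bound of Duhamel's formula: compared to the pointwise bound, integration in time gains a
factor `(λ + ν)⁻¹`. -/
lemma lintegral_enorm_duhamel_sq_le {l ν T : ℝ} (hl : 0 ≤ l) (hν : 0 < ν) {a b : ℝ}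
    (hbT : b ≤ a + T) (c : ℂ) {h : ℝ → ℂ} (hh : IntegrableOn h (Icc a b)) :
    ∫⁻ t in Icc a b, ‖duhamel l a c h t‖ₑ ^ 2 ≤ ENNReal.ofReal (2 * Real.exp (ν * T) ^ 2) *
      (ENNReal.ofReal (l + ν)⁻¹ * (‖c‖ₑ ^ 2 +
        ENNReal.ofReal (l + ν)⁻¹ * ∫⁻ r in Icc a b, ‖h r‖ₑ ^ 2)) := by
  set μ := l + ν with hμ
  have hμ0 : 0 < μ := by positivity
  set k : ℝ → ℝ≥0∞ := fun x => ENNReal.ofReal (Real.exp (-(μ * x))) with hk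
  set κ : ℝ → ℝ → ℝ≥0∞ := fun t r => (Ici r).indicator (fun t => k (t - r)) t * ‖h r‖ₑ ^ 2 with hκ
  have hkm : Measurable k := by fun_prop
  have hκm : AEMeasurable (Function.uncurry κ)
      ((volume.restrict (Icc a b)).prod (volume.restrict (Icc a b))) := by
    have h1 : AEMeasurable (fun p : ℝ × ℝ => ‖h p.2‖ₑ ^ 2)
        ((volume.restrict (Icc a b)).prod (volume.restrict (Icc a b))) :=
      (hh.1.enorm.pow_const 2).comp_quasiMeasurePreserving Measure.quasiMeasurePreserving_snd
    have h2 : Measurable ({p : ℝ × ℝ | p.2 ≤ p.1}.indicator fun p => k (p.1 - p.2)) :=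
      (hkm.comp (measurable_fst.sub measurable_snd)).indicator
        (measurableSet_le measurable_snd measurable_fst)
    refine (h2.aemeasurable.mul h1).congr (Eventually.of_forall fun p => ?_)
    simp [hκ, indicator, Function.uncurry]
  have hκle : ∀ r, ∫⁻ t in Icc a b, κ t r ≤ ENNReal.ofReal μ⁻¹ * ‖h r‖ₑ ^ 2 := fun r => by
    simp only [hκ]
    rw [lintegral_mul_const (f := (Ici r).indicator fun t => k (t - r)) _
      ((hkm.comp (measurable_id.sub_const r)).indicator measurableSet_Ici)]
    gcongr
    rw [lintegral_indicator measurableSet_Ici, Measure.restrict_restrict measurableSet_Ici, inter_comm]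
    exact lintegral_exp_le' hμ0 r _
  calc ∫⁻ t in Icc a b, ‖duhamel l a c h t‖ₑ ^ 2
      ≤ ∫⁻ t in Icc a b, ENNReal.ofReal (2 * Real.exp (ν * T) ^ 2) *
          (k (t - a) * ‖c‖ₑ ^ 2 + ENNReal.ofReal μ⁻¹ * ∫⁻ r in Icc a b, κ t r) := by
        refine setLIntegral_mono' measurableSet_Icc fun t ht => ?_
        refine (enorm_duhamel_sq_le hl hν ht.1 (ht.2.trans hbT) c
          (hh.mono_set (Icc_subset_Icc_right ht.2))).trans ?_
        refine mul_le_mul' le_rfl (add_le_add le_rfl (mul_le_mul' le_rfl ?_))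
        rw [← lintegral_indicator measurableSet_Icc, ← lintegral_indicator measurableSet_Icc]
        refine lintegral_mono fun r => ?_
        simp only [indicator, hκ, mem_Icc, mem_Ici]
        split_ifs with h1 h2 h3
        · exact le_rfl
        · exact absurd h1.2 h3
        · exact absurd ⟨h1.1, h1.2.trans ht.2⟩ h2
        all_goals exact zero_le
    _ = ENNReal.ofReal (2 * Real.exp (ν * T) ^ 2) *
          ((∫⁻ t in Icc a b, k (t - a)) * ‖c‖ₑ ^ 2
            + ENNReal.ofReal μ⁻¹ * ∫⁻ t in Icc a b, ∫⁻ r in Icc a b, κ t r) := by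
        rw [lintegral_const_mul' _ _ ENNReal.ofReal_ne_top, lintegral_add_left (by fun_prop),
          lintegral_mul_const _ (by fun_prop), lintegral_const_mul' _ _ ENNReal.ofReal_ne_top]
    _ ≤ ENNReal.ofReal (2 * Real.exp (ν * T) ^ 2) *
          (ENNReal.ofReal μ⁻¹ * ‖c‖ₑ ^ 2
            + ENNReal.ofReal μ⁻¹ * (ENNReal.ofReal μ⁻¹ * ∫⁻ r in Icc a b, ‖h r‖ₑ ^ 2)) := by
        gcongr
        · rw [← Ici_inter_Iic, inter_comm]
          exact lintegral_exp_le' hμ0 a _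
        · rw [lintegral_lintegral_swap hκm, ← lintegral_const_mul' _ _ ENNReal.ofReal_ne_top]
          exact lintegral_mono hκle
    _ = _ := by ring

/-! ### The linear heat equation on Fourier coefficients -/

/-- The family `y` of Fourier coefficients solves `∂ₜ y - νΔy = h` on the time interval `[a, b]`, in
the integrated sense. -/
structure IsLinSol (ν a b : ℝ) (h y : ℝ → (Fin d → ℤ) → ℂ) : Prop where
  integrableOn : ∀ k, IntegrableOn (fun t => h t k) (Icc a b)
  continuousOn : ∀ k, ContinuousOn (fun t => y t k) (Icc a b)
  equation : ∀ t ∈ Icc a b, ∀ k,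
    y t k = y a k + ∫ τ in a..t, (-((ν * freqSq k : ℝ) : ℂ) * y τ k + h τ k)

lemma IsLinSol.eq_duhamel {ν a b : ℝ} {h y : ℝ → (Fin d → ℤ) → ℂ} (H : IsLinSol ν a b h y)
    {t : ℝ} (ht : t ∈ Icc a b) (k : Fin d → ℤ) :
    y t k = duhamel (ν * freqSq k) a (y a k) (fun τ => h τ k) t :=
  ParabolicTorus.eq_duhamel (H.integrableOn k) (H.continuousOn k) (fun t ht => H.equation t ht k) t ht

lemma isLinSol_duhamel {ν a b : ℝ} {h : ℝ → (Fin d → ℤ) → ℂ} (c : (Fin d → ℤ) → ℂ)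
    (hh : ∀ k, IntegrableOn (fun t => h t k) (Icc a b)) :
    IsLinSol ν a b h fun t k => duhamel (ν * freqSq k) a (c k) (fun τ => h τ k) t where
  integrableOn := hh
  continuousOn k := continuousOn_duhamel _ _ (hh k)
  equation t ht k := by
    rw [duhamel_self]
    exact duhamel_solves _ _ (hh k) ht

lemma intervalIntegrable_of_Icc {f : ℝ → ℂ} {a b t : ℝ} (hf : IntegrableOn f (Icc a b))
    (ht : t ∈ Icc a b) : IntervalIntegrable f volume a t :=
  (intervalIntegrable_iff_integrableOn_Icc_of_le ht.1).2 (hf.mono_set (Icc_subset_Icc_right ht.2))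

lemma IsLinSol.integrableOn_rhs {ν a b : ℝ} {h y : ℝ → (Fin d → ℤ) → ℂ} (H : IsLinSol ν a b h y)
    (k : Fin d → ℤ) :
    IntegrableOn (fun τ => -((ν * freqSq k : ℝ) : ℂ) * y τ k + h τ k) (Icc a b) :=
  ((H.continuousOn k).integrableOn_Icc.const_mul _).add (H.integrableOn k)

lemma IsLinSol.sub {ν a b : ℝ} {h₁ y₁ h₂ y₂ : ℝ → (Fin d → ℤ) → ℂ} (H₁ : IsLinSol ν a b h₁ y₁)
    (H₂ : IsLinSol ν a b h₂ y₂) :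
    IsLinSol ν a b (fun t k => h₁ t k - h₂ t k) (fun t k => y₁ t k - y₂ t k) where
  integrableOn k := (H₁.integrableOn k).sub (H₂.integrableOn k)
  continuousOn k := (H₁.continuousOn k).sub (H₂.continuousOn k)
  equation t ht k := by
    rw [H₁.equation t ht k, H₂.equation t ht k, add_sub_add_comm, ← intervalIntegral.integral_sub
      (intervalIntegrable_of_Icc (H₁.integrableOn_rhs k) ht)
      (intervalIntegrable_of_Icc (H₂.integrableOn_rhs k) ht)]
    congr 1
    refine intervalIntegral.integral_congr fun τ _ => ?_
    ring

lemma IsLinSol.restrict {ν a b a' b' : ℝ} {h y : ℝ → (Fin d → ℤ) → ℂ} (H : IsLinSol ν a b h y)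
    (ha : a ≤ a') (hb : b' ≤ b) : IsLinSol ν a' b' h y where
  integrableOn k := (H.integrableOn k).mono_set (Icc_subset_Icc ha hb)
  continuousOn k := (H.continuousOn k).mono (Icc_subset_Icc ha hb)
  equation t ht k := by
    have hi : ∀ {t}, t ∈ Icc a b →
        IntervalIntegrable (fun τ => -((ν * freqSq k : ℝ) : ℂ) * y τ k + h τ k) volume a t :=
      fun ht => intervalIntegrable_of_Icc (H.integrableOn_rhs k) ht
    have ha' : a' ∈ Icc a b := ⟨ha, ht.1.trans (ht.2.trans hb)⟩
    have ht' : t ∈ Icc a b := ⟨ha.trans ht.1, ht.2.trans hb⟩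
    rw [H.equation t ht' k, H.equation a' ha' k, add_assoc,
      intervalIntegral.integral_add_adjacent_intervals (hi ha') ((hi ha').symm.trans (hi ht'))]

lemma lintegral_wsq {S : Set ℝ} {h : ℝ → (Fin d → ℤ) → ℂ}
    (hh : ∀ k, AEStronglyMeasurable (fun t => h t k) (volume.restrict S)) (σ : ℝ) :
    ∫⁻ t in S, wsq σ (h t) = ∑' k, pw σ k * ∫⁻ t in S, ‖h t k‖ₑ ^ 2 := by
  unfold wsq
  rw [lintegral_tsum fun k => ((hh k).enorm.pow_const 2).const_mul _]
  exact tsum_congr fun k => lintegral_const_mul' _ _ (pw_ne_top σ k)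

lemma ofReal_rate_inv {ν : ℝ} (hν : 0 < ν) (k : Fin d → ℤ) :
    ENNReal.ofReal (ν * freqSq k + ν)⁻¹ = ENNReal.ofReal ν⁻¹ * pw (-1) k := by
  rw [pw, ← ENNReal.ofReal_mul (by positivity), Real.rpow_neg_one, wt, ← mul_inv]
  congr 2
  ring

/-- The constant in the parabolic estimates on time intervals of length at most `T`. -/
def linConst (ν T : ℝ) : ℝ≥0 :=
  Real.toNNReal (2 * Real.exp (ν * T) ^ 2) * (1 + Real.toNNReal ν⁻¹) ^ 2

lemma IsLinSol.pw_mul_le {ν a b T : ℝ} (hν : 0 < ν) (hT : b ≤ a + T) {h y : ℝ → (Fin d → ℤ) → ℂ}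
    (H : IsLinSol ν a b h y) (σ : ℝ) {t : ℝ} (ht : t ∈ Icc a b) (k : Fin d → ℤ) :
    pw σ k * ‖y t k‖ₑ ^ 2 ≤ linConst ν T *
      (pw σ k * ‖y a k‖ₑ ^ 2 + pw (σ - 1) k * ∫⁻ r in Icc a t, ‖h r k‖ₑ ^ 2) := by
  rw [H.eq_duhamel ht k]
  have h1 := enorm_duhamel_sq_le_sup (mul_nonneg hν.le (freqSq_nonneg k)) hν ht.1
    (ht.2.trans hT) (y a k) ((H.integrableOn k).mono_set (Icc_subset_Icc_right ht.2))
  rw [ofReal_rate_inv hν] at h1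
  have e1 : pw (σ - 1) k = pw σ k * pw (-1) k := by rw [← pw_add]; rfl
  have hv : (1 : ℝ≥0∞) ≤ (1 + ENNReal.ofReal ν⁻¹) ^ 2 := one_le_pow₀ le_self_add
  have hv2 : ENNReal.ofReal ν⁻¹ ≤ (1 + ENNReal.ofReal ν⁻¹) ^ 2 :=
    le_add_self.trans (le_self_pow₀ le_self_add two_ne_zero)
  have hC : (linConst ν T : ℝ≥0∞)
      = ENNReal.ofReal (2 * Real.exp (ν * T) ^ 2) * (1 + ENNReal.ofReal ν⁻¹) ^ 2 := by
    simp only [linConst, ENNReal.ofReal]; push_cast; rfl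
  set c := ENNReal.ofReal (2 * Real.exp (ν * T) ^ 2)
  set J := ∫⁻ r in Icc a t, ‖h r k‖ₑ ^ 2
  rw [hC, e1]
  calc _ ≤ pw σ k * (c * (‖y a k‖ₑ ^ 2 + ENNReal.ofReal ν⁻¹ * pw (-1) k * J)) := by gcongr
    _ = c * (1 * (pw σ k * ‖y a k‖ₑ ^ 2) + ENNReal.ofReal ν⁻¹ * (pw σ k * pw (-1) k * J)) := by ring
    _ ≤ c * ((1 + ENNReal.ofReal ν⁻¹) ^ 2 * (pw σ k * ‖y a k‖ₑ ^ 2)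
          + (1 + ENNReal.ofReal ν⁻¹) ^ 2 * (pw σ k * pw (-1) k * J)) := by gcongr
    _ = _ := by ring

/-- The bound in `C(H^σ)`, by the forcing term in `L²(H^{σ-1})`. -/
lemma IsLinSol.wsq_le {ν a b T : ℝ} (hν : 0 < ν) (hT : b ≤ a + T) {h y : ℝ → (Fin d → ℤ) → ℂ}
    (H : IsLinSol ν a b h y) (σ : ℝ) {t : ℝ} (ht : t ∈ Icc a b) :
    wsq σ (y t) ≤ linConst ν T * (wsq σ (y a) + ∫⁻ r in Icc a t, wsq (σ - 1) (h r)) := by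
  rw [lintegral_wsq fun k => ((H.integrableOn k).mono_set (Icc_subset_Icc_right ht.2)).1]
  unfold wsq
  rw [← ENNReal.tsum_add, ← ENNReal.tsum_mul_left]
  exact ENNReal.tsum_le_tsum fun k => H.pw_mul_le hν hT σ ht k

/-- The bound in `L²(H^{σ+1})`, by the forcing term in `L²(H^{σ-1})`. -/
lemma IsLinSol.lintegral_wsq_le {ν a b T : ℝ} (hν : 0 < ν) (hT : b ≤ a + T)
    {h y : ℝ → (Fin d → ℤ) → ℂ} (H : IsLinSol ν a b h y) (σ : ℝ) :
    ∫⁻ t in Icc a b, wsq (σ + 1) (y t) ≤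
      linConst ν T * (wsq σ (y a) + ∫⁻ r in Icc a b, wsq (σ - 1) (h r)) := by
  rw [lintegral_wsq fun k => (H.integrableOn k).1,
    lintegral_wsq fun k => (H.continuousOn k).aestronglyMeasurable measurableSet_Icc]
  unfold wsq
  rw [← ENNReal.tsum_add, ← ENNReal.tsum_mul_left]
  refine ENNReal.tsum_le_tsum fun k => ?_
  have h0 : ∫⁻ t in Icc a b, ‖y t k‖ₑ ^ 2
      = ∫⁻ t in Icc a b, ‖duhamel (ν * freqSq k) a (y a k) (fun τ => h τ k) t‖ₑ ^ 2 :=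
    setLIntegral_congr_fun measurableSet_Icc fun t ht => by
      rw [H.eq_duhamel ht k]
  rw [h0]
  have h1 := lintegral_enorm_duhamel_sq_le (mul_nonneg hν.le (freqSq_nonneg k)) hν
    hT (y a k) (H.integrableOn k)
  rw [ofReal_rate_inv hν] at h1
  have e1 : pw (σ - 1) k = pw (σ + 1) k * (pw (-1) k * pw (-1) k) := by
    rw [← pw_add, ← pw_add]; congr 1; ring
  have e2 : pw σ k = pw (σ + 1) k * pw (-1) k := by rw [← pw_add]; congr 1; ring
  have hv1 : ENNReal.ofReal ν⁻¹ ≤ (1 + ENNReal.ofReal ν⁻¹) ^ 2 :=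
    le_add_self.trans (le_self_pow₀ le_self_add two_ne_zero)
  have hv2 : ENNReal.ofReal ν⁻¹ ^ 2 ≤ (1 + ENNReal.ofReal ν⁻¹) ^ 2 :=
    pow_le_pow_left' le_add_self 2
  have hC : (linConst ν T : ℝ≥0∞)
      = ENNReal.ofReal (2 * Real.exp (ν * T) ^ 2) * (1 + ENNReal.ofReal ν⁻¹) ^ 2 := by
    simp only [linConst, ENNReal.ofReal]; push_cast; rfl
  set c := ENNReal.ofReal (2 * Real.exp (ν * T) ^ 2)
  set J := ∫⁻ r in Icc a b, ‖h r k‖ₑ ^ 2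
  rw [hC, e1, e2]
  calc _ ≤ pw (σ + 1) k * (c * (ENNReal.ofReal ν⁻¹ * pw (-1) k *
          (‖y a k‖ₑ ^ 2 + ENNReal.ofReal ν⁻¹ * pw (-1) k * J))) := by gcongr
    _ = c * (ENNReal.ofReal ν⁻¹ * (pw (σ + 1) k * pw (-1) k * ‖y a k‖ₑ ^ 2)
          + ENNReal.ofReal ν⁻¹ ^ 2 * (pw (σ + 1) k * (pw (-1) k * pw (-1) k) * J)) := by ring
    _ ≤ c * ((1 + ENNReal.ofReal ν⁻¹) ^ 2 * (pw (σ + 1) k * pw (-1) k * ‖y a k‖ₑ ^ 2)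
          + (1 + ENNReal.ofReal ν⁻¹) ^ 2 * (pw (σ + 1) k * (pw (-1) k * pw (-1) k) * J)) := by
        gcongr
    _ = _ := by ring

/-- Solutions are continuous in time with values in `H^σ`: the bounds for the single modes are
uniform in time and summable. -/
lemma IsLinSol.tendsto_wsq {ν a b : ℝ} (hν : 0 < ν) {h y : ℝ → (Fin d → ℤ) → ℂ}
    (H : IsLinSol ν a b h y) {σ : ℝ} (hy : wsq σ (y a) < ⊤)
    (hh : ∫⁻ r in Icc a b, wsq (σ - 1) (h r) < ⊤) {t₀ : ℝ} (ht₀ : t₀ ∈ Icc a b) :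
    Tendsto (fun t => wsq σ fun k => y t k - y t₀ k) (𝓝[Icc a b] t₀) (𝓝 0) := by
  let _ : MeasurableSpace (Fin d → ℤ) := ⊤
  set bd : (Fin d → ℤ) → ℝ≥0∞ := fun k => linConst ν (b - a) *
      (pw σ k * ‖y a k‖ₑ ^ 2 + pw (σ - 1) k * ∫⁻ r in Icc a b, ‖h r k‖ₑ ^ 2) with hbd
  have hbdt : ∑' k, bd k < ⊤ := by
    rw [hbd, ENNReal.tsum_mul_left, ENNReal.tsum_add, ← lintegral_wsq fun k => (H.integrableOn k).1]
    exact ENNReal.mul_lt_top ENNReal.coe_lt_top (ENNReal.add_lt_top.2 ⟨hy, hh⟩)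
  have hle : ∀ t ∈ Icc a b, ∀ k, pw σ k * ‖y t k‖ₑ ^ 2 ≤ bd k := fun t ht k =>
    (H.pw_mul_le hν (T := b - a) (by linarith) σ ht k).trans (by
      simp only [hbd]
      gcongr
      exact ht.2)
  have key := tendsto_lintegral_filter_of_dominated_convergence (μ := Measure.count)
    (l := 𝓝[Icc a b] t₀) (F := fun t k => pw σ k * ‖y t k - y t₀ k‖ₑ ^ 2) (f := fun _ => 0)
    (fun k => 4 * bd k) (Eventually.of_forall fun _ => measurable_from_top) ?_ ?_ ?_
  · simp only [lintegral_count, tsum_zero] at key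
    exact key
  · filter_upwards [self_mem_nhdsWithin] with t ht
    refine Eventually.of_forall fun k => ?_
    calc pw σ k * ‖y t k - y t₀ k‖ₑ ^ 2 ≤ pw σ k * (‖y t k‖ₑ + ‖y t₀ k‖ₑ) ^ 2 := by
          gcongr; exact enorm_sub_le
      _ ≤ pw σ k * (2 * (‖y t k‖ₑ ^ 2 + ‖y t₀ k‖ₑ ^ 2)) := by gcongr; exact ennreal_add_sq_le _ _
      _ = 2 * (pw σ k * ‖y t k‖ₑ ^ 2 + pw σ k * ‖y t₀ k‖ₑ ^ 2) := by ring
      _ ≤ 2 * (bd k + bd k) := by gcongr <;> apply hle <;> assumption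
      _ = 4 * bd k := by ring
  · rw [lintegral_count, ENNReal.tsum_mul_left]
    finiteness
  · refine Eventually.of_forall fun k => ?_
    have h1 : Tendsto (fun t => ‖y t k - y t₀ k‖ₑ ^ 2) (𝓝[Icc a b] t₀) (𝓝 0) := by
      have h2 : Tendsto (fun t => y t k - y t₀ k) (𝓝[Icc a b] t₀) (𝓝 0) := by
        have : Tendsto (fun t => y t k - y t₀ k) (𝓝[Icc a b] t₀) (𝓝 (y t₀ k - y t₀ k)) :=
          ((H.continuousOn k) t₀ ht₀).tendsto.sub_const _
        rwa [sub_self] at this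
      have := (ENNReal.continuous_pow 2).tendsto _ |>.comp h2.enorm
      simpa [Function.comp_def] using this
    have := ENNReal.Tendsto.const_mul h1 (Or.inr (pw_ne_top σ k))
    rwa [mul_zero] at this

/-! ### Bessel potentials -/

/-- The factor `(2π)^{-d}` between the squared `ℓ²` norm of the Fourier coefficients and the squared
`L²` norm. -/
def parsevalConst (d : ℕ) : ℝ≥0∞ := (ENNReal.ofReal ((2 * Real.pi) ^ d))⁻¹

lemma parsevalConst_ne_zero : parsevalConst d ≠ 0 := by simp [parsevalConst]

lemma parsevalConst_ne_top : parsevalConst d ≠ ⊤ := by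
  have := two_pi_pow_pos d
  simp [parsevalConst, this]

lemma wsq_zero_L2 (v : L2 d) : wsq 0 (coeff v) = parsevalConst d * ‖v‖ₑ ^ 2 := by
  rw [wsq_zero_eq (memLp_L2 v), Lp.enorm_def, eLpNorm_eq_lintegral_rpow_enorm_toReal (by norm_num) (by norm_num)]
  rw [← ENNReal.rpow_two, ← ENNReal.rpow_mul]
  norm_num
  rfl

lemma L2_ext {v w : L2 d} (h : ∀ k, coeff v k = coeff w k) : v = w :=
  Lp.ext (coeff_injective (memLp_L2 v) (memLp_L2 w) (funext h))

lemma memH_iff {σ : ℕ} {v : L2 d} : MemH σ v ↔ wsq σ (coeff v) < ⊤ := by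
  rw [← sobNorm_sq, MemH, ENNReal.pow_lt_top_iff]
  simp

lemma wsq_weight_mul (σ τ : ℝ) (a : (Fin d → ℤ) → ℂ) :
    wsq σ (fun k => ((wt k ^ (τ / 2) : ℝ) : ℂ) * a k) = wsq (σ + τ) a := by
  unfold wsq
  refine tsum_congr fun k => ?_
  have h0 : ‖((wt k ^ (τ / 2) : ℝ) : ℂ)‖ₑ = pw (τ / 2) k := by
    rw [← ofReal_norm, Complex.norm_real, Real.norm_of_nonneg (Real.rpow_nonneg (wt_pos k).le _)]
    rfl
  rw [enorm_mul, mul_pow, ← mul_assoc, h0, pw_half_sq, pw_add]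

lemma wt_neg (k : Fin d → ℤ) : wt (-k) = wt k := by simp [wt, freqSq]

lemma exists_bessel (τ : ℝ) (v : L2 d) (hv : wsq τ (coeff v) < ⊤) :
    ∃ w : L2 d, ∀ k, coeff w k = ((wt k ^ (τ / 2) : ℝ) : ℂ) * coeff v k := by
  refine exists_L2_of_wsq_lt_top ?_ fun k => ?_
  · rw [wsq_weight_mul, zero_add]; exact hv
  · rw [coeff_neg_eq_conj, wt_neg, map_mul, Complex.conj_ofReal]

open Classical in
/-- The Bessel potential `(1 - Δ)^{τ/2} v`, with junk value `0` when it does not lie in `L²`. -/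
def bessel (τ : ℝ) (v : L2 d) : L2 d :=
  if h : wsq τ (coeff v) < ⊤ then (exists_bessel τ v h).choose else 0

lemma coeff_bessel {τ : ℝ} {v : L2 d} (hv : wsq τ (coeff v) < ⊤) (k : Fin d → ℤ) :
    coeff (bessel τ v) k = ((wt k ^ (τ / 2) : ℝ) : ℂ) * coeff v k := by
  rw [bessel, dif_pos hv]
  exact (exists_bessel τ v hv).choose_spec k

lemma wsq_L2_lt_top {τ : ℝ} (hτ : τ ≤ 0) (v : L2 d) : wsq τ (coeff v) < ⊤ :=
  (wsq_mono hτ _).trans_lt (wsq_zero_lt_top (memLp_L2 v))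

lemma wsq_L2_sub_lt_top {τ : ℝ} {v w : L2 d} (hv : wsq τ (coeff v) < ⊤) (hw : wsq τ (coeff w) < ⊤) :
    wsq τ (coeff (v - w : L2 d)) < ⊤ := by
  rw [show coeff (v - w : L2 d) = fun k => coeff v k - coeff w k from funext (coeff_L2_sub v w)]
  refine (wsq_sub_le _ _ _).trans_lt ?_
  finiteness

lemma wsq_L2_add_lt_top {τ : ℝ} {v w : L2 d} (hv : wsq τ (coeff v) < ⊤) (hw : wsq τ (coeff w) < ⊤) :
    wsq τ (coeff (v + w : L2 d)) < ⊤ := by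
  rw [show coeff (v + w : L2 d) = fun k => coeff v k + coeff w k from funext (coeff_L2_add v w)]
  refine (wsq_add_le _ _ _).trans_lt ?_
  finiteness

lemma bessel_sub {τ : ℝ} {v w : L2 d} (hv : wsq τ (coeff v) < ⊤) (hw : wsq τ (coeff w) < ⊤) :
    bessel τ v - bessel τ w = bessel τ (v - w) := by
  refine L2_ext fun k => ?_
  rw [coeff_L2_sub, coeff_bessel hv, coeff_bessel hw, coeff_bessel (wsq_L2_sub_lt_top hv hw),
    coeff_L2_sub, mul_sub]

lemma wsq_bessel {σ τ : ℝ} {v : L2 d} (hv : wsq τ (coeff v) < ⊤) :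
    wsq σ (coeff (bessel τ v)) = wsq (σ + τ) (coeff v) := by
  rw [← wsq_weight_mul, show coeff (bessel τ v) = _ from funext (coeff_bessel hv)]

/-- The Bessel potential of order `τ` is an isometry from `H^τ` to `L²`, up to a constant. -/
lemma wsq_eq_enorm_bessel {τ : ℝ} {v : L2 d} (hv : wsq τ (coeff v) < ⊤) :
    wsq τ (coeff v) = parsevalConst d * ‖bessel τ v‖ₑ ^ 2 := by
  rw [← wsq_zero_L2, wsq_bessel hv, zero_add]

lemma wsq_sub_eq_enorm_bessel {τ : ℝ} {v w : L2 d} (hv : wsq τ (coeff v) < ⊤)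
    (hw : wsq τ (coeff w) < ⊤) :
    wsq τ (coeff (v - w : L2 d)) = parsevalConst d * ‖bessel τ v - bessel τ w‖ₑ ^ 2 := by
  rw [bessel_sub hv hw, wsq_eq_enorm_bessel (wsq_L2_sub_lt_top hv hw)]

lemma bessel_bessel_neg {τ : ℝ} (hτ : 0 ≤ τ) (v : L2 d) :
    wsq τ (coeff (bessel (-τ) v)) < ⊤ ∧ bessel τ (bessel (-τ) v) = v := by
  have h1 : wsq (-τ) (coeff v) < ⊤ := wsq_L2_lt_top (by linarith) v
  have h2 : wsq τ (coeff (bessel (-τ) v)) < ⊤ := by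
    rw [wsq_bessel h1, add_neg_cancel]; exact wsq_zero_lt_top (memLp_L2 v)
  refine ⟨h2, L2_ext fun k => ?_⟩
  rw [coeff_bessel h2, coeff_bessel h1, ← mul_assoc, ← Complex.ofReal_mul,
    ← Real.rpow_add (wt_pos k)]
  rw [show τ / 2 + -τ / 2 = 0 by ring]
  simp

/-- Continuity of curves in `H^σ` is continuity of their Bessel potentials in `L²`. -/
lemma memC_iff {σ : ℕ} {I : Set ℝ} {u : ℝ → L2 d} :
    MemC σ I u ↔ (∀ t ∈ I, wsq σ (coeff (u t)) < ⊤) ∧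
      ContinuousOn (fun t => bessel (σ : ℝ) (u t)) I := by
  unfold MemC
  simp only [memH_iff]
  refine and_congr_right fun hfin => ?_
  have key : ∀ t₀ ∈ I, (Tendsto (fun t => sobNorm σ (u t - u t₀)) (𝓝[I] t₀) (𝓝 0) ↔
      ContinuousWithinAt (fun t => bessel (σ : ℝ) (u t)) I t₀) := by
    intro t₀ ht₀
    set c := parsevalConst d ^ (1 / 2 : ℝ) with hc
    have hc0 : c ≠ 0 := by
      rw [hc]; simp [ENNReal.rpow_eq_zero_iff, parsevalConst_ne_zero, parsevalConst_ne_top]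
    have hct : c ≠ ⊤ := by
      rw [hc]; simp [ENNReal.rpow_eq_top_iff, parsevalConst_ne_zero, parsevalConst_ne_top]
    have hs : ∀ t ∈ I, sobNorm σ (u t - u t₀)
        = c * ‖bessel (σ : ℝ) (u t) - bessel (σ : ℝ) (u t₀)‖ₑ := fun t ht => by
      have h1 : sobNorm σ (u t - u t₀) = (wsq σ (coeff (u t - u t₀ : L2 d))) ^ (1 / 2 : ℝ) := by
        rw [← sobNorm_sq, ← ENNReal.rpow_two, ← ENNReal.rpow_mul]; norm_num
      rw [h1, wsq_sub_eq_enorm_bessel (hfin t ht) (hfin t₀ ht₀), ENNReal.mul_rpow_of_nonneg _ _ (by norm_num),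
        ← ENNReal.rpow_two, ← ENNReal.rpow_mul]
      norm_num
      rfl
    have hev : (fun t => sobNorm σ (u t - u t₀)) =ᶠ[𝓝[I] t₀]
        fun t => c * ‖bessel (σ : ℝ) (u t) - bessel (σ : ℝ) (u t₀)‖ₑ := by
      filter_upwards [self_mem_nhdsWithin] with t ht using hs t ht
    rw [tendsto_congr' hev, ContinuousWithinAt, tendsto_iff_edist_tendsto_0]
    simp only [edist_eq_enorm_sub]
    constructor
    · intro h
      have := ENNReal.Tendsto.const_mul h (Or.inr (ENNReal.inv_ne_top.2 hc0))
      simpa only [← mul_assoc, ENNReal.inv_mul_cancel hc0 hct, one_mul, mul_zero] using this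
    · intro h
      have := ENNReal.Tendsto.const_mul h (Or.inr hct)
      simpa only [mul_zero] using this
  exact ⟨fun h t ht => (key t ht).1 (h t ht), fun h t ht => (key t ht).2 (h t ht)⟩

/-! ### Radial truncation -/

/-- The radial retraction of a normed space to the ball of radius `R` is Lipschitz. -/
lemma norm_radial_sub_le {E : Type*} [NormedAddCommGroup E] [NormedSpace ℝ E] {R : ℝ} (hR : 0 < R)
    (x y : E) : ‖(R / max R ‖x‖) • x - (R / max R ‖y‖) • y‖ ≤ 2 * ‖x - y‖ := by
  set mx := max R ‖x‖ with hmx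
  set my := max R ‖y‖ with hmy
  have hx0 : 0 < mx := hR.trans_le (le_max_left _ _)
  have hy0 : 0 < my := hR.trans_le (le_max_left _ _)
  have hRx : R / mx ≤ 1 := (div_le_one hx0).2 (le_max_left _ _)
  have hyy : ‖y‖ ≤ my := le_max_right _ _
  have hm : |my - mx| ≤ ‖x - y‖ := by
    rw [abs_sub_comm]
    refine (abs_max_sub_max_le_max R ‖x‖ R ‖y‖).trans ?_
    rw [sub_self, abs_zero, max_eq_right (abs_nonneg _)]
    exact abs_norm_sub_norm_le x y
  have e : (R / mx) • x - (R / my) • y = (R / mx) • (x - y) + (R / mx * ((my - mx) / my)) • y := by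
    rw [smul_sub, sub_add, sub_right_inj, ← sub_smul]
    congr 1
    field_simp
    ring
  rw [e]
  refine (norm_add_le _ _).trans ?_
  rw [norm_smul, norm_smul, Real.norm_of_nonneg (by positivity), Real.norm_eq_abs, abs_mul,
    abs_of_nonneg (by positivity : 0 ≤ R / mx), abs_div, abs_of_pos hy0]
  have h1 : R / mx * ‖x - y‖ ≤ 1 * ‖x - y‖ := by gcongr
  have h2 : R / mx * (|my - mx| / my) * ‖y‖ ≤ 1 * (‖x - y‖ / my) * my := by gcongr
  have h3 : 1 * (‖x - y‖ / my) * my = ‖x - y‖ := by field_simp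
  linarith

/-- The radial retraction of `H^s` to a ball, the radius being measured in the norm
`‖(1 - Δ)^{s/2} u‖_{L²}`. -/
def trunc (s : ℕ) (R : ℝ) (u : L2 d) : L2 d := (R / max R ‖bessel (s : ℝ) u‖) • u

lemma trunc_eq_self {s : ℕ} {R : ℝ} (hR : 0 < R) {u : L2 d} (hu : ‖bessel (s : ℝ) u‖ ≤ R) :
    trunc s R u = u := by
  rw [trunc, max_eq_left hu, div_self hR.ne', one_smul]

lemma wsq_smul_L2_lt_top {τ : ℝ} (c : ℝ) {u : L2 d} (hu : wsq τ (coeff u) < ⊤) :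
    wsq τ (coeff (c • u : L2 d)) < ⊤ := by
  rw [show coeff (c • u : L2 d) = fun k => (c : ℂ) * coeff u k from funext (coeff_L2_smul c u), wsq_smul]
  finiteness

lemma wsq_trunc_lt_top {s : ℕ} {R : ℝ} {u : L2 d} (hu : wsq s (coeff u) < ⊤) :
    wsq s (coeff (trunc s R u)) < ⊤ := wsq_smul_L2_lt_top _ hu

lemma bessel_smul {τ : ℝ} (c : ℝ) {u : L2 d} (hu : wsq τ (coeff u) < ⊤) :
    bessel τ (c • u) = c • bessel τ u := by
  refine L2_ext fun k => ?_
  rw [coeff_bessel (wsq_smul_L2_lt_top c hu), coeff_L2_smul, coeff_L2_smul, coeff_bessel hu]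
  ring

lemma bessel_trunc {s : ℕ} {R : ℝ} {u : L2 d} (hu : wsq s (coeff u) < ⊤) :
    bessel (s : ℝ) (trunc s R u) = (R / max R ‖bessel (s : ℝ) u‖) • bessel (s : ℝ) u :=
  bessel_smul _ hu

lemma wsq_trunc_le {s : ℕ} {R : ℝ} (hR : 0 < R) {u : L2 d} (hu : wsq s (coeff u) < ⊤) :
    wsq s (coeff (trunc s R u)) ≤ parsevalConst d * ENNReal.ofReal R ^ 2 := by
  rw [wsq_eq_enorm_bessel (wsq_trunc_lt_top hu), bessel_trunc hu]
  gcongr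
  rw [← ofReal_norm]
  refine ENNReal.ofReal_le_ofReal ?_
  have h0 : 0 < max R ‖bessel (s : ℝ) u‖ := hR.trans_le (le_max_left _ _)
  rw [norm_smul, Real.norm_of_nonneg (by positivity), div_mul_eq_mul_div, div_le_iff₀ h0]
  gcongr
  exact le_max_right _ _

lemma wsq_trunc_sub_le {s : ℕ} {R : ℝ} (hR : 0 < R) {u v : L2 d} (hu : wsq s (coeff u) < ⊤)
    (hv : wsq s (coeff v) < ⊤) :
    wsq s (coeff (trunc s R u - trunc s R v : L2 d)) ≤ 4 * wsq s (coeff (u - v : L2 d)) := by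
  rw [wsq_sub_eq_enorm_bessel (wsq_trunc_lt_top hu) (wsq_trunc_lt_top hv),
    wsq_sub_eq_enorm_bessel hu hv, bessel_trunc hu, bessel_trunc hv, mul_left_comm]
  gcongr
  have h := norm_radial_sub_le hR (bessel (s : ℝ) u) (bessel (s : ℝ) v)
  rw [← ofReal_norm, ← ofReal_norm]
  calc _ ≤ ENNReal.ofReal (2 * ‖bessel (s : ℝ) u - bessel (s : ℝ) v‖) ^ 2 := by gcongr
    _ = _ := by
      rw [ENNReal.ofReal_mul (by norm_num), mul_pow]
      norm_num

/-! ### A fixed point theorem for Volterra maps -/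

/-- A map of `C([0,T], E)` which is Lipschitz for the `L²` norms on the intervals `[0,t]` has a fixed
point: multiplication by `e^{-γt}`, with `γ` large, conjugates it to a contraction. -/
lemma exists_fixedPoint_of_volterra {E : Type*} [NormedAddCommGroup E] [NormedSpace ℝ E]
    [CompleteSpace E] {T : ℝ} (hT : 0 ≤ T) (Φ : C(Icc 0 T, E) → C(Icc 0 T, E)) (K : ℝ≥0)
    (hΦ : ∀ V W : C(Icc 0 T, E), ∀ t : Icc 0 T, ‖Φ V t - Φ W t‖ₑ ^ 2 ≤
      K * ∫⁻ τ in Icc 0 (t : ℝ), ‖V (projIcc 0 T hT τ) - W (projIcc 0 T hT τ)‖ₑ ^ 2) :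
    ∃ W, Φ W = W := by
  set γ : ℝ := 2 * (K + 1) with hγ
  have hγ0 : 0 < γ := by positivity
  set e : C(Icc 0 T, ℝ) := ⟨fun t => Real.exp (γ * t), by fun_prop⟩ with he
  set e' : C(Icc 0 T, ℝ) := ⟨fun t => Real.exp (-(γ * t)), by fun_prop⟩ with he'
  set Ψ : C(Icc 0 T, E) → C(Icc 0 T, E) := fun V => e' • Φ (e • V) with hΨ
  have hnn : Nonempty (Icc 0 T) := ⟨⟨0, le_rfl, hT⟩⟩
  have hlip : LipschitzWith (1 / 2) Ψ := by
    refine LipschitzWith.of_dist_le_mul fun V W => ?_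
    set D := dist V W with hD
    rw [ContinuousMap.dist_le (by positivity)]
    intro t
    have h1 : ‖Φ (e • V) t - Φ (e • W) t‖ₑ ^ 2
        ≤ ENNReal.ofReal ((Real.exp (γ * t)) ^ 2 * (D / 2) ^ 2) := by
      refine (hΦ _ _ t).trans ?_
      have h2 : ∀ τ ∈ Icc 0 (t : ℝ),
          ‖(e • V) (projIcc 0 T hT τ) - (e • W) (projIcc 0 T hT τ)‖ₑ ^ 2
          ≤ ENNReal.ofReal ((Real.exp (γ * t)) ^ 2 * D ^ 2)
            * ENNReal.ofReal (Real.exp (-(2 * γ * (t - τ)))) := by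
        intro τ hτ
        have hτ' : τ ∈ Icc 0 T := ⟨hτ.1, hτ.2.trans t.2.2⟩
        rw [projIcc_of_mem hT hτ']
        have h3 : ‖(e • V) ⟨τ, hτ'⟩ - (e • W) ⟨τ, hτ'⟩‖ ≤ Real.exp (γ * τ) * D := by
          have : (e • V) ⟨τ, hτ'⟩ - (e • W) ⟨τ, hτ'⟩
              = Real.exp (γ * τ) • (V ⟨τ, hτ'⟩ - W ⟨τ, hτ'⟩) := by
            rw [smul_sub]; rfl
          rw [this, norm_smul, Real.norm_of_nonneg (Real.exp_pos _).le]
          gcongr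
          rw [← dist_eq_norm]
          exact ContinuousMap.dist_apply_le_dist _
        rw [← ofReal_norm, ← ENNReal.ofReal_pow (norm_nonneg _), ← ENNReal.ofReal_mul (by positivity)]
        refine ENNReal.ofReal_le_ofReal ?_
        calc _ ≤ (Real.exp (γ * τ) * D) ^ 2 := by gcongr
          _ = _ := by
            rw [mul_pow, ← Real.exp_nat_mul, ← Real.exp_nat_mul, mul_right_comm (Real.exp _),
              ← Real.exp_add]
            congr 2
            push_cast
            ring
      calc (K : ℝ≥0∞) * ∫⁻ τ in Icc 0 (t : ℝ),
            ‖(e • V) (projIcc 0 T hT τ) - (e • W) (projIcc 0 T hT τ)‖ₑ ^ 2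
          ≤ K * ∫⁻ τ in Icc 0 (t : ℝ), ENNReal.ofReal ((Real.exp (γ * t)) ^ 2 * D ^ 2)
            * ENNReal.ofReal (Real.exp (-(2 * γ * (t - τ)))) :=
            mul_le_mul' le_rfl (setLIntegral_mono' measurableSet_Icc h2)
        _ ≤ K * (ENNReal.ofReal ((Real.exp (γ * t)) ^ 2 * D ^ 2) * ENNReal.ofReal (2 * γ)⁻¹) := by
            rw [lintegral_const_mul' _ _ ENNReal.ofReal_ne_top]
            gcongr
            rw [← Ici_inter_Iic]
            exact lintegral_exp_le (by positivity) _ _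
        _ ≤ _ := by
            rw [← ENNReal.ofReal_mul (by positivity), ← ENNReal.ofReal_coe_nnreal,
              ← ENNReal.ofReal_mul (by positivity)]
            refine ENNReal.ofReal_le_ofReal ?_
            have h4 : (K : ℝ) * (2 * γ)⁻¹ ≤ 1 / 4 := by
              rw [← div_eq_mul_inv, div_le_iff₀ (by positivity), hγ]
              linarith
            calc (K : ℝ) * (Real.exp (γ * t) ^ 2 * D ^ 2 * (2 * γ)⁻¹)
                = Real.exp (γ * t) ^ 2 * D ^ 2 * (K * (2 * γ)⁻¹) := by ring
              _ ≤ Real.exp (γ * t) ^ 2 * D ^ 2 * (1 / 4) := by gcongr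
              _ = _ := by ring
    have h5 : ‖Φ (e • V) t - Φ (e • W) t‖ ≤ Real.exp (γ * t) * (D / 2) := by
      rw [← ofReal_norm, ← ENNReal.ofReal_pow (norm_nonneg _),
        ENNReal.ofReal_le_ofReal_iff (by positivity), ← mul_pow] at h1
      exact (pow_le_pow_iff_left₀ (norm_nonneg _) (by positivity) two_ne_zero).1 h1
    have h6 : Ψ V t - Ψ W t = Real.exp (-(γ * t)) • (Φ (e • V) t - Φ (e • W) t) := by
      rw [smul_sub]; rfl
    rw [dist_eq_norm, h6, norm_smul, Real.norm_of_nonneg (Real.exp_pos _).le]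
    calc Real.exp (-(γ * t)) * ‖Φ (e • V) t - Φ (e • W) t‖
        ≤ Real.exp (-(γ * t)) * (Real.exp (γ * t) * (D / 2)) := by gcongr
      _ = _ := by
        rw [← mul_assoc, ← Real.exp_add, neg_add_cancel, Real.exp_zero]
        push_cast
        ring
  have hc : ContractingWith (1 / 2) Ψ := ⟨by
    rw [← NNReal.coe_lt_coe]; norm_num, hlip⟩
  refine ⟨e • hc.fixedPoint Ψ, ?_⟩
  have hfix : e' • Φ (e • hc.fixedPoint Ψ) = hc.fixedPoint Ψ := hc.fixedPoint_isFixedPt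
  conv_rhs => rw [← hfix]
  ext t
  change _ = Real.exp (γ * (t : ℝ)) • (Real.exp (-(γ * (t : ℝ))) • Φ (e • hc.fixedPoint Ψ) t)
  rw [smul_smul, ← Real.exp_add, add_neg_cancel, Real.exp_zero, one_smul]

/-! ### Curves in Sobolev spaces -/

lemma sobNorm_eq (σ : ℕ) (v : L2 d) : sobNorm σ v = wsq σ (coeff v) ^ (1 / 2 : ℝ) := by
  rw [← sobNorm_sq, ← ENNReal.rpow_two, ← ENNReal.rpow_mul]
  norm_num

lemma sobNorm_mono {σ τ : ℕ} (h : σ ≤ τ) (v : L2 d) : sobNorm σ v ≤ sobNorm τ v := by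
  rw [sobNorm_eq, sobNorm_eq]
  exact ENNReal.rpow_le_rpow (wsq_mono (by exact_mod_cast h) _) (by norm_num)

lemma sobNorm_le_of_wsq_le {σ : ℕ} {v : L2 d} {B : ℝ≥0∞} (h : wsq σ (coeff v) ≤ B ^ 2) :
    sobNorm σ v ≤ B := by
  rw [← sobNorm_sq] at h
  exact (ENNReal.pow_le_pow_left_iff two_ne_zero).1 h

lemma MemC.mono {σ : ℕ} {I J : Set ℝ} {u : ℝ → L2 d} (h : MemC σ I u) (hJ : J ⊆ I) : MemC σ J u :=
  ⟨fun t ht => h.1 t (hJ ht), fun t ht => (h.2 t (hJ ht)).mono_left (nhdsWithin_mono _ hJ)⟩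

lemma MemC.of_le {σ τ : ℕ} (hστ : σ ≤ τ) {I : Set ℝ} {u : ℝ → L2 d} (h : MemC τ I u) :
    MemC σ I u :=
  ⟨fun t ht => (sobNorm_mono hστ _).trans_lt (h.1 t ht), fun t ht =>
    tendsto_of_tendsto_of_tendsto_of_le_of_le tendsto_const_nhds (h.2 t ht)
      (fun _ => zero_le) fun _ => sobNorm_mono hστ _⟩

lemma MemC.congr {σ : ℕ} {I : Set ℝ} {u v : ℝ → L2 d} (h : MemC σ I u) (huv : EqOn v u I) :
    MemC σ I v := by
  refine ⟨fun t ht => huv ht ▸ h.1 t ht, fun t ht => ?_⟩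
  rw [huv ht]
  refine (h.2 t ht).congr' ?_
  filter_upwards [self_mem_nhdsWithin] with r hr
  rw [huv hr]

lemma MemC.wsq_lt_top {σ : ℕ} {I : Set ℝ} {u : ℝ → L2 d} (h : MemC σ I u) {t : ℝ} (ht : t ∈ I) :
    wsq σ (coeff (u t)) < ⊤ := memH_iff.1 (h.1 t ht)

lemma bessel_zero (v : L2 d) : bessel 0 v = v := by
  refine L2_ext fun k => ?_
  rw [coeff_bessel (wsq_L2_lt_top le_rfl v)]
  simp

lemma bessel_add {τ : ℝ} {v w : L2 d} (hv : wsq τ (coeff v) < ⊤) (hw : wsq τ (coeff w) < ⊤) :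
    bessel τ (v + w) = bessel τ v + bessel τ w := by
  refine L2_ext fun k => ?_
  rw [coeff_L2_add, coeff_bessel hv, coeff_bessel hw, coeff_bessel (wsq_L2_add_lt_top hv hw),
    coeff_L2_add, mul_add]

lemma MemC.add {σ : ℕ} {I : Set ℝ} {u v : ℝ → L2 d} (hu : MemC σ I u) (hv : MemC σ I v) :
    MemC σ I fun t => u t + v t := by
  refine memC_iff.2 ⟨fun t ht => wsq_L2_add_lt_top (hu.wsq_lt_top ht) (hv.wsq_lt_top ht), ?_⟩
  exact ((memC_iff.1 hu).2.add (memC_iff.1 hv).2).congr fun t ht =>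
    bessel_add (hu.wsq_lt_top ht) (hv.wsq_lt_top ht)

lemma MemC.sub {σ : ℕ} {I : Set ℝ} {u v : ℝ → L2 d} (hu : MemC σ I u) (hv : MemC σ I v) :
    MemC σ I fun t => u t - v t := by
  refine memC_iff.2 ⟨fun t ht => wsq_L2_sub_lt_top (hu.wsq_lt_top ht) (hv.wsq_lt_top ht), ?_⟩
  exact ((memC_iff.1 hu).2.sub (memC_iff.1 hv).2).congr fun t ht =>
    (bessel_sub (hu.wsq_lt_top ht) (hv.wsq_lt_top ht)).symm

lemma MemC.trunc {s : ℕ} {R : ℝ} (hR : 0 < R) {I : Set ℝ} {u : ℝ → L2 d} (hu : MemC s I u) :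
    MemC s I fun t => trunc s R (u t) := by
  refine memC_iff.2 ⟨fun t ht => wsq_trunc_lt_top (hu.wsq_lt_top ht), ?_⟩
  have hc := (memC_iff.1 hu).2
  refine ContinuousOn.congr (f := fun t =>
    (R / max R ‖bessel (s : ℝ) (u t)‖) • bessel (s : ℝ) (u t)) ?_
    fun t ht => bessel_trunc (hu.wsq_lt_top ht)
  refine ContinuousOn.smul (continuousOn_const.div (continuousOn_const.sup hc.norm) fun t _ => ?_) hc
  exact (hR.trans_le (le_max_left _ _)).ne'

lemma MemC.continuousOn {σ : ℕ} {I : Set ℝ} {u : ℝ → L2 d} (hu : MemC σ I u) :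
    ContinuousOn u I := by
  have := (memC_iff.1 (hu.of_le (Nat.zero_le σ))).2
  simpa only [Nat.cast_zero, bessel_zero] using this

lemma MemC.exists_bound {σ : ℕ} {a b : ℝ} {u : ℝ → L2 d} (hu : MemC σ (Icc a b) u) :
    ∃ M : ℝ≥0, ∀ t ∈ Icc a b, wsq σ (coeff (u t)) ≤ M := by
  obtain ⟨C, hC⟩ := isCompact_Icc.exists_bound_of_continuousOn (memC_iff.1 hu).2
  refine ⟨(parsevalConst d * ENNReal.ofReal C ^ 2).toNNReal, fun t ht => ?_⟩
  rw [ENNReal.coe_toNNReal (ENNReal.mul_ne_top parsevalConst_ne_top (by finiteness)),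
    wsq_eq_enorm_bessel (hu.wsq_lt_top ht), ← ofReal_norm]
  gcongr
  exact hC t ht

lemma MemC.tendsto_wsq {σ : ℕ} {I : Set ℝ} {u : ℝ → L2 d} (hu : MemC σ I u) {t₀ : ℝ} (ht₀ : t₀ ∈ I) :
    Tendsto (fun t => wsq σ (coeff (u t - u t₀ : L2 d))) (𝓝[I] t₀) (𝓝 0) := by
  have := (ENNReal.continuous_pow 2).tendsto _ |>.comp (hu.2 t₀ ht₀)
  simpa [Function.comp_def, sobNorm_sq] using this

lemma tendsto_zero_of_sq {α : Type*} {l : Filter α} {g : α → ℝ≥0∞}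
    (h : Tendsto (fun x => g x ^ 2) l (𝓝 0)) : Tendsto g l (𝓝 0) := by
  have h1 := (ENNReal.continuous_rpow_const (y := 1 / 2)).tendsto _ |>.comp h
  simp only [Function.comp_def, ← ENNReal.rpow_two, ← ENNReal.rpow_mul] at h1
  norm_num at h1
  exact h1

lemma continuous_coeff (k : Fin d → ℤ) : Continuous fun v : L2 d => coeff v k := by
  refine continuous_iff_continuousAt.2 fun v₀ => ?_
  rw [ContinuousAt, tendsto_iff_edist_tendsto_0]
  simp only [edist_eq_enorm_sub, ← coeff_L2_sub]
  set c := parsevalConst d ^ (1 / 2 : ℝ) with hc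
  have hct : c ≠ ⊤ := by
    rw [hc]; simp [ENNReal.rpow_eq_top_iff, parsevalConst_ne_zero, parsevalConst_ne_top]
  have hc2 : c ^ 2 = parsevalConst d := by
    rw [hc, ← ENNReal.rpow_two, ← ENNReal.rpow_mul]; norm_num
  have h1 : ∀ v : L2 d, ‖coeff (v - v₀ : L2 d) k‖ₑ ≤ c * ‖v - v₀‖ₑ := fun v => by
    refine (ENNReal.pow_le_pow_left_iff two_ne_zero).1 ?_
    rw [mul_pow, hc2, ← wsq_zero_L2]
    exact enorm_sq_le_wsq le_rfl _ k
  have h2 : Tendsto (fun v : L2 d => c * ‖v - v₀‖ₑ) (𝓝 v₀) (𝓝 0) := by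
    have : Tendsto (fun v : L2 d => v - v₀) (𝓝 v₀) (𝓝 0) := by
      have : Tendsto (fun v : L2 d => v - v₀) (𝓝 v₀) (𝓝 (v₀ - v₀)) :=
        tendsto_id.sub tendsto_const_nhds
      rwa [sub_self] at this
    have h3 := ENNReal.Tendsto.const_mul this.enorm (Or.inr hct)
    simpa using h3
  exact tendsto_of_tendsto_of_tendsto_of_le_of_le tendsto_const_nhds h2 (fun _ => zero_le) h1

lemma normC_le {σ : ℕ} {T : ℝ} {u : ℝ → L2 d} {B : ℝ≥0∞}
    (h : ∀ t ∈ Icc 0 T, wsq σ (coeff (u t)) ≤ B ^ 2) : normC σ T u ≤ B :=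
  iSup₂_le fun t ht => sobNorm_le_of_wsq_le (h t ht)

lemma wsq_le_normC_sq {σ : ℕ} {T : ℝ} (u : ℝ → L2 d) {t : ℝ} (ht : t ∈ Icc 0 T) :
    wsq σ (coeff (u t)) ≤ normC σ T u ^ 2 := by
  rw [← sobNorm_sq]
  gcongr
  exact le_iSup₂ (f := fun t (_ : t ∈ Icc 0 T) => sobNorm σ (u t)) t ht

lemma normL2_sq (σ : ℕ) (T : ℝ) (u : ℝ → L2 d) :
    normL2 σ T u ^ 2 = ∫⁻ t in Icc 0 T, wsq σ (coeff (u t)) := by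
  simp only [normL2, sobNorm_sq]
  rw [← ENNReal.rpow_two, ← ENNReal.rpow_mul]
  norm_num

lemma normL2_le {σ : ℕ} {T : ℝ} {u : ℝ → L2 d} {B : ℝ≥0∞}
    (h : ∫⁻ t in Icc 0 T, wsq σ (coeff (u t)) ≤ B ^ 2) : normL2 σ T u ≤ B := by
  rw [← normL2_sq] at h
  exact (ENNReal.pow_le_pow_left_iff two_ne_zero).1 h

lemma MemL2.lintegral_lt_top {σ : ℕ} {T : ℝ} {u : ℝ → L2 d} (h : MemL2 σ T u) :
    ∫⁻ t in Icc 0 T, wsq σ (coeff (u t)) < ⊤ := by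
  rw [← normL2_sq]
  exact ENNReal.pow_lt_top h.2

lemma MemL2.mono {σ : ℕ} {T T' : ℝ} {u : ℝ → L2 d} (h : MemL2 σ T u) (hT : T' ≤ T) :
    MemL2 σ T' u := by
  have hI : Icc 0 T' ⊆ Icc 0 T := Icc_subset_Icc_right hT
  refine ⟨h.1.mono_set hI, ?_⟩
  have h1 : normL2 σ T' u ^ 2 < ⊤ := by
    rw [normL2_sq]
    exact (lintegral_mono_set hI).trans_lt h.lintegral_lt_top
  simpa [ENNReal.pow_lt_top_iff] using h1

lemma MemL2.integrableOn_coeff {σ : ℕ} {T : ℝ} {u : ℝ → L2 d} (h : MemL2 σ T u) (k : Fin d → ℤ) :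
    IntegrableOn (fun t => coeff (u t) k) (Icc 0 T) := by
  have h1 : AEStronglyMeasurable (fun t => coeff (u t) k) (volume.restrict (Icc 0 T)) :=
    (continuous_coeff k).comp_aestronglyMeasurable h.1
  have h2 : MemLp (fun t => coeff (u t) k) 2 (volume.restrict (Icc 0 T)) := by
    refine ⟨h1, ?_⟩
    rw [eLpNorm_lt_top_iff_lintegral_rpow_enorm_lt_top (by norm_num) (by norm_num)]
    refine lt_of_le_of_lt (lintegral_mono fun t => ?_) h.lintegral_lt_top
    simp only [ENNReal.toReal_ofNat, ENNReal.rpow_two]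
    exact enorm_sq_le_wsq (Nat.cast_nonneg σ) _ k
  exact h2.integrable (by norm_num)

/-! ### The forcing term -/

lemma exists_wsq_comp_le {s : ℕ} (hs1 : 1 ≤ s) (hs : (d : ℝ) / 2 < s) {f : ℝ → ℝ}
    (hf : ContDiff ℝ ∞ f) (R : ℝ≥0) :
    ∃ C : ℝ≥0, ∀ v : L2 d, wsq s (coeff v) ≤ R → wsq s (coeff fun x => f (v x)) ≤ C := by
  obtain ⟨C, hC⟩ := exists_wsq_comp_sub_le hs1 hs hf R
  have h0 : wsq s (coeff (0 : L2 d)) = 0 := by rw [coeff_L2_zero]; simp [wsq]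
  have h1 : wsq s (coeff fun x => f ((0 : L2 d) x)) < ⊤ :=
    wsq_comp_lt_top hs1 hs hf (by rw [h0]; exact ENNReal.zero_lt_top)
  lift wsq s (coeff fun x => f ((0 : L2 d) x)) to ℝ≥0 using h1.ne with c hc
  refine ⟨2 * (C * R + c), fun v hv => ?_⟩
  have h2 := hC v 0 hv (by rw [h0]; exact zero_le)
  rw [sub_zero] at h2
  have h3 := wsq_add_le s (fun k => coeff (fun x => f (v x)) k - coeff (fun x => f ((0 : L2 d) x)) k)
    (coeff fun x => f ((0 : L2 d) x))
  simp only [sub_add_cancel] at h3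
  refine h3.trans ?_
  rw [← hc, show ((2 * (C * R + c) : ℝ≥0) : ℝ≥0∞) = 2 * (C * R + c) by push_cast; rfl]
  gcongr
  exact h2.trans (by gcongr)

lemma MemC.continuousOn_coeff_comp {s : ℕ} (hs1 : 1 ≤ s) (hs : (d : ℝ) / 2 < s) {f : ℝ → ℝ}
    (hf : ContDiff ℝ ∞ f) {a b : ℝ} {v : ℝ → L2 d} (hv : MemC s (Icc a b) v) (k : Fin d → ℤ) :
    ContinuousOn (fun t => coeff (fun x => f (v t x)) k) (Icc a b) := by
  obtain ⟨M, hM⟩ := hv.exists_bound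
  obtain ⟨C, hC⟩ := exists_wsq_comp_sub_le hs1 hs hf M
  intro t₀ ht₀
  have h1 : Tendsto (fun t => (C : ℝ≥0∞) * wsq s (coeff (v t - v t₀ : L2 d))) (𝓝[Icc a b] t₀)
      (𝓝 0) := by
    have := ENNReal.Tendsto.const_mul (a := (C : ℝ≥0∞)) (hv.tendsto_wsq ht₀)
      (Or.inr ENNReal.coe_ne_top)
    rwa [mul_zero] at this
  have h2 : Tendsto (fun t => ‖coeff (fun x => f (v t x)) k - coeff (fun x => f (v t₀ x)) k‖ₑ ^ 2)
      (𝓝[Icc a b] t₀) (𝓝 0) := by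
    refine tendsto_of_tendsto_of_tendsto_of_le_of_le' tendsto_const_nhds h1
      (Eventually.of_forall fun _ => zero_le) ?_
    filter_upwards [self_mem_nhdsWithin] with t ht
    exact (enorm_sq_le_wsq (Nat.cast_nonneg s) _ k).trans (hC _ _ (hM t ht) (hM t₀ ht₀))
  rw [ContinuousWithinAt, tendsto_iff_edist_tendsto_0]
  simp only [edist_eq_enorm_sub]
  exact tendsto_zero_of_sq h2

/-- The Fourier coefficients of `νΔζ - f(v) + φ`. -/
def force (ν : ℝ) (f : ℝ → ℝ) (v ζ φ : ℝ → L2 d) (t : ℝ) (k : Fin d → ℤ) : ℂ :=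
  -((ν * freqSq k : ℝ) : ℂ) * coeff (ζ t) k - coeff (fun x => f (v t x)) k + coeff (φ t) k

lemma integrableOn_force {s : ℕ} (hs1 : 1 ≤ s) (hs : (d : ℝ) / 2 < s) {f : ℝ → ℝ}
    (hf : ContDiff ℝ ∞ f) (ν : ℝ) {T : ℝ} {v ζ φ : ℝ → L2 d} (hv : MemC s (Icc 0 T) v) {σ τ : ℕ}
    (hζ : MemC σ (Icc 0 T) ζ) (hφ : MemL2 τ T φ) (k : Fin d → ℤ) :
    IntegrableOn (fun t => force ν f v ζ φ t k) (Icc 0 T) := by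
  refine Integrable.add (Integrable.sub ?_ ?_) (hφ.integrableOn_coeff k)
  · exact (((continuous_coeff k).comp_continuousOn hζ.continuousOn).integrableOn_Icc).const_mul _
  · exact (hv.continuousOn_coeff_comp hs1 hs hf k).integrableOn_Icc

lemma wsq_laplacian_le {ν : ℝ} (hν : 0 < ν) (σ : ℝ) (a : (Fin d → ℤ) → ℂ) :
    wsq (σ - 1) (fun k => -((ν * freqSq k : ℝ) : ℂ) * a k)
      ≤ ENNReal.ofReal ν ^ 2 * wsq (σ + 1) a := by
  have h1 : wsq (σ - 1) (fun k => -((ν * freqSq k : ℝ) : ℂ) * a k)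
      ≤ wsq (σ - 1) fun k => (ν : ℂ) * (((wt k ^ ((2 : ℝ) / 2) : ℝ) : ℂ) * a k) := by
    refine wsq_le_wsq fun k => ?_
    rw [← mul_assoc, enorm_mul, enorm_mul]
    gcongr
    rw [enorm_neg, ← Complex.ofReal_mul, ← ofReal_norm, ← ofReal_norm, Complex.norm_real,
      Complex.norm_real]
    refine ENNReal.ofReal_le_ofReal ?_
    have := freqSq_nonneg k
    have := (wt_pos k).le
    rw [div_self two_ne_zero, Real.rpow_one, Real.norm_of_nonneg (by positivity),
      Real.norm_of_nonneg (by positivity), wt]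
    gcongr
    linarith
  refine h1.trans ?_
  rw [wsq_smul, wsq_weight_mul, ← ofReal_norm, Complex.norm_real, Real.norm_of_nonneg hν.le]
  rw [show σ - 1 + 2 = σ + 1 by ring]

/-- The forcing term in `H^{s-1}` is Lipschitz in `v ∈ H^s`, `ζ ∈ H^{s+1}` and `φ ∈ H^{s-1}`, as long
as `v` stays in a bounded set. -/
lemma exists_wsq_force_sub_le {s : ℕ} (hs1 : 1 ≤ s) (hs : (d : ℝ) / 2 < s) {f : ℝ → ℝ}
    (hf : ContDiff ℝ ∞ f) {ν : ℝ} (hν : 0 < ν) (M : ℝ≥0) :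
    ∃ C : ℝ≥0, ∀ (v ζ φ v' ζ' φ' : ℝ → L2 d) (t : ℝ), wsq s (coeff (v t)) ≤ M →
      wsq s (coeff (v' t)) ≤ M →
      wsq ((s : ℝ) - 1) (fun k => force ν f v ζ φ t k - force ν f v' ζ' φ' t k) ≤
        C * (wsq ((s : ℝ) + 1) (coeff (ζ t - ζ' t : L2 d)) + wsq s (coeff (v t - v' t : L2 d))
          + wsq ((s : ℝ) - 1) (coeff (φ t - φ' t : L2 d))) := by
  obtain ⟨C, hC⟩ := exists_wsq_comp_sub_le hs1 hs hf M
  refine ⟨4 * (1 + C + Real.toNNReal ν ^ 2), fun v ζ φ v' ζ' φ' t hv hv' => ?_⟩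
  have e : (fun k => force ν f v ζ φ t k - force ν f v' ζ' φ' t k) = fun k =>
      ((-((ν * freqSq k : ℝ) : ℂ) * coeff (ζ t - ζ' t : L2 d) k)
        - (coeff (fun x => f (v t x)) k - coeff (fun x => f (v' t x)) k))
        + coeff (φ t - φ' t : L2 d) k := by
    funext k
    simp only [force, coeff_L2_sub]
    ring
  rw [e]
  refine (wsq_add_le _ _ _).trans ?_
  refine (mul_le_mul' le_rfl (add_le_add (wsq_sub_le _ _ _) le_rfl)).trans ?_
  have h1 := wsq_laplacian_le hν s (coeff (ζ t - ζ' t : L2 d))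
  have h2 := (wsq_mono (show (s : ℝ) - 1 ≤ s by linarith) _).trans (hC _ _ hv hv')
  have h3 : ENNReal.ofReal ν ^ 2 = ((Real.toNNReal ν ^ 2 : ℝ≥0) : ℝ≥0∞) := by
    push_cast; rfl
  rw [h3] at h1
  set n := Real.toNNReal ν ^ 2
  set z := wsq ((s : ℝ) + 1) (coeff (ζ t - ζ' t : L2 d))
  set V := wsq (s : ℝ) (coeff (v t - v' t : L2 d))
  set p := wsq ((s : ℝ) - 1) (coeff (φ t - φ' t : L2 d))
  have hn : (n : ℝ≥0∞) ≤ 1 + C + n := le_add_self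
  have hc : (C : ℝ≥0∞) ≤ 1 + C + n := le_add_self.trans le_self_add
  have hone : (1 : ℝ≥0∞) ≤ 1 + C + n := le_self_add.trans le_self_add
  rw [show ((4 * (1 + C + n) : ℝ≥0) : ℝ≥0∞) = 4 * (1 + C + n) by push_cast; rfl]
  calc _ ≤ 2 * (2 * (n * z + C * V) + p) := by gcongr
    _ ≤ 2 * (2 * (n * z + C * V) + 2 * (1 * p)) := by
      gcongr
      rw [one_mul]
      exact le_mul_of_one_le_left zero_le (by norm_num)
    _ = 4 * (n * z + C * V + 1 * p) := by ring
    _ ≤ 4 * ((1 + C + n) * z + (1 + C + n) * V + (1 + C + n) * p) := by gcongr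
    _ = _ := by ring

lemma exists_wsq_force_le {s : ℕ} (hs1 : 1 ≤ s) (hs : (d : ℝ) / 2 < s) {f : ℝ → ℝ}
    (hf : ContDiff ℝ ∞ f) {ν : ℝ} (hν : 0 < ν) (M : ℝ≥0) :
    ∃ C : ℝ≥0, ∀ (v ζ φ : ℝ → L2 d) (t : ℝ), wsq s (coeff (v t)) ≤ M →
      wsq ((s : ℝ) - 1) (force ν f v ζ φ t) ≤
        C * (1 + wsq ((s : ℝ) + 1) (coeff (ζ t)) + wsq ((s : ℝ) - 1) (coeff (φ t))) := by
  obtain ⟨C, hC⟩ := exists_wsq_comp_le hs1 hs hf M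
  refine ⟨4 * (1 + C + Real.toNNReal ν ^ 2), fun v ζ φ t hv => ?_⟩
  unfold force
  refine (wsq_add_le _ _ _).trans ?_
  refine (mul_le_mul' le_rfl (add_le_add (wsq_sub_le _ _ _) le_rfl)).trans ?_
  have h1 := wsq_laplacian_le hν s (coeff (ζ t))
  have h2 := (wsq_mono (show (s : ℝ) - 1 ≤ s by linarith) _).trans (hC _ hv)
  have h3 : ENNReal.ofReal ν ^ 2 = ((Real.toNNReal ν ^ 2 : ℝ≥0) : ℝ≥0∞) := by
    push_cast; rfl
  rw [h3] at h1
  set n := Real.toNNReal ν ^ 2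
  set z := wsq ((s : ℝ) + 1) (coeff (ζ t))
  set p := wsq ((s : ℝ) - 1) (coeff (φ t))
  have hn : (n : ℝ≥0∞) ≤ 1 + C + n := le_add_self
  have hc : (C : ℝ≥0∞) ≤ 1 + C + n := le_add_self.trans le_self_add
  have hone : (1 : ℝ≥0∞) ≤ 1 + C + n := le_self_add.trans le_self_add
  rw [show ((4 * (1 + C + n) : ℝ≥0) : ℝ≥0∞) = 4 * (1 + C + n) by push_cast; rfl]
  calc _ ≤ 2 * (2 * (n * z + C) + p) := by gcongr
    _ ≤ 2 * (2 * (n * z + C) + 2 * (1 * p)) := by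
      gcongr
      rw [one_mul]
      exact le_mul_of_one_le_left zero_le (by norm_num)
    _ = 4 * (C + n * z + 1 * p) := by ring
    _ ≤ 4 * ((1 + C + n) + (1 + C + n) * z + (1 + C + n) * p) := by gcongr
    _ = _ := by ring

/-! ### Solutions for a given argument of the nonlinearity -/

/-- `u ∈ C([0,T], H^s)` solves `∂ₜu - νΔ(u + ζ) + f(v) = φ`, `u(0) = u₀`. With `v = u + ζ` this is
the original problem; truncating `u` in `v` gives a globally solvable one. -/
structure Solves (s : ℕ) (ν : ℝ) (f : ℝ → ℝ) (T : ℝ) (v : ℝ → L2 d) (u₀ : L2 d) (ζ φ : ℝ → L2 d)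
    (u : ℝ → L2 d) : Prop where
  memC : MemC s (Icc 0 T) u
  initial : u 0 = u₀
  linear : IsLinSol ν 0 T (force ν f v ζ φ) fun t => coeff (u t)

lemma IsLinSol.congr {ν a b : ℝ} {h y h' y' : ℝ → (Fin d → ℤ) → ℂ} (H : IsLinSol ν a b h y)
    (hh : EqOn h' h (Icc a b)) (hy : EqOn y' y (Icc a b)) : IsLinSol ν a b h' y' where
  integrableOn k := (H.integrableOn k).congr_fun (fun t ht => by rw [hh ht]) measurableSet_Icc
  continuousOn k := (H.continuousOn k).congr fun t ht => by rw [hy ht]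
  equation t ht k := by
    rw [hy ht, hy (left_mem_Icc.2 (ht.1.trans ht.2)), H.equation t ht k]
    congr 1
    refine intervalIntegral.integral_congr fun τ hτ => ?_
    rw [uIcc_of_le ht.1] at hτ
    have hτ' : τ ∈ Icc a b := ⟨hτ.1, hτ.2.trans ht.2⟩
    simp only [hh hτ', hy hτ']

lemma Solves.congr {s : ℕ} {ν : ℝ} {f : ℝ → ℝ} {T : ℝ} {v v' : ℝ → L2 d} {u₀ : L2 d}
    {ζ φ u : ℝ → L2 d} (H : Solves s ν f T v u₀ ζ φ u) (hv : EqOn v' v (Icc 0 T)) :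
    Solves s ν f T v' u₀ ζ φ u where
  memC := H.memC
  initial := H.initial
  linear := H.linear.congr (fun t ht => by funext k; simp only [force, hv ht]) fun _ _ => rfl

variable {s : ℕ} {ν : ℝ} {f : ℝ → ℝ}

lemma cast_pred (hs1 : 1 ≤ s) : ((s - 1 : ℕ) : ℝ) = (s : ℝ) - 1 := by
  rw [Nat.cast_sub hs1, Nat.cast_one]

lemma lintegral_wsq_force_lt_top (hs1 : 1 ≤ s) (hs : (d : ℝ) / 2 < s) (hf : ContDiff ℝ ∞ f)
    (hν : 0 < ν) {T : ℝ} {v ζ φ : ℝ → L2 d} (hv : MemC s (Icc 0 T) v)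
    (hζ : MemC (s + 1) (Icc 0 T) ζ) (hφ : MemL2 (s - 1) T φ) :
    ∫⁻ t in Icc 0 T, wsq ((s : ℝ) - 1) (force ν f v ζ φ t) < ⊤ := by
  obtain ⟨M, hM⟩ := hv.exists_bound
  obtain ⟨N, hN⟩ := hζ.exists_bound
  obtain ⟨C, hC⟩ := exists_wsq_force_le hs1 hs hf hν M
  have hφ' := hφ.lintegral_lt_top
  rw [cast_pred hs1] at hφ'
  push_cast at hN
  calc _ ≤ ∫⁻ t in Icc 0 T, (C : ℝ≥0∞) * (1 + N + wsq ((s : ℝ) - 1) (coeff (φ t))) := by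
        refine setLIntegral_mono' measurableSet_Icc fun t ht => (hC v ζ φ t (hM t ht)).trans ?_
        gcongr
        exact hN t ht
    _ = C * ((1 + N) * volume (Icc 0 T) + ∫⁻ t in Icc 0 T, wsq ((s : ℝ) - 1) (coeff (φ t))) := by
        rw [lintegral_const_mul' _ _ ENNReal.coe_ne_top, lintegral_add_left measurable_const,
          setLIntegral_const]
    _ < ⊤ := by
        rw [Real.volume_Icc]
        finiteness

lemma Solves.memX (hs1 : 1 ≤ s) (hs : (d : ℝ) / 2 < s) (hf : ContDiff ℝ ∞ f) (hν : 0 < ν)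
    {T : ℝ} (hT : 0 ≤ T) {v ζ φ u : ℝ → L2 d} {u₀ : L2 d} (hv : MemC s (Icc 0 T) v)
    (hζ : MemC (s + 1) (Icc 0 T) ζ) (hφ : MemL2 (s - 1) T φ) (H : Solves s ν f T v u₀ ζ φ u) :
    MemX s T u := by
  refine ⟨H.memC, H.memC.continuousOn.aestronglyMeasurable measurableSet_Icc, ?_⟩
  have h1 := H.linear.lintegral_wsq_le hν (T := T) (by linarith) s
  have h2 : normL2 (s + 1) T u ^ 2 < ⊤ := by
    rw [normL2_sq]
    push_cast
    refine h1.trans_lt (ENNReal.mul_lt_top ENNReal.coe_lt_top (ENNReal.add_lt_top.2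
      ⟨H.memC.wsq_lt_top (left_mem_Icc.2 hT), lintegral_wsq_force_lt_top hs1 hs hf hν hv hζ hφ⟩))
  simpa [ENNReal.pow_lt_top_iff] using h2

lemma force_add_rhs (u ζ φ : ℝ → L2 d) (τ : ℝ) (k : Fin d → ℤ) :
    -((ν * freqSq k : ℝ) : ℂ) * coeff (u τ + ζ τ : L2 d) k
        - coeff (fun x => f ((u τ + ζ τ : L2 d) x)) k + coeff (φ τ) k
      = -((ν * freqSq k : ℝ) : ℂ) * coeff (u τ) k
        + force ν f (fun τ => u τ + ζ τ) ζ φ τ k := by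
  rw [force, coeff_L2_add]
  ring

/-- The original problem is the case `v = u + ζ`. -/
lemma isSolution_iff (hs1 : 1 ≤ s) (hs : (d : ℝ) / 2 < s) (hf : ContDiff ℝ ∞ f) (hν : 0 < ν)
    {T : ℝ} (hT : 0 ≤ T) {ζ φ u : ℝ → L2 d} {u₀ : L2 d}
    (hζ : MemC (s + 1) (Icc 0 T) ζ) (hφ : MemL2 (s - 1) T φ) :
    IsSolution s ν f T u₀ ζ φ u ↔ Solves s ν f T (fun t => u t + ζ t) u₀ ζ φ u := by
  constructor
  · intro H
    have hv : MemC s (Icc 0 T) fun t => u t + ζ t := H.memX.1.add (hζ.of_le (Nat.le_succ s))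
    refine ⟨H.memX.1, H.initial, fun k => integrableOn_force hs1 hs hf ν hv hζ hφ k, fun k =>
      (continuous_coeff k).comp_continuousOn H.memX.1.continuousOn, fun t ht k => ?_⟩
    rw [H.equation t ht k, H.initial]
    simp only [force_add_rhs]
  · intro H
    have hv : MemC s (Icc 0 T) fun t => u t + ζ t := H.memC.add (hζ.of_le (Nat.le_succ s))
    refine ⟨H.memX hs1 hs hf hν hT hv hζ hφ, H.initial, fun t ht k => ?_⟩
    have := H.linear.equation t ht k
    rw [H.initial] at this
    simp only [force_add_rhs]
    exact this

lemma wsq_L2_add_le (σ : ℝ) (v w : L2 d) :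
    wsq σ (coeff (v + w : L2 d)) ≤ 2 * (wsq σ (coeff v) + wsq σ (coeff w)) := by
  rw [funext (coeff_L2_add v w)]
  exact wsq_add_le _ _ _

lemma exists_wsq_force_trunc_sub_le (hs1 : 1 ≤ s) (hs : (d : ℝ) / 2 < s) (hf : ContDiff ℝ ∞ f)
    (hν : 0 < ν) {R : ℝ} (hR : 0 < R) (M : ℝ≥0) :
    ∃ C : ℝ≥0, ∀ (w w' ζ φ ζ' φ' : ℝ → L2 d) (t : ℝ), wsq s (coeff (w t)) < ⊤ →
      wsq s (coeff (w' t)) < ⊤ → wsq s (coeff (ζ t)) ≤ M → wsq s (coeff (ζ' t)) ≤ M →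
      wsq ((s : ℝ) - 1) (fun k => force ν f (fun t => trunc s R (w t) + ζ t) ζ φ t k
          - force ν f (fun t => trunc s R (w' t) + ζ' t) ζ' φ' t k) ≤
        C * (3 * wsq ((s : ℝ) + 1) (coeff (ζ t - ζ' t : L2 d))
          + 8 * wsq s (coeff (w t - w' t : L2 d))
          + wsq ((s : ℝ) - 1) (coeff (φ t - φ' t : L2 d))) := by
  obtain ⟨B, hB⟩ : ∃ B : ℝ≥0, (B : ℝ≥0∞) = parsevalConst d * ENNReal.ofReal R ^ 2 :=
    ⟨_, ENNReal.coe_toNNReal (ENNReal.mul_ne_top parsevalConst_ne_top (by finiteness))⟩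
  obtain ⟨C, hC⟩ := exists_wsq_force_sub_le hs1 hs hf hν (2 * (B + M))
  have hb : ∀ w ζ : L2 d, wsq s (coeff w) < ⊤ → wsq s (coeff ζ) ≤ M →
      wsq s (coeff (trunc s R w + ζ : L2 d)) ≤ ((2 * (B + M) : ℝ≥0) : ℝ≥0∞) := by
    intro w ζ hw hζ
    refine (wsq_L2_add_le _ _ _).trans ?_
    rw [show ((2 * (B + M) : ℝ≥0) : ℝ≥0∞) = 2 * (B + M) by push_cast; rfl, hB]
    gcongr
    exact wsq_trunc_le hR hw
  refine ⟨C, fun w w' ζ φ ζ' φ' t hw hw' hζ hζ' => ?_⟩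
  refine (hC (fun t => trunc s R (w t) + ζ t) ζ φ (fun t => trunc s R (w' t) + ζ' t) ζ' φ' t
    (hb (w t) (ζ t) hw hζ) (hb (w' t) (ζ' t) hw' hζ')).trans ?_
  have h1 : wsq s (coeff ((trunc s R (w t) + ζ t) - (trunc s R (w' t) + ζ' t) : L2 d))
      ≤ 2 * (4 * wsq s (coeff (w t - w' t : L2 d))
        + wsq ((s : ℝ) + 1) (coeff (ζ t - ζ' t : L2 d))) := by
    rw [add_sub_add_comm]
    refine (wsq_L2_add_le _ _ _).trans ?_
    gcongr
    · exact wsq_trunc_sub_le hR hw hw'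
    · exact wsq_mono (by linarith) _
  calc _ ≤ (C : ℝ≥0∞) * (wsq ((s : ℝ) + 1) (coeff (ζ t - ζ' t : L2 d))
        + 2 * (4 * wsq s (coeff (w t - w' t : L2 d))
        + wsq ((s : ℝ) + 1) (coeff (ζ t - ζ' t : L2 d)))
        + wsq ((s : ℝ) - 1) (coeff (φ t - φ' t : L2 d))) := by gcongr
    _ = _ := by ring

/-- Solutions of the truncated problem depend Lipschitz continuously on the data. -/
lemma exists_normX_sub_le (hs1 : 1 ≤ s) (hs : (d : ℝ) / 2 < s) (hf : ContDiff ℝ ∞ f) (hν : 0 < ν)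
    (T : ℝ) {R : ℝ} (hR : 0 < R) (M : ℝ≥0) :
    ∃ K : ℝ≥0, ∀ (u₁ u₂ : L2 d) (ζ₁ φ₁ ζ₂ φ₂ w₁ w₂ : ℝ → L2 d),
      (∀ t ∈ Icc 0 T, wsq s (coeff (ζ₁ t)) ≤ M) → (∀ t ∈ Icc 0 T, wsq s (coeff (ζ₂ t)) ≤ M) →
      Solves s ν f T (fun t => trunc s R (w₁ t) + ζ₁ t) u₁ ζ₁ φ₁ w₁ →
      Solves s ν f T (fun t => trunc s R (w₂ t) + ζ₂ t) u₂ ζ₂ φ₂ w₂ →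
      normX s T (w₁ - w₂) ≤ K * dataDist s T u₁ ζ₁ φ₁ u₂ ζ₂ φ₂ := by
  obtain ⟨C, hC⟩ := exists_wsq_force_trunc_sub_le hs1 hs hf hν hR M
  set L := linConst ν T with hL
  set τ : ℝ≥0 := Real.toNNReal T
  obtain ⟨G, hG⟩ := exists_gronwall (L * C * 8) T
  set a : ℝ≥0 := L * (1 + C * (3 * τ + 1))
  set b : ℝ≥0 := a + L * C * 8 * (τ * (G * a))
  refine ⟨NNReal.sqrt (G * a) + NNReal.sqrt b, fun u₁ u₂ ζ₁ φ₁ ζ₂ φ₂ w₁ w₂ hM₁ hM₂ H₁ H₂ => ?_⟩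
  set D := dataDist s T u₁ ζ₁ φ₁ u₂ ζ₂ φ₂ with hD
  by_cases hT : 0 ≤ T
  swap
  · have : Icc 0 T = ∅ := Icc_eq_empty hT
    simp [normX, normC, normL2, this]
  have hD0 : wsq s (coeff (u₁ - u₂ : L2 d)) ≤ D ^ 2 := by
    rw [← sobNorm_sq]
    gcongr
    exact le_self_add.trans le_self_add
  have hDζ : ∀ t ∈ Icc 0 T, wsq ((s : ℝ) + 1) (coeff (ζ₁ t - ζ₂ t : L2 d)) ≤ D ^ 2 := fun t ht => by
    have := wsq_le_normC_sq (σ := s + 1) (ζ₁ - ζ₂) ht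
    push_cast at this
    refine this.trans ?_
    gcongr
    exact le_add_self.trans le_self_add
  have hDφ : ∫⁻ t in Icc 0 T, wsq ((s : ℝ) - 1) (coeff (φ₁ t - φ₂ t : L2 d)) ≤ D ^ 2 := by
    have := normL2_sq (s - 1) T (φ₁ - φ₂)
    rw [cast_pred hs1] at this
    refine this.symm.le.trans ?_
    gcongr
    exact le_add_self
  set z : ℝ → ℝ≥0∞ := fun t => wsq s (coeff (w₁ t - w₂ t : L2 d)) with hz
  -- the forcing terms differ by the data and by the solutions themselves
  have hF : ∀ t ∈ Icc 0 T, wsq ((s : ℝ) - 1)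
        (fun k => force ν f (fun t => trunc s R (w₁ t) + ζ₁ t) ζ₁ φ₁ t k
          - force ν f (fun t => trunc s R (w₂ t) + ζ₂ t) ζ₂ φ₂ t k)
      ≤ C * (3 * D ^ 2 + 8 * z t + wsq ((s : ℝ) - 1) (coeff (φ₁ t - φ₂ t : L2 d))) := by
    intro t ht
    refine (hC w₁ w₂ ζ₁ φ₁ ζ₂ φ₂ t (H₁.memC.wsq_lt_top ht) (H₂.memC.wsq_lt_top ht) (hM₁ t ht)
      (hM₂ t ht)).trans ?_
    calc _ ≤ (C : ℝ≥0∞) * (3 * D ^ 2 + 8 * z t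
          + wsq ((s : ℝ) - 1) (coeff (φ₁ t - φ₂ t : L2 d))) := by
          gcongr
          exact hDζ t ht
      _ = _ := by ring
  have hzm : ∀ t, Icc 0 t ⊆ Icc 0 T → AEMeasurable z (volume.restrict (Icc 0 t)) := fun t ht => by
    have hc : ContinuousOn (fun t => parsevalConst d * ‖bessel (s : ℝ) (w₁ t - w₂ t)‖ₑ ^ 2)
        (Icc 0 T) := by
      have := (memC_iff.1 (H₁.memC.sub H₂.memC)).2
      refine ENNReal.continuous_const_mul parsevalConst_ne_top |>.comp_continuousOn ?_
      exact (ENNReal.continuous_pow 2).comp_continuousOn this.enorm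
    refine ((hc.mono ht).aemeasurable measurableSet_Icc).congr ?_
    filter_upwards [ae_restrict_mem measurableSet_Icc] with r hr
    exact (wsq_eq_enorm_bessel ((H₁.memC.sub H₂.memC).wsq_lt_top (ht hr))).symm
  have hI : ∀ t ∈ Icc 0 T, ∫⁻ r in Icc 0 t, wsq ((s : ℝ) - 1)
        (fun k => force ν f (fun t => trunc s R (w₁ t) + ζ₁ t) ζ₁ φ₁ r k
          - force ν f (fun t => trunc s R (w₂ t) + ζ₂ t) ζ₂ φ₂ r k)
      ≤ C * ((3 * τ + 1) * D ^ 2) + C * 8 * ∫⁻ r in Icc 0 t, z r := by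
    intro t ht
    have hsub : Icc 0 t ⊆ Icc 0 T := Icc_subset_Icc_right ht.2
    have hm : AEMeasurable (fun r => 3 * D ^ 2 + 8 * z r) (volume.restrict (Icc 0 t)) :=
      aemeasurable_const.add ((hzm t hsub).const_mul _)
    calc _ ≤ ∫⁻ r in Icc 0 t, (C : ℝ≥0∞) * ((3 * D ^ 2 + 8 * z r)
          + wsq ((s : ℝ) - 1) (coeff (φ₁ r - φ₂ r : L2 d))) :=
          setLIntegral_mono' measurableSet_Icc fun r hr => hF r (hsub hr)
      _ = C * ((3 * D ^ 2 * volume (Icc 0 t) + 8 * ∫⁻ r in Icc 0 t, z r)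
          + ∫⁻ r in Icc 0 t, wsq ((s : ℝ) - 1) (coeff (φ₁ r - φ₂ r : L2 d))) := by
          rw [lintegral_const_mul' _ _ ENNReal.coe_ne_top,
            lintegral_add_left' hm,
            lintegral_add_left measurable_const, setLIntegral_const,
            lintegral_const_mul' _ _ (by norm_num)]
      _ ≤ C * ((3 * D ^ 2 * τ + 8 * ∫⁻ r in Icc 0 t, z r) + D ^ 2) := by
          gcongr
          · rw [Real.volume_Icc]
            exact ENNReal.ofReal_le_ofReal (by linarith [ht.2])
          · exact (lintegral_mono_set hsub).trans hDφ
      _ = _ := by ring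
  have hlin := H₁.linear.sub H₂.linear
  have hcoe : ∀ t, (fun k => coeff (w₁ t) k - coeff (w₂ t) k) = coeff (w₁ t - w₂ t : L2 d) :=
    fun t => (funext (coeff_L2_sub (w₁ t) (w₂ t))).symm
  have ha : (a : ℝ≥0∞) = L * (1 + C * (3 * τ + 1)) := by simp only [a]; push_cast; rfl
  have hb : (b : ℝ≥0∞) = a + L * C * 8 * (τ * (G * a)) := by simp only [b]; push_cast; rfl
  have hz0 : wsq s (fun k => coeff (w₁ 0) k - coeff (w₂ 0) k) ≤ D ^ 2 := by
    rw [hcoe, H₁.initial, H₂.initial]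
    exact hD0
  have hzG : ∀ t ∈ Icc 0 T, z t ≤ G * (a * D ^ 2) := by
    obtain ⟨N, hN⟩ := (H₁.memC.sub H₂.memC).exists_bound
    refine hG 0 T z (a * D ^ 2) N (by linarith) ENNReal.coe_lt_top hN fun t ht => ?_
    have h1 := hlin.wsq_le hν (T := T) (by linarith) s ht
    rw [hcoe] at h1
    refine h1.trans ?_
    calc _ ≤ (L : ℝ≥0∞) * (D ^ 2 + (C * ((3 * τ + 1) * D ^ 2) + C * 8 * ∫⁻ r in Icc 0 t, z r)) := by
          gcongr
          exact hI t ht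
      _ = _ := by
          rw [ha, show ((L * C * 8 : ℝ≥0) : ℝ≥0∞) = L * C * 8 by push_cast; rfl]
          ring
  have hsq : ∀ c : ℝ≥0, (c : ℝ≥0∞) * D ^ 2 = ((NNReal.sqrt c : ℝ≥0∞) * D) ^ 2 := fun c => by
    rw [mul_pow, ← ENNReal.coe_pow, NNReal.sq_sqrt]
  rw [normX, show ((NNReal.sqrt (G * a) + NNReal.sqrt b : ℝ≥0) : ℝ≥0∞) * D
    = NNReal.sqrt (G * a) * D + NNReal.sqrt b * D by rw [ENNReal.coe_add, add_mul]]
  refine add_le_add (normC_le fun t ht => ?_) (normL2_le ?_)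
  · rw [← hsq, ENNReal.coe_mul, mul_assoc]
    exact hzG t ht
  · rw [← hsq]
    have h1 := hlin.lintegral_wsq_le hν (T := T) (by linarith) s
    simp only [hcoe] at h1
    push_cast
    refine h1.trans ?_
    have h2 : ∫⁻ r in Icc 0 T, z r ≤ G * (a * D ^ 2) * τ := by
      calc _ ≤ ∫⁻ _ in Icc 0 T, G * (a * D ^ 2) := setLIntegral_mono' measurableSet_Icc hzG
        _ = _ := by rw [setLIntegral_const, Real.volume_Icc, sub_zero]; rfl
    calc _ ≤ (L : ℝ≥0∞) * (D ^ 2 + (C * ((3 * τ + 1) * D ^ 2) + C * 8 * (G * (a * D ^ 2) * τ))) := by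
          gcongr
          · rw [← hcoe]; exact hz0
          · exact (hI T (right_mem_Icc.2 hT)).trans (by gcongr)
      _ = (L * (1 + C * (3 * τ + 1)) + L * C * 8 * (τ * (G * a))) * D ^ 2 := by ring
      _ = _ := by rw [hb, ha]

/-! ### Existence for the truncated problem -/

lemma force_neg (v ζ φ : ℝ → L2 d) (t : ℝ) (k : Fin d → ℤ) :
    force ν f v ζ φ t (-k) = conj (force ν f v ζ φ t k) := by
  have h : freqSq (-k) = freqSq k := by simp [freqSq]
  simp only [force, coeff_neg_eq_conj, h, map_add, map_sub, map_mul, map_neg, Complex.conj_ofReal]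

/-- The curve in `H^s` with Bessel potential `V`, extended by constants outside `[0, T]`. -/
def curve (s : ℕ) {T : ℝ} (hT : 0 ≤ T) (V : C(Icc 0 T, L2 d)) (t : ℝ) : L2 d :=
  bessel (-(s : ℝ)) (V (projIcc 0 T hT t))

lemma wsq_curve_lt_top {T : ℝ} (hT : 0 ≤ T) (V : C(Icc 0 T, L2 d)) (t : ℝ) :
    wsq s (coeff (curve s hT V t)) < ⊤ := (bessel_bessel_neg (Nat.cast_nonneg s) _).1

lemma bessel_curve {T : ℝ} (hT : 0 ≤ T) (V : C(Icc 0 T, L2 d)) (t : ℝ) :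
    bessel (s : ℝ) (curve s hT V t) = V (projIcc 0 T hT t) :=
  (bessel_bessel_neg (Nat.cast_nonneg s) _).2

lemma memC_curve {T : ℝ} (hT : 0 ≤ T) (V : C(Icc 0 T, L2 d)) (I : Set ℝ) :
    MemC s I (curve s hT V) := by
  refine memC_iff.2 ⟨fun t _ => wsq_curve_lt_top hT V t, ?_⟩
  simp only [bessel_curve]
  exact (V.continuous.comp continuous_projIcc).continuousOn

/-- The truncated problem is solvable on every time interval `[0, T]`. The unknown is the Bessel
potential `V = (1 - Δ)^{s/2} u` in `C([0,T], L²)`, on which Duhamel's formula acts as a Volterra map. -/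
lemma exists_solves_trunc (hs1 : 1 ≤ s) (hs : (d : ℝ) / 2 < s) (hf : ContDiff ℝ ∞ f) (hν : 0 < ν)
    {T : ℝ} (hT : 0 ≤ T) {R : ℝ} (hR : 0 < R) {u₀ : L2 d} {ζ φ : ℝ → L2 d} (hu₀ : MemH s u₀)
    (hζ : MemC (s + 1) (Icc 0 T) ζ) (hφ : MemL2 (s - 1) T φ) :
    ∃ u, Solves s ν f T (fun t => trunc s R (u t) + ζ t) u₀ ζ φ u := by
  have hζs : MemC s (Icc 0 T) ζ := hζ.of_le (Nat.le_succ s)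
  set v : C(Icc 0 T, L2 d) → ℝ → L2 d := fun V t => trunc s R (curve s hT V t) + ζ t with hvdef
  have hv : ∀ V, MemC s (Icc 0 T) (v V) := fun V => ((memC_curve hT V _).trunc hR).add hζs
  set h : C(Icc 0 T, L2 d) → ℝ → (Fin d → ℤ) → ℂ := fun V => force ν f (v V) ζ φ with hh
  set y : C(Icc 0 T, L2 d) → ℝ → (Fin d → ℤ) → ℂ := fun V t k =>
    duhamel (ν * freqSq k) 0 (coeff u₀ k) (fun τ => h V τ k) t with hy
  have hlin : ∀ V, IsLinSol ν 0 T (h V) (y V) := fun V =>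
    isLinSol_duhamel _ fun k => integrableOn_force hs1 hs hf ν (hv V) hζ hφ k
  have hy0 : ∀ V, y V 0 = coeff u₀ := fun V => by
    funext k
    exact duhamel_self _ _ _ _
  have hu₀' : wsq s (coeff u₀) < ⊤ := memH_iff.1 hu₀
  have hfin : ∀ V, ∫⁻ t in Icc 0 T, wsq ((s : ℝ) - 1) (h V t) < ⊤ := fun V =>
    lintegral_wsq_force_lt_top hs1 hs hf hν (hv V) hζ hφ
  have hylt : ∀ V, ∀ t ∈ Icc 0 T, wsq s (y V t) < ⊤ := fun V t ht => by
    refine ((hlin V).wsq_le hν (T := T) (by linarith) s ht).trans_lt ?_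
    rw [hy0]
    refine ENNReal.mul_lt_top ENNReal.coe_lt_top (ENNReal.add_lt_top.2 ⟨hu₀', ?_⟩)
    exact (lintegral_mono_set (Icc_subset_Icc_right ht.2)).trans_lt (hfin V)
  have hsymm : ∀ V t k, y V t (-k) = conj (y V t k) := fun V t k => by
    have hk : freqSq (-k) = freqSq k := by simp [freqSq]
    simp only [hy, hh, force_neg, coeff_neg_eq_conj, hk, duhamel_conj]
  have hex : ∀ V (t : Icc 0 T), ∃ w : L2 d,
      ∀ k, coeff w k = ((wt k ^ ((s : ℝ) / 2) : ℝ) : ℂ) * y V t k := fun V t => by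
    refine exists_L2_of_wsq_lt_top ?_ fun k => ?_
    · rw [wsq_weight_mul, zero_add]
      exact hylt V t t.2
    · rw [hsymm, wt_neg, map_mul, Complex.conj_ofReal]
  choose w hw using hex
  have hwsub : ∀ V V' (t t' : Icc 0 T), parsevalConst d * ‖w V t - w V' t'‖ₑ ^ 2
      = wsq s fun k => y V t k - y V' t' k := fun V V' t t' => by
    rw [← wsq_zero_L2, ← zero_add (s : ℝ), ← wsq_weight_mul]
    congr 1
    funext k
    rw [coeff_L2_sub, hw, hw]
    ring
  have hcancel : ∀ {x y : ℝ≥0∞}, parsevalConst d * x ≤ parsevalConst d * y → x ≤ y := fun hxy =>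
    (ENNReal.mul_le_mul_iff_right parsevalConst_ne_zero parsevalConst_ne_top).1 hxy
  have hcont : ∀ V, Continuous (w V) := fun V => by
    refine continuous_iff_continuousAt.2 fun t₀ => ?_
    have h1 : Tendsto (fun t : Icc 0 T => wsq s fun k => y V t k - y V t₀ k) (𝓝 t₀) (𝓝 0) := by
      have := (hlin V).tendsto_wsq hν (σ := s) (by rw [hy0]; exact hu₀') (hfin V) t₀.2
      refine this.comp (tendsto_nhdsWithin_iff.2 ⟨continuous_subtype_val.tendsto _, ?_⟩)
      exact Eventually.of_forall fun t => t.2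
    simp only [← hwsub] at h1
    have h2 := ENNReal.Tendsto.const_mul h1 (Or.inr (ENNReal.inv_ne_top.2 (parsevalConst_ne_zero (d := d))))
    simp only [← mul_assoc, ENNReal.inv_mul_cancel parsevalConst_ne_zero parsevalConst_ne_top,
      one_mul, mul_zero] at h2
    rw [ContinuousAt, tendsto_iff_edist_tendsto_0]
    simp only [edist_eq_enorm_sub]
    exact tendsto_zero_of_sq h2
  obtain ⟨M, hM⟩ := hζs.exists_bound
  obtain ⟨C, hC⟩ := exists_wsq_force_trunc_sub_le (d := d) hs1 hs hf hν hR M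
  have hzero : ∀ σ (x : L2 d), wsq σ (coeff (x - x : L2 d)) = 0 := fun σ x => by
    rw [sub_self, coeff_L2_zero]
    simp [wsq]
  obtain ⟨W, hW⟩ := exists_fixedPoint_of_volterra hT (fun V => ⟨w V, hcont V⟩)
    (linConst ν T * C * 8) fun V V' t => by
      refine hcancel ?_
      change parsevalConst d * ‖w V t - w V' t‖ₑ ^ 2 ≤ _
      rw [hwsub]
      refine (((hlin V).sub (hlin V')).wsq_le hν (T := T) (by linarith) s t.2).trans ?_
      have e0 : wsq s (fun k => y V 0 k - y V' 0 k) = 0 := by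
        rw [hy0, hy0]
        simp [wsq]
      rw [e0, zero_add]
      have h1 : ∫⁻ r in Icc 0 (t : ℝ), wsq ((s : ℝ) - 1) (fun k => h V r k - h V' r k)
          ≤ ∫⁻ r in Icc 0 (t : ℝ), (C * 8 * parsevalConst d) *
            ‖V (projIcc 0 T hT r) - V' (projIcc 0 T hT r)‖ₑ ^ 2 := by
        refine setLIntegral_mono' measurableSet_Icc fun r hr => ?_
        have hr' : r ∈ Icc 0 T := ⟨hr.1, hr.2.trans t.2.2⟩
        refine (hC (curve s hT V) (curve s hT V') ζ φ ζ φ r (wsq_curve_lt_top hT V r)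
          (wsq_curve_lt_top hT V' r) (hM r hr') (hM r hr')).trans ?_
        rw [hzero, hzero, wsq_sub_eq_enorm_bessel (wsq_curve_lt_top hT V r)
          (wsq_curve_lt_top hT V' r), bessel_curve, bessel_curve]
        exact le_of_eq (by ring)
      rw [lintegral_const_mul' _ _ (by
        have := parsevalConst_ne_top (d := d); finiteness)] at h1
      refine (mul_le_mul' le_rfl h1).trans (le_of_eq ?_)
      push_cast
      ring
  have hWw : ∀ t, w W t = W t := fun t => congrArg (fun V : C(Icc 0 T, L2 d) => V t) hW
  have hcoeff : EqOn (fun t => coeff (curve s hT W t)) (y W) (Icc 0 T) := fun t ht => by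
    funext k
    have h1 := coeff_bessel (wsq_curve_lt_top (s := s) hT W t) k
    rw [bessel_curve, projIcc_of_mem hT ht, ← hWw, hw] at h1
    have h2 : ((wt k ^ ((s : ℝ) / 2) : ℝ) : ℂ) ≠ 0 :=
      Complex.ofReal_ne_zero.2 (Real.rpow_pos_of_pos (wt_pos k) _).ne'
    exact (mul_left_cancel₀ h2 h1).symm
  refine ⟨curve s hT W, memC_curve hT W _, L2_ext fun k => ?_, ?_⟩
  · exact (congrFun (hcoeff (left_mem_Icc.2 hT)) k).trans (congrFun (hy0 W) k)
  · exact (hlin W).congr (fun _ _ => rfl) hcoeff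

/-! ### Solutions, uniqueness and continuation -/

lemma exists_norm_bessel_le (d s : ℕ) (M : ℝ≥0) :
    ∃ R : ℝ, 0 < R ∧ ∀ v : L2 d, wsq s (coeff v) ≤ M → ‖bessel (s : ℝ) v‖ ≤ R := by
  set c : ℝ≥0∞ := (parsevalConst d)⁻¹ * M with hc
  have hct : c ≠ ⊤ := ENNReal.mul_ne_top (ENNReal.inv_ne_top.2 parsevalConst_ne_zero)
    ENNReal.coe_ne_top
  refine ⟨c.toReal + 1, by positivity, fun v hv => ?_⟩
  rw [wsq_eq_enorm_bessel (hv.trans_lt ENNReal.coe_lt_top)] at hv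
  have h1 : ‖bessel (s : ℝ) v‖ₑ ^ 2 ≤ c := by
    rw [hc, ← one_mul (‖bessel (s : ℝ) v‖ₑ ^ 2), ← ENNReal.inv_mul_cancel
      (parsevalConst_ne_zero (d := d)) parsevalConst_ne_top, mul_assoc]
    gcongr
  have h2 := ENNReal.toReal_mono hct h1
  rw [ENNReal.toReal_pow, toReal_enorm] at h2
  nlinarith [sq_nonneg (‖bessel (s : ℝ) v‖ - 1)]

lemma MemC.exists_norm_bessel_le {a b : ℝ} {u : ℝ → L2 d} (hu : MemC s (Icc a b) u) :
    ∃ R : ℝ, 0 < R ∧ ∀ t ∈ Icc a b, ‖bessel (s : ℝ) (u t)‖ ≤ R := by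
  obtain ⟨M, hM⟩ := hu.exists_bound
  obtain ⟨R, hR, h⟩ := ParabolicTorus.exists_norm_bessel_le d s M
  exact ⟨R, hR, fun t ht => h _ (hM t ht)⟩

lemma IsSolution.restrict {T T' : ℝ} {u₀ : L2 d} {ζ φ u : ℝ → L2 d}
    (H : IsSolution s ν f T u₀ ζ φ u) (hT : T' ≤ T) : IsSolution s ν f T' u₀ ζ φ u where
  memX := ⟨H.memX.1.mono (Icc_subset_Icc_right hT), H.memX.2.mono hT⟩
  initial := H.initial
  equation t ht := H.equation t (Icc_subset_Icc_right hT ht)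

lemma Solves.restrict {T T' : ℝ} {u₀ : L2 d} {v ζ φ u : ℝ → L2 d}
    (H : Solves s ν f T v u₀ ζ φ u) (hT : T' ≤ T) : Solves s ν f T' v u₀ ζ φ u where
  memC := H.memC.mono (Icc_subset_Icc_right hT)
  initial := H.initial
  linear := H.linear.restrict le_rfl hT

lemma dataDist_self (T : ℝ) (u₀ : L2 d) (ζ φ : ℝ → L2 d) : dataDist s T u₀ ζ φ u₀ ζ φ = 0 := by
  have h : ∀ σ : ℕ, sobNorm σ (0 : L2 d) = 0 := fun σ => by
    rw [sobNorm_eq, coeff_L2_zero]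
    simp [wsq]
  simp [dataDist, normC, normL2, h]

lemma eqOn_of_normX_sub_eq_zero {T : ℝ} {u v : ℝ → L2 d} (h : normX s T (u - v) = 0) :
    EqOn u v (Icc 0 T) := fun t ht => by
  have h1 := wsq_le_normC_sq (σ := s) (u - v) ht
  rw [(add_eq_zero.1 h).1] at h1
  have h2 := wsq_eq_zero (Nat.cast_nonneg s) (le_antisymm (h1.trans (by simp)) zero_le)
  refine L2_ext fun k => sub_eq_zero.1 ?_
  rw [← coeff_L2_sub]
  exact h2 k

lemma Solves.isSolution (hs1 : 1 ≤ s) (hs : (d : ℝ) / 2 < s) (hf : ContDiff ℝ ∞ f) (hν : 0 < ν)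
    {T : ℝ} (hT : 0 ≤ T) {R : ℝ} (hR : 0 < R) {u₀ : L2 d} {ζ φ u : ℝ → L2 d}
    (hζ : MemC (s + 1) (Icc 0 T) ζ) (hφ : MemL2 (s - 1) T φ)
    (H : Solves s ν f T (fun t => trunc s R (u t) + ζ t) u₀ ζ φ u)
    (hu : ∀ t ∈ Icc 0 T, ‖bessel (s : ℝ) (u t)‖ ≤ R) : IsSolution s ν f T u₀ ζ φ u :=
  (isSolution_iff hs1 hs hf hν hT hζ hφ).2 <| H.congr fun t ht => by
    simp only [trunc_eq_self hR (hu t ht)]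

lemma IsSolution.solves (hs1 : 1 ≤ s) (hs : (d : ℝ) / 2 < s) (hf : ContDiff ℝ ∞ f) (hν : 0 < ν)
    {T : ℝ} (hT : 0 ≤ T) {R : ℝ} (hR : 0 < R) {u₀ : L2 d} {ζ φ u : ℝ → L2 d}
    (hζ : MemC (s + 1) (Icc 0 T) ζ) (hφ : MemL2 (s - 1) T φ) (H : IsSolution s ν f T u₀ ζ φ u)
    (hu : ∀ t ∈ Icc 0 T, ‖bessel (s : ℝ) (u t)‖ ≤ R) :
    Solves s ν f T (fun t => trunc s R (u t) + ζ t) u₀ ζ φ u :=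
  ((isSolution_iff hs1 hs hf hν hT hζ hφ).1 H).congr fun t ht => by
    simp only [trunc_eq_self hR (hu t ht)]

lemma Solves.eqOn (hs1 : 1 ≤ s) (hs : (d : ℝ) / 2 < s) (hf : ContDiff ℝ ∞ f) (hν : 0 < ν)
    {T : ℝ} {R : ℝ} (hR : 0 < R) {u₀ : L2 d} {ζ φ u v : ℝ → L2 d}
    (hζ : MemC (s + 1) (Icc 0 T) ζ)
    (H : Solves s ν f T (fun t => trunc s R (u t) + ζ t) u₀ ζ φ u)
    (H' : Solves s ν f T (fun t => trunc s R (v t) + ζ t) u₀ ζ φ v) : EqOn u v (Icc 0 T) := by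
  obtain ⟨M, hM⟩ := (hζ.of_le (Nat.le_succ s)).exists_bound
  obtain ⟨K, hK⟩ := exists_normX_sub_le (d := d) hs1 hs hf hν T hR M
  have := hK u₀ u₀ ζ φ ζ φ u v hM hM H H'
  rw [dataDist_self, mul_zero] at this
  exact eqOn_of_normX_sub_eq_zero (le_antisymm this zero_le)

lemma IsSolution.eqOn (hs1 : 1 ≤ s) (hs : (d : ℝ) / 2 < s) (hf : ContDiff ℝ ∞ f) (hν : 0 < ν)
    {T : ℝ} (hT : 0 ≤ T) {u₀ : L2 d} {ζ φ u v : ℝ → L2 d}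
    (hζ : MemC (s + 1) (Icc 0 T) ζ) (hφ : MemL2 (s - 1) T φ)
    (H : IsSolution s ν f T u₀ ζ φ u) (H' : IsSolution s ν f T u₀ ζ φ v) : EqOn u v (Icc 0 T) := by
  obtain ⟨R, hR, hu⟩ := H.memX.1.exists_norm_bessel_le
  obtain ⟨R', _, hv⟩ := H'.memX.1.exists_norm_bessel_le
  have hR0 : 0 < max R R' := lt_max_of_lt_left hR
  exact (H.solves hs1 hs hf hν hT hR0 hζ hφ fun t ht => (hu t ht).trans (le_max_left _ _)).eqOn
    hs1 hs hf hν hR0 hζ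
    (H'.solves hs1 hs hf hν hT hR0 hζ hφ fun t ht => (hv t ht).trans (le_max_right _ _))

lemma IsSolution.congr (hs1 : 1 ≤ s) (hs : (d : ℝ) / 2 < s) (hf : ContDiff ℝ ∞ f) (hν : 0 < ν)
    {T : ℝ} (hT : 0 ≤ T) {u₀ : L2 d} {ζ φ u v : ℝ → L2 d}
    (hζ : MemC (s + 1) (Icc 0 T) ζ) (hφ : MemL2 (s - 1) T φ)
    (H : IsSolution s ν f T u₀ ζ φ u) (huv : EqOn v u (Icc 0 T)) : IsSolution s ν f T u₀ ζ φ v := by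
  have H' := (isSolution_iff hs1 hs hf hν hT hζ hφ).1 H
  refine (isSolution_iff hs1 hs hf hν hT hζ hφ).2 ⟨H'.memC.congr huv,
    (huv (left_mem_Icc.2 hT)).trans H.initial, H'.linear.congr (fun t ht => ?_) fun t ht => ?_⟩
  · funext k
    simp only [force, huv ht]
  · simp only [huv ht]

lemma exists_isSolution_zero (hs1 : 1 ≤ s) (hs : (d : ℝ) / 2 < s) (hf : ContDiff ℝ ∞ f)
    (hν : 0 < ν) {u₀ : L2 d} {ζ φ : ℝ → L2 d} (hu₀ : MemH s u₀) (hζ : MemC (s + 1) (Icc 0 0) ζ)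
    (hφ : MemL2 (s - 1) 0 φ) : ∃ u, IsSolution s ν f 0 u₀ ζ φ u := by
  have hR : 0 < ‖bessel (s : ℝ) u₀‖ + 1 := by positivity
  obtain ⟨u, hu⟩ := exists_solves_trunc hs1 hs hf hν le_rfl hR hu₀ hζ hφ
  refine ⟨u, hu.isSolution hs1 hs hf hν le_rfl hR hζ hφ fun t ht => ?_⟩
  rw [Icc_self, mem_singleton_iff] at ht
  rw [ht, hu.initial]
  linarith

/-- A solution can be continued beyond its final time: it coincides with the solution of a truncated
problem, and the latter stays below the level of the truncation for some time. -/
lemma IsSolution.exists_extension (hs1 : 1 ≤ s) (hs : (d : ℝ) / 2 < s) (hf : ContDiff ℝ ∞ f)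
    (hν : 0 < ν) {T T₁ : ℝ} (hT : 0 ≤ T) (hT₁ : T < T₁) {u₀ : L2 d} {ζ φ u : ℝ → L2 d}
    (hu₀ : MemH s u₀) (hζ : MemC (s + 1) (Icc 0 T₁) ζ) (hφ : MemL2 (s - 1) T₁ φ)
    (H : IsSolution s ν f T u₀ ζ φ u) :
    ∃ T' > T, ∃ v, IsSolution s ν f T' u₀ ζ φ v := by
  have hζT : MemC (s + 1) (Icc 0 T) ζ := hζ.mono (Icc_subset_Icc_right hT₁.le)
  obtain ⟨R, hR, hu⟩ := H.memX.1.exists_norm_bessel_le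
  have hR1 : 0 < R + 1 := by positivity
  obtain ⟨w, hw⟩ := exists_solves_trunc hs1 hs hf hν (hT.trans hT₁.le) hR1 hu₀ hζ hφ
  have hwu : EqOn w u (Icc 0 T) := (hw.restrict hT₁.le).eqOn hs1 hs hf hν hR1 hζT
    (H.solves hs1 hs hf hν hT hR1 hζT (hφ.mono hT₁.le) fun t ht => (hu t ht).trans (by linarith))
  have hc : ContinuousWithinAt (fun t => ‖bessel (s : ℝ) (w t)‖) (Icc 0 T₁) T :=
    ((memC_iff.1 hw.memC).2.norm) T ⟨hT, hT₁.le⟩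
  have hlt : ‖bessel (s : ℝ) (w T)‖ < R + 1 := by
    rw [hwu (right_mem_Icc.2 hT)]
    linarith [hu T (right_mem_Icc.2 hT)]
  have hev : ∀ᶠ t in 𝓝[Ici T] T, ‖bessel (s : ℝ) (w t)‖ < R + 1 := by
    have h1 : Tendsto (fun t => ‖bessel (s : ℝ) (w t)‖) (𝓝[Icc T T₁] T)
        (𝓝 ‖bessel (s : ℝ) (w T)‖) := hc.tendsto.mono_left (nhdsWithin_mono _ (Icc_subset_Icc_left hT))
    rw [nhdsWithin_Icc_eq_nhdsGE hT₁] at h1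
    exact h1.eventually_lt_const hlt
  obtain ⟨c, hTc, hc'⟩ := (mem_nhdsGE_iff_exists_Icc_subset.1 hev)
  have hTT' : T < min c T₁ := lt_min hTc hT₁
  refine ⟨min c T₁, hTT', w, (hw.restrict (min_le_right _ _)).isSolution hs1 hs hf hν
    (hT.trans hTT'.le) hR1 (hζ.mono (Icc_subset_Icc_right (min_le_right _ _)))
    (hφ.mono (min_le_right _ _)) fun t ht => ?_⟩
  rcases le_total t T with h | h
  · rw [hwu ⟨ht.1, h⟩]
    linarith [hu t ⟨ht.1, h⟩]
  · exact (hc' ⟨h, ht.2.trans (min_le_left _ _)⟩).le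

/-- A solution on `[0, T)` which is bounded in `H^s` has a continuation to `[0, T]`. -/
lemma exists_isSolution_of_bound (hs1 : 1 ≤ s) (hs : (d : ℝ) / 2 < s) (hf : ContDiff ℝ ∞ f)
    (hν : 0 < ν) {T : ℝ} (hT : 0 < T) {u₀ : L2 d} {ζ φ u : ℝ → L2 d}
    (hu₀ : MemH s u₀) (hζ : MemC (s + 1) (Icc 0 T) ζ) (hφ : MemL2 (s - 1) T φ)
    (H : ∀ t ∈ Ico 0 T, IsSolution s ν f t u₀ ζ φ u) {M : ℝ≥0}
    (hM : ∀ t ∈ Ico 0 T, wsq s (coeff (u t)) ≤ M) : ∃ v, IsSolution s ν f T u₀ ζ φ v := by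
  obtain ⟨R, hR, hRM⟩ := exists_norm_bessel_le d s M
  obtain ⟨w, hw⟩ := exists_solves_trunc hs1 hs hf hν hT.le hR hu₀ hζ hφ
  have h1 : ∀ t ∈ Ico 0 T, ‖bessel (s : ℝ) (w t)‖ ≤ R := fun t ht => by
    have hζt := hζ.mono (Icc_subset_Icc_right ht.2.le)
    have := (hw.restrict ht.2.le).eqOn hs1 hs hf hν hR hζt
      ((H t ht).solves hs1 hs hf hν ht.1 hR hζt (hφ.mono ht.2.le) fun r hr =>
        hRM _ (hM r ⟨hr.1, hr.2.trans_lt ht.2⟩))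
    rw [this (right_mem_Icc.2 ht.1)]
    exact hRM _ (hM t ht)
  refine ⟨w, hw.isSolution hs1 hs hf hν hT.le hR hζ hφ fun t ht => ?_⟩
  rcases ht.2.lt_or_eq with h | rfl
  · exact h1 t ⟨ht.1, h⟩
  · have hc : Tendsto (fun r => ‖bessel (s : ℝ) (w r)‖) (𝓝[Ico 0 t] t)
        (𝓝 ‖bessel (s : ℝ) (w t)‖) :=
      (((memC_iff.1 hw.memC).2.norm) t ht).tendsto.mono_left (nhdsWithin_mono _ Ico_subset_Icc_self)
    have := right_nhdsWithin_Ico_neBot hT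
    refine le_of_tendsto hc ?_
    filter_upwards [self_mem_nhdsWithin] with r hr using h1 r hr

/-- A solution on `[0, T)` which does not tend to infinity in `H^s` at time `T` is bounded: if it is
small compared to `M` at a time close to `T`, it cannot reach the level `M` before `T`. -/
lemma exists_bound_of_frequently (hs1 : 1 ≤ s) (hs : (d : ℝ) / 2 < s) (hf : ContDiff ℝ ∞ f)
    (hν : 0 < ν) {T : ℝ} (hT : 0 < T) {u₀ : L2 d} {ζ φ u : ℝ → L2 d}
    (hζ : MemC (s + 1) (Icc 0 T) ζ) (hφ : MemL2 (s - 1) T φ)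
    (H : ∀ t ∈ Ico 0 T, IsSolution s ν f t u₀ ζ φ u) {R : ℝ≥0}
    (hR : ∃ᶠ t in 𝓝[<] T, wsq s (coeff (u t)) ≤ R) :
    ∃ M : ℝ≥0, ∀ t ∈ Ico 0 T, wsq s (coeff (u t)) ≤ M := by
  obtain ⟨N, hN⟩ := (hζ.of_le (Nat.le_succ s)).exists_bound
  obtain ⟨N₁, hN₁⟩ := hζ.exists_bound
  push_cast at hN₁
  set L := linConst ν T with hL
  set M : ℝ≥0 := L * (R + 1) + R + 1 with hM
  obtain ⟨C, hC⟩ := exists_wsq_force_le (d := d) hs1 hs hf hν (2 * (M + N))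
  set g : ℝ → ℝ≥0∞ := fun r => C * (1 + N₁ + wsq ((s : ℝ) - 1) (coeff (φ r))) with hg
  have hgi : ∫⁻ r in Icc 0 T, g r ≠ ⊤ := by
    have hφ' := hφ.lintegral_lt_top
    rw [cast_pred hs1] at hφ'
    rw [hg, lintegral_const_mul' _ _ ENNReal.coe_ne_top, lintegral_add_left measurable_const,
      setLIntegral_const, Real.volume_Icc]
    finiteness
  have hsmall : ∀ᶠ a in 𝓝[<] T, ∫⁻ r in Icc a T, g r ∂(volume.restrict (Icc 0 T)) < 1 := by
    have h1 : Tendsto (fun a => (volume.restrict (Icc 0 T)) (Icc a T)) (𝓝[<] T) (𝓝 0) := by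
      have h2 : Tendsto (fun a : ℝ => ENNReal.ofReal (T - a)) (𝓝[<] T) (𝓝 0) := by
        have : Tendsto (fun a : ℝ => ENNReal.ofReal (T - a)) (𝓝 T) (𝓝 (ENNReal.ofReal (T - T))) :=
          (ENNReal.continuous_ofReal.comp (continuous_const.sub continuous_id)).tendsto T
        rw [sub_self, ENNReal.ofReal_zero] at this
        exact this.mono_left nhdsWithin_le_nhds
      refine tendsto_of_tendsto_of_tendsto_of_le_of_le tendsto_const_nhds h2 (fun _ => zero_le)
        fun a => (Measure.restrict_apply_le _ _).trans ?_
      rw [Real.volume_Icc]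
    exact (tendsto_setLIntegral_zero hgi h1).eventually_lt_const one_pos
  obtain ⟨a, haR, ha1, ha⟩ := (hR.and_eventually (hsmall.and (Ioo_mem_nhdsLT hT))).exists
  have ha0 : a ∈ Ico 0 T := ⟨ha.1.le, ha.2⟩
  rw [Measure.restrict_restrict measurableSet_Icc,
    inter_eq_left.2 (Icc_subset_Icc_left ha0.1)] at ha1
  have key : ∀ b ∈ Ico a T, wsq s (coeff (u b)) ≤ M := by
    intro b hb
    by_contra! hlt
    have hb0 : b ∈ Ico 0 T := ⟨ha0.1.trans hb.1, hb.2⟩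
    have hbT : Icc 0 b ⊆ Icc 0 T := Icc_subset_Icc_right hb.2.le
    have hsol := (isSolution_iff hs1 hs hf hν hb0.1 (hζ.mono hbT) (hφ.mono hb.2.le)).1 (H b hb0)
    have hab : Icc a b ⊆ Icc 0 b := Icc_subset_Icc_left ha0.1
    have hzc : ContinuousOn (fun t => wsq s (coeff (u t))) (Icc a b) := by
      refine ContinuousOn.congr (f := fun t => parsevalConst d * ‖bessel (s : ℝ) (u t)‖ₑ ^ 2) ?_
        fun t ht => wsq_eq_enorm_bessel (hsol.memC.wsq_lt_top (hab ht))
      refine ENNReal.continuous_const_mul parsevalConst_ne_top |>.comp_continuousOn ?_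
      exact (ENNReal.continuous_pow 2).comp_continuousOn
        ((memC_iff.1 hsol.memC).2.mono hab).enorm
    -- the first time at which the level `M` is reached
    obtain ⟨r, ⟨hr, hrM⟩, hleast⟩ : ∃ r, IsLeast (Icc a b ∩ (fun t => wsq s (coeff (u t))) ⁻¹'
        Ici (M : ℝ≥0∞)) r :=
      (isCompact_Icc.of_isClosed_subset (hzc.preimage_isClosed_of_isClosed isClosed_Icc isClosed_Ici)
        inter_subset_left).exists_isLeast ⟨b, right_mem_Icc.2 hb.1, hlt.le⟩
    have hbelow : ∀ t ∈ Ico a r, wsq s (coeff (u t)) ≤ M := fun t ht => by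
      by_contra! h
      exact absurd (hleast ⟨⟨ht.1, ht.2.le.trans hr.2⟩, h.le⟩) (not_le.2 ht.2)
    have h1 := (hsol.linear.restrict ha0.1 hr.2).wsq_le hν (T := T) (by linarith [hr.2, hb.2, ha0.1])
      s (right_mem_Icc.2 hr.1)
    have h2 : ∫⁻ t in Icc a r, wsq ((s : ℝ) - 1) (force ν f (fun t => u t + ζ t) ζ φ t) ≤ 1 := by
      rw [setLIntegral_congr Ico_ae_eq_Icc.symm]
      refine le_trans ?_ ha1.le
      calc _ ≤ ∫⁻ t in Ico a r, g t := by
            refine setLIntegral_mono' measurableSet_Ico fun t ht => ?_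
            have htT : t ∈ Icc 0 T := ⟨ha0.1.trans ht.1, ht.2.le.trans (hr.2.trans hb.2.le)⟩
            refine (hC (fun t => u t + ζ t) ζ φ t ?_).trans ?_
            · refine (wsq_L2_add_le _ _ _).trans ?_
              rw [show ((2 * (M + N) : ℝ≥0) : ℝ≥0∞) = 2 * (M + N) by push_cast; rfl]
              gcongr
              · exact hbelow t ht
              · exact hN t htT
            · simp only [hg]
              gcongr
              exact hN₁ t htT
        _ ≤ _ := lintegral_mono_set (Ico_subset_Icc_self.trans
              (Icc_subset_Icc_right (hr.2.trans hb.2.le)))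
    have h3 : (M : ℝ≥0∞) ≤ ((L * (R + 1) : ℝ≥0) : ℝ≥0∞) := by
      rw [show ((L * (R + 1) : ℝ≥0) : ℝ≥0∞) = L * (R + 1) by push_cast; rfl]
      refine le_trans hrM (h1.trans ?_)
      gcongr
    have h4 : M ≤ L * (R + 1) := ENNReal.coe_le_coe.1 h3
    have h5 : L * (R + 1) < M := by
      rw [hM, add_assoc]
      exact lt_add_of_pos_right _ (by positivity)
    exact absurd h4 (not_le.2 h5)
  obtain ⟨M', hM'⟩ := (H a ha0).memX.1.exists_bound
  refine ⟨M + M', fun t ht => ?_⟩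
  rw [ENNReal.coe_add]
  rcases le_total t a with h | h
  · exact (hM' t ⟨ht.1, h⟩).trans le_add_self
  · exact (key t ⟨h, ht.2⟩).trans le_self_add

/-- Stability of solutions under perturbations of the data. The radius of the truncation is chosen so
that it affects neither the given solution nor the perturbed one. -/
lemma exists_stability (hs1 : 1 ≤ s) (hs : (d : ℝ) / 2 < s) (hf : ContDiff ℝ ∞ f)
    (hν : 0 < ν) (T : ℝ) (Λ : ℝ≥0) :
    ∃ δ C : ℝ≥0, 0 < δ ∧ 0 < C ∧ ∀ (u₀' : L2 d) (ζ' φ' u' : ℝ → L2 d) (u₀ : L2 d) (ζ φ : ℝ → L2 d),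
      0 ≤ T → MemC (s + 1) (Icc 0 T) ζ' → MemL2 (s - 1) T φ' →
      IsSolution s ν f T u₀' ζ' φ' u' → size s T ζ' φ' u' ≤ Λ →
      MemH s u₀ → MemC (s + 1) (Icc 0 T) ζ → MemL2 (s - 1) T φ →
      dataDist s T u₀ ζ φ u₀' ζ' φ' < δ →
      ∃ u, IsSolution s ν f T u₀ ζ φ u ∧
        normX s T (u - u') ≤ C * dataDist s T u₀ ζ φ u₀' ζ' φ' := by
  set M : ℝ≥0 := 2 * (Λ ^ 2 + 1) with hM
  have hMc : (M : ℝ≥0∞) = 2 * ((Λ : ℝ≥0∞) ^ 2 + 1) := by rw [hM]; push_cast; rfl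
  obtain ⟨R, hR, hRM⟩ := exists_norm_bessel_le d s M
  obtain ⟨K, hK⟩ := exists_normX_sub_le (d := d) hs1 hs hf hν T hR M
  refine ⟨min 1 (K + 1)⁻¹, K + 1, by positivity, by positivity, ?_⟩
  intro u₀' ζ' φ' u' u₀ ζ φ hT hζ' hφ' H hΛ hu₀ hζ hφ hD
  set D := dataDist s T u₀ ζ φ u₀' ζ' φ' with hDdef
  have hD1 : D ≤ 1 := hD.le.trans (by exact_mod_cast min_le_left _ _)
  have hDK : ((K + 1 : ℝ≥0) : ℝ≥0∞) * D ≤ 1 := by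
    have h1 : D ≤ (((K + 1)⁻¹ : ℝ≥0) : ℝ≥0∞) := hD.le.trans (by exact_mod_cast min_le_right _ _)
    refine (mul_le_mul' le_rfl h1).trans ?_
    rw [← ENNReal.coe_mul, mul_inv_cancel₀ (by positivity), ENNReal.coe_one]
  have hsum : ∀ {v w : L2 d}, wsq s (coeff w) ≤ (Λ : ℝ≥0∞) ^ 2 → wsq s (coeff (v - w : L2 d)) ≤ 1 →
      wsq s (coeff v) ≤ M := by
    intro v w hw hvw
    have := wsq_L2_add_le s w (v - w)
    rw [add_sub_cancel] at this
    rw [hMc]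
    exact this.trans (by gcongr)
  have hle : (Λ : ℝ≥0∞) ^ 2 ≤ M := by
    rw [hMc, two_mul]
    exact le_self_add.trans le_self_add
  have hu' : ∀ t ∈ Icc 0 T, wsq s (coeff (u' t)) ≤ (Λ : ℝ≥0∞) ^ 2 := fun t ht => by
    refine (wsq_le_normC_sq u' ht).trans ?_
    gcongr
    exact (le_self_add.trans le_add_self).trans hΛ
  have hζΛ : ∀ t ∈ Icc 0 T, wsq s (coeff (ζ' t)) ≤ (Λ : ℝ≥0∞) ^ 2 := fun t ht => by
    refine (wsq_mono (by push_cast; linarith) _).trans ((wsq_le_normC_sq (σ := s + 1) ζ' ht).trans ?_)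
    gcongr
    exact (le_self_add.trans le_self_add).trans hΛ
  have hζM : ∀ t ∈ Icc 0 T, wsq s (coeff (ζ t)) ≤ M := fun t ht => by
    refine hsum (hζΛ t ht) ?_
    refine (wsq_mono (by push_cast; linarith) _).trans
      ((wsq_le_normC_sq (σ := s + 1) (ζ - ζ') ht).trans ?_)
    refine pow_le_one₀ zero_le (le_trans ?_ hD1)
    exact le_add_self.trans le_self_add
  obtain ⟨w, hw⟩ := exists_solves_trunc hs1 hs hf hν hT hR hu₀ hζ hφ
  have hX := hK u₀ u₀' ζ φ ζ' φ' w u' hζM (fun t ht => (hζΛ t ht).trans hle) hw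
    (H.solves hs1 hs hf hν hT hR hζ' hφ' fun t ht => hRM _ ((hu' t ht).trans hle))
  have hX' : normX s T (w - u') ≤ ((K + 1 : ℝ≥0) : ℝ≥0∞) * D := hX.trans (by
    gcongr
    exact le_self_add)
  refine ⟨w, hw.isSolution hs1 hs hf hν hT hR hζ hφ fun t ht => hRM _ (hsum (hu' t ht) ?_), hX'⟩
  refine (wsq_le_normC_sq (w - u') ht).trans (pow_le_one₀ zero_le ?_)
  exact le_self_add.trans (hX'.trans hDK)

lemma size_lt_top {T : ℝ} {ζ φ u : ℝ → L2 d} (hζ : MemC (s + 1) (Icc 0 T) ζ)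
    (hφ : MemL2 (s - 1) T φ) (hu : MemX s T u) : size s T ζ φ u < ⊤ := by
  have h : ∀ {σ : ℕ} {v : ℝ → L2 d}, MemC σ (Icc 0 T) v → normC σ T v < ⊤ := by
    intro σ v hv
    obtain ⟨M, hM⟩ := hv.exists_bound
    refine (normC_le (B := (NNReal.sqrt M : ℝ≥0)) fun t ht => ?_).trans_lt ENNReal.coe_lt_top
    rw [← ENNReal.coe_pow, NNReal.sq_sqrt]
    exact hM t ht
  exact ENNReal.add_lt_top.2 ⟨ENNReal.add_lt_top.2 ⟨h hζ, hφ.2⟩,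
    ENNReal.add_lt_top.2 ⟨h hu.1, hu.2.2⟩⟩

end ParabolicTorus

end

theorem proposition1p1
    (d : ℕ) (hd : 1 ≤ d) (s : ℕ) (hs : (d : ℝ) / 2 < s)
    (ν : ℝ) (hν : 0 < ν)
    (p : ℕ) (hp : 2 ≤ p) (P : Polynomial ℝ) (hP : P.natDegree = p)
    (g : ℝ → ℝ) (hg : ContDiff ℝ ∞ g)
    (hgb : ∀ n : ℕ, ∃ M : ℝ, ∀ y : ℝ, |iteratedDeriv n g y| ≤ M)
    (f : ℝ → ℝ) (hf : ∀ y : ℝ, f y = P.eval y + g y) :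
    -- the constants depend only on `T` and `Λ` (and on `d, s, ν, f`), not on the data
    ∃ δ C : ℝ → ℝ≥0 → ℝ≥0, (∀ (T : ℝ) (Λ : ℝ≥0), 0 < T → 0 < δ T Λ ∧ 0 < C T Λ) ∧
      ∀ (u₀' : L2 d) (ζ' φ' : ℝ → L2 d),
        MemH s u₀' → MemC (s + 1) (Ici 0) ζ' → MemL2loc (s - 1) φ' →
        ∃ (Tmax : EReal) (u' : ℝ → L2 d), 0 < Tmax ∧
          -- existence before the maximal time
          (∀ T : ℝ, 0 < T → (T : EReal) < Tmax → IsSolution s ν f T u₀' ζ' φ' u') ∧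
          -- uniqueness, and maximality of `Tmax`
          (∀ (T : ℝ) (v : ℝ → L2 d), 0 < T → IsSolution s ν f T u₀' ζ' φ' v →
            (T : EReal) < Tmax ∧ EqOn v u' (Icc 0 T)) ∧
          -- blow-up
          (∀ T' : ℝ, Tmax = (T' : EReal) →
            Tendsto (fun t => sobNorm s (u' t)) (𝓝[<] T') (𝓝 ∞)) ∧
          -- stability
          (∀ T : ℝ, 0 < T → (T : EReal) < Tmax →
            ∃ Λ : ℝ≥0, (Λ : ℝ≥0∞) = size s T ζ' φ' u' ∧
            ∀ (u₀ : L2 d) (ζ φ : ℝ → L2 d),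
              MemH s u₀ → MemC (s + 1) (Icc 0 T) ζ → MemL2 (s - 1) T φ →
              dataDist s T u₀ ζ φ u₀' ζ' φ' < δ T Λ →
              ∃ u : ℝ → L2 d, IsSolution s ν f T u₀ ζ φ u ∧
                (∀ v : ℝ → L2 d, IsSolution s ν f T u₀ ζ φ v → EqOn v u (Icc 0 T)) ∧
                normX s T (u - u') ≤ C T Λ * dataDist s T u₀ ζ φ u₀' ζ' φ') := by
  have hs1 : 1 ≤ s := by
    have h1 : (1 : ℝ) ≤ d := by exact_mod_cast hd
    have h2 : (0 : ℝ) < s := by linarith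
    exact_mod_cast h2
  have hfs : ContDiff ℝ ∞ f := by
    rw [show f = fun y => P.eval y + g y from funext hf]
    have hP' : ContDiff ℝ ∞ fun y => P.eval y := by
      simpa [Polynomial.coe_aeval_eq_eval] using P.contDiff_aeval (𝕜 := ℝ) ∞
    exact hP'.add hg
  choose δ C hδ hC hstab using fun T Λ => exists_stability (d := d) hs1 hs hfs hν T Λ
  refine ⟨δ, C, fun T Λ _ => ⟨hδ T Λ, hC T Λ⟩, fun u₀' ζ' φ' hu₀ hζ hφ => ?_⟩
  have hζT : ∀ T : ℝ, MemC (s + 1) (Icc 0 T) ζ' := fun T => hζ.mono fun t ht => ht.1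
  have hφT : ∀ T : ℝ, MemL2 (s - 1) T φ' := fun T =>
    (hφ (max T 1) (lt_max_of_lt_right one_pos)).mono (le_max_left _ _)
  -- the times up to which there is a solution
  set S : Set ℝ := {T | 0 ≤ T ∧ ∃ u, IsSolution s ν f T u₀' ζ' φ' u} with hS
  have h0S : (0 : ℝ) ∈ S := ⟨le_rfl, exists_isSolution_zero hs1 hs hfs hν hu₀ (hζT 0) (hφT 0)⟩
  have hdown : ∀ T T' : ℝ, T ∈ S → 0 ≤ T' → T' ≤ T → T' ∈ S := fun T T' hT h0 h =>
    ⟨h0, hT.2.imp fun u hu => hu.restrict h⟩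
  have hup : ∀ T ∈ S, ∃ T' ∈ S, T < T' := fun T hT => by
    obtain ⟨u, hu⟩ := hT.2
    obtain ⟨T', hT', v, hv⟩ := hu.exists_extension hs1 hs hfs hν hT.1 (lt_add_one T) hu₀
      (hζT _) (hφT _)
    exact ⟨T', ⟨hT.1.trans hT'.le, v, hv⟩, hT'⟩
  set Tmax : EReal := ⨆ T ∈ S, (T : EReal) with hTmax
  have hlt : ∀ T : ℝ, 0 ≤ T → ((T : EReal) < Tmax ↔ T ∈ S) := fun T hT => by
    constructor
    · intro h
      obtain ⟨T', hT', h'⟩ := lt_biSup_iff.1 h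
      exact hdown T' T hT' hT (EReal.coe_lt_coe_iff.1 h').le
    · intro h
      obtain ⟨T', hT', h'⟩ := hup T h
      exact (EReal.coe_lt_coe_iff.2 h').trans_le (le_biSup (fun T : ℝ => (T : EReal)) hT')
  -- `u' t` is the value at time `t` of any solution on `[0, t]`, and `0` after the maximal time
  classical
  set u' : ℝ → L2 d := fun t => if h : t ∈ S then h.2.choose t else 0 with hu'
  have hu'eq : ∀ T ∈ S, ∀ v, IsSolution s ν f T u₀' ζ' φ' v → EqOn v u' (Icc 0 T) := by
    intro T hT v hv t ht
    have htS : t ∈ S := hdown T t hT ht.1 ht.2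
    rw [hu']
    simp only [dif_pos htS]
    exact (hv.restrict ht.2).eqOn hs1 hs hfs hν ht.1 (hζT t) (hφT t) htS.2.choose_spec
      (right_mem_Icc.2 ht.1)
  have hsol : ∀ T ∈ S, IsSolution s ν f T u₀' ζ' φ' u' := fun T hT => by
    obtain ⟨u, hu⟩ := hT.2
    exact hu.congr hs1 hs hfs hν hT.1 (hζT T) (hφT T) (hu'eq T hT u hu).symm
  refine ⟨Tmax, u', ?_, fun T hT h => hsol T ((hlt T hT.le).1 h), fun T v hT hv => ?_, ?_, ?_⟩
  · exact_mod_cast (hlt 0 le_rfl).2 h0S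
  · have hTS : T ∈ S := ⟨hT.le, v, hv⟩
    exact ⟨(hlt T hT.le).2 hTS, hu'eq T hTS v hv⟩
  · intro T' hT'
    have hpos : 0 < T' := by
      have := (hlt 0 le_rfl).2 h0S
      rw [hT'] at this
      exact_mod_cast this
    have hbefore : ∀ t ∈ Ico 0 T', IsSolution s ν f t u₀' ζ' φ' u' := fun t ht =>
      hsol t ((hlt t ht.1).1 (by rw [hT']; exact_mod_cast ht.2))
    rw [ENNReal.tendsto_nhds_top_iff_nnreal]
    intro R
    by_contra hR
    have hfr : ∃ᶠ t in 𝓝[<] T', wsq s (coeff (u' t)) ≤ ((R ^ 2 : ℝ≥0) : ℝ≥0∞) := by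
      refine (not_eventually.1 hR).mono fun t ht => ?_
      rw [← sobNorm_sq, ENNReal.coe_pow]
      gcongr
      exact not_lt.1 ht
    obtain ⟨M, hM⟩ := exists_bound_of_frequently hs1 hs hfs hν hpos (hζT T') (hφT T') hbefore hfr
    have hmem : T' ∈ S := ⟨hpos.le, exists_isSolution_of_bound hs1 hs hfs hν hpos hu₀ (hζT T')
      (hφT T') hbefore hM⟩
    have := (hlt T' hpos.le).2 hmem
    rw [hT'] at this
    exact lt_irrefl _ this
  · intro T hT h
    have hTs := hsol T ((hlt T hT.le).1 h)
    refine ⟨(size s T ζ' φ' u').toNNReal,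
      ENNReal.coe_toNNReal (size_lt_top (hζT T) (hφT T) hTs.memX).ne, ?_⟩
    intro u₀ ζ φ hu hζ₁ hφ₁ hD
    obtain ⟨u, husol, hle⟩ := hstab T _ u₀' ζ' φ' u' u₀ ζ φ hT.le (hζT T) (hφT T) hTs
      (ENNReal.coe_toNNReal (size_lt_top (hζT T) (hφT T) hTs.memX).ne).ge hu hζ₁ hφ₁ hD
    exact ⟨u, husol, fun v hv => hv.eqOn hs1 hs hfs hν hT.le hζ₁ hφ₁ husol, hle⟩
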